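/- \textbf{Setting.} All groups are finite. Let $\mathscr D$ be a finite set of cyclic groups and let $R$ be a commutative ring such that $|G|$ and $\varphi(|G|)$ are units in $R$ for all $G\in\mathscr D$, where $\varphi$ is Euler's totient function. For a group $X$ let $\mathscr S_X$ be its set of subgroups and $R\mathscr S_X$ the free $R$-module on $\mathscr S_X$. For $L\le G\times H$ let $p_1(L)\le G$, $p_2(L)\le H$ be the two projections of $L$, and put $k_1(L)=\{g\mid (g,1)\in L\}$, $k_2(L)=\{h\mid (1,h)\in L\}$, $s(L)=[p_1(L):k_1(L)]$, and $\mathscr P(L)=\{L'\le L\mid p_i(L')=p_i(L),\ i=1,2\}$. For $L\le G\times H$ and $M\le H\times K$ put $L*M=\{(g,k)\mid \exists h:(g,h)\in L,(h,k)\in M\}$ and $\kappa(L,M)=|k_2(L)\cap k_1(M)|/|H|$. \textbf{The algebras.} (1) $B(G,H)$ is the Grothendieck group of finite $(G,H)$-bisets with respect to disjoint union, and $RB(G,H)=R\otimes_{\mathbb Z} B(G,H)$. The $R$-algebra $B_R^{\mathscr D}=\bigoplus_{G,H\in\mathscr D}RB(G,H)$ has the multiplication induced by the tensor product $[X]\cdot[Y]=[X\times_H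 Y]$ for $X$ a $(G,H)$-biset and $Y$ an $(H,K)$-biset; the product of elements of $RB(G,H)$ and $RB(H',K)$ with $H\ne H'$ is $0$. (2) $\tilde A_R^{\mathscr D}=\bigoplus_{G,H\in\mathscr D}R\mathscr S_{G\times H}$, where the product of $L\le G\times H$ and $M\le H\times K$ is $\sum_{N\le G\times K}a_N^{L,M}N$ with $$a_N^{L,M}=\sum_{(L',M')\le(L,M),\ N\le L'*M'}\mu_{(L',M'),(L,M)}\,\kappa(L',M'),$$ $\mu$ here being the Möbius function of the poset $\mathscr S_{G\times H}\times\mathscr S_{H\times K}$; products of non-matching components are $0$. (3) $\tilde{\mathsf C}$ is the category with objects $(G,G')$, where $G'\le G\in\mathscr D$, with morphism set $\mathscr P(G'\times H')$ from $(H,H')$ to $(G,G')$ and with composition $L\circ M=L*M$. For a prime $p$ let a subscript $p$ denote Sylow $p$-subgroups. For $L\le G\times H$ and $M\le H\times K$ put $\lambda(L,M)=\prod_p\lambda_p(L,M)$, where $\lambda_p(L,M)=0$ if $p_2(L_p)\neq p_1(M_p)$, and otherwise $\lambda_p(L,M)=\varphi(|k_2(L_p)\cap k_1(M_p)|)/|H_p|$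 if $s(L_p)=1=s(M_p)$ and $\lambda_p(L,M)=|k_2(L_p)\cap k_1(M_p)|/|H_p|$ if not. For $L\le G\times H$ put $\mu(L)=\prod_p\mu_p(L)$, where $\mu_p(L)=\varphi(|p_1(L_p)|)/|H_p|$ if $s(L_p)=1$ and $\mu_p(L)=|k_1(L_p)|/|H_p|$ if $s(L_p)>1$. For a $2$-cocycle $\alpha$ of $\tilde{\mathsf C}$ with values in $R^\times$, the twisted category algebra $R_\alpha\tilde{\mathsf C}$ is the free $R$-module on the morphisms of $\tilde{\mathsf C}$, with $t\cdot s=\alpha(t,s)\,t\circ s$ if $t\circ s$ exists and $t\cdot s=0$ otherwise; $R\tilde{\mathsf C}$ is the case $\alpha=1$. (4) Let $k$ range over all divisors of the orders $|G|$, $G\in\mathscr D$; let $C_k$ be a cyclic group of order $k$, and let $n(k)$ be the number of sections $(P,K)$ (that is, $K\unlhd P\le G$) of groups $G\in\mathscr D$ with $P/K\cong C_k$. \textbf{Theorem.} On $\tilde{\mathsf C}$, $\lambda$ is a $2$-cocycle with values in $R^\times$, and there are $R$-algebra isomorphisms $$B_R^{\mathscr D}\xrightarrow{\ \gamma\ }\tilde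 A_R^{\mathscr D}\xrightarrow{\ \delta\ }R_\lambda\tilde{\mathsf C}\xrightarrow{\ \epsilon\ }R\tilde{\mathsf C}\xrightarrow{\ \omega\ }\prod_k \mathrm{Mat}_{n(k)}(R\,\mathrm{Aut}(C_k))$$ given as follows. \begin{itemize} \item On each component, $\gamma=\zeta\circ\alpha$, where $\alpha([X])=\sum_{x\in X}\mathrm{stab}_{G\times H}(x)$ and $\zeta(L)=\sum_{L'\le L}L'$. \item $\delta\bigl(\sum_{L'\in\mathscr P(L)}L'\bigr)=L$, viewed as a morphism from $(H,p_2(L))$ to $(G,p_1(L))$, for $G,H\in\mathscr D$ and $L\le G\times H$. \item $\epsilon(L)=\mu(L)\,L$ for every morphism $L$. \item For every numbering $\sigma^k_1,\dots,\sigma^k_{n(k)}$ of the sections isomorphic to $C_k$ and every choice of isomorphisms $\theta^k_m$ from $C_k$ to the quotient $P_m/K_m$ of $\sigma^k_m=(P_m,K_m)$, with $P_m\le G_m\in\mathscr D$, there is such an $\omega$ for which the $(m,n)$-entry of the $k$-th component of $\omega(s)$, for a morphism $s$, is the sum of all $a\in\mathrm{Aut}(C_k)$ with $t_k(m,a,n)\le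 s$. Here $t_k(m,a,n)$ is the morphism $\{(g,h)\in P_m\times P_n\mid \theta^k_m a(\theta^k_n)^{-1}(hK_n)=gK_m\}$ from $(G_n,P_n)$ to $(G_m,P_m)$, and $t\le s$ means that $t=s\circ e$ for an idempotent endomorphism $e$ of the domain of $s$. \end{itemize} In particular, if $R$ is a field then $B_R^{\mathscr D}$ is a semisimple $R$-algebra. -/

import Mathlib

set_option linter.unusedSectionVars false

universe u v w x

namespace DoubleBurnside

open scoped TensorProduct
open CategoryTheory

/-! ### The algebra of an `R`-linear category with finitely many objects -/

section LinearCategory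

/-- A small `R`-linear category with set of objects `ι`.
Here `Hom i j` is the module of morphisms from `j` to `i`. -/
structure LinCat (R : Type w) [CommRing R] (ι : Type v) where
  Hom : ι → ι → Type x
  [acg : ∀ i j, AddCommGroup (Hom i j)]
  [mod : ∀ i j, Module R (Hom i j)]
  comp : ∀ i j k, Hom i j →ₗ[R] Hom j k →ₗ[R] Hom i k
  one : ∀ i, Hom i i
  one_comp : ∀ i j (a : Hom i j), comp i i j (one i) a = a
  comp_one : ∀ i j (a : Hom i j), comp i j j a (one j) = a
  assoc : ∀ i j k l (a : Hom i j) (b : Hom j k) (c : Hom k l),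
    comp i k l (comp i j k a b) c = comp i j l a (comp j k l b c)

attribute [instance] LinCat.acg LinCat.mod

variable {R : Type w} [CommRing R] {ι : Type v}

/-- The direct sum of all `Hom i j`; for a finite set `ι` of objects, which is the only case used,
its elements are the families `(a i j)`. -/
def LinCat.Alg (A : LinCat.{v, w, x} R ι) : Type (max v x) := ∀ i j, A.Hom i j

namespace LinCat

variable (A : LinCat.{v, w, x} R ι)

instance : AddCommGroup A.Alg := inferInstanceAs (AddCommGroup (∀ i j, A.Hom i j))

instance : Module R A.Alg := inferInstanceAs (Module R (∀ i j, A.Hom i j))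

/-- The embedding of the summand `Hom i j`. -/
def of [DecidableEq ι] {A : LinCat.{v, w, x} R ι} (i j : ι) (a : A.Hom i j) : A.Alg :=
  Pi.single i (Pi.single j a)

variable [Fintype ι] [DecidableEq ι]

/-- The product of `a ∈ Hom i j` and `b ∈ Hom j' k` is the composition if `j = j'`
and `0` otherwise. -/
instance : Mul A.Alg := ⟨fun a b i k => ∑ j, A.comp i j k (a i j) (b j k)⟩

instance : One A.Alg := ⟨fun i => Pi.single i (A.one i)⟩

variable {A}

theorem mul_apply (a b : A.Alg) (i k : ι) :
    (a * b) i k = ∑ j, A.comp i j k (a i j) (b j k) := rfl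

theorem add_apply (a b : A.Alg) (i k : ι) : (a + b) i k = a i k + b i k := rfl

theorem smul_apply (r : R) (a : A.Alg) (i k : ι) : (r • a) i k = r • a i k := rfl

theorem zero_apply (i k : ι) : (0 : A.Alg) i k = 0 := rfl

theorem one_apply_self (i : ι) : (1 : A.Alg) i i = A.one i :=
  Pi.single_eq_same (M := fun j => A.Hom i j) i (A.one i)

theorem one_apply_ne {i j : ι} (h : j ≠ i) : (1 : A.Alg) i j = 0 :=
  Pi.single_eq_of_ne (M := fun j => A.Hom i j) h (A.one i)

@[ext] theorem ext {a b : A.Alg} (h : ∀ i j, a i j = b i j) : a = b :=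
  funext fun i => funext fun j => h i j

instance : Ring A.Alg where
  __ := (inferInstance : AddCommGroup A.Alg)
  left_distrib a b c := by
    ext i k; simp [mul_apply, add_apply, Finset.sum_add_distrib]
  right_distrib a b c := by
    ext i k; simp [mul_apply, add_apply, Finset.sum_add_distrib]
  zero_mul a := by ext i k; simp [mul_apply, zero_apply]
  mul_zero a := by ext i k; simp [mul_apply, zero_apply]
  mul_assoc a b c := by
    ext i l
    simp only [mul_apply, map_sum, LinearMap.sum_apply, A.assoc]
    exact Finset.sum_comm
  one_mul a := by
    ext i k
    rw [mul_apply, Finset.sum_eq_single i]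
    · rw [one_apply_self, A.one_comp]
    · intro j _ hj; rw [one_apply_ne hj]; simp
    · simp
  mul_one a := by
    ext i k
    rw [mul_apply, Finset.sum_eq_single k]
    · rw [one_apply_self, A.comp_one]
    · intro j _ hj; rw [one_apply_ne hj.symm]; simp
    · simp

instance : Algebra R A.Alg := Algebra.ofModule
  (fun r a b => by ext i k; simp [mul_apply, smul_apply, Finset.smul_sum])
  (fun r a b => by ext i k; simp [mul_apply, smul_apply, Finset.smul_sum])

end LinCat

end LinearCategory

/-! ### Bisets and double Burnside groups -/

section Bisets

/-- A finite `(G, H)`-biset; the right action of `h` is the action of `MulOpposite.op h`. -/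
structure Biset (G H : Type u) [Group G] [Group H] where
  carrier : Type u
  [finite : Finite carrier]
  [left : MulAction G carrier]
  [right : MulAction Hᵐᵒᵖ carrier]
  [comm : SMulCommClass G Hᵐᵒᵖ carrier]

attribute [instance] Biset.finite Biset.left Biset.right Biset.comm

variable {G H K I : Type u} [Group G] [Group H] [Group K] [Group I]

/-- Isomorphisms of bisets. -/
structure BisetIso (X Y : Biset G H) where
  toEquiv : X.carrier ≃ Y.carrier
  map_left : ∀ (g : G) (a : X.carrier), toEquiv (g • a) = g • toEquiv a
  map_right : ∀ (h : Hᵐᵒᵖ) (a : X.carrier), toEquiv (h • a) = h • toEquiv a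

namespace BisetIso

def refl (X : Biset G H) : BisetIso X X := ⟨Equiv.refl _, fun _ _ => rfl, fun _ _ => rfl⟩

def symm {X Y : Biset G H} (e : BisetIso X Y) : BisetIso Y X :=
  ⟨e.toEquiv.symm,
    fun g a => by rw [Equiv.symm_apply_eq, e.map_left, Equiv.apply_symm_apply],
    fun g a => by rw [Equiv.symm_apply_eq, e.map_right, Equiv.apply_symm_apply]⟩

def trans {X Y Z : Biset G H} (e : BisetIso X Y) (f : BisetIso Y Z) : BisetIso X Z :=
  ⟨e.toEquiv.trans f.toEquiv,
    fun g a => by simp [e.map_left, f.map_left],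
    fun g a => by simp [e.map_right, f.map_right]⟩

end BisetIso

variable (G H) in
instance bisetSetoid : Setoid (Biset G H) where
  r X Y := Nonempty (BisetIso X Y)
  iseqv := ⟨fun X => ⟨.refl X⟩, fun ⟨e⟩ => ⟨e.symm⟩, fun ⟨e⟩ ⟨f⟩ => ⟨e.trans f⟩⟩

/-- Disjoint union. -/
def Biset.sum (X Y : Biset G H) : Biset G H where
  carrier := X.carrier ⊕ Y.carrier

/-- The empty biset. -/
def Biset.empty (G H : Type u) [Group G] [Group H] : Biset G H where
  carrier := PEmpty
  left := { smul := fun _ a => a, one_smul := fun a => a.elim, mul_smul := fun _ _ a => a.elim }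
  right := { smul := fun _ a => a, one_smul := fun a => a.elim, mul_smul := fun _ _ a => a.elim }
  comm := @SMulCommClass.mk _ _ _ (_) (_) (fun _ _ a => a.elim)

def BisetIso.sumCongr {X X' Y Y' : Biset G H} (e : BisetIso X X') (f : BisetIso Y Y') :
    BisetIso (X.sum Y) (X'.sum Y') where
  toEquiv := Equiv.sumCongr e.toEquiv f.toEquiv
  map_left g a := by
    rcases a with a | a
    · exact congrArg Sum.inl (e.map_left g a)
    · exact congrArg Sum.inr (f.map_left g a)
  map_right g a := by
    rcases a with a | a
    · exact congrArg Sum.inl (e.map_right g a)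
    · exact congrArg Sum.inr (f.map_right g a)

/-- Isomorphism classes of finite `(G, H)`-bisets. -/
def BisetClass (G H : Type u) [Group G] [Group H] : Type (u + 1) := Quotient (bisetSetoid G H)

/-- The isomorphism class of a biset. -/
def Biset.cls (X : Biset G H) : BisetClass G H := Quotient.mk _ X

theorem Biset.cls_eq {X Y : Biset G H} (e : BisetIso X Y) : X.cls = Y.cls :=
  Quotient.sound ⟨e⟩

instance : Zero (BisetClass G H) := ⟨(Biset.empty G H).cls⟩

instance : Add (BisetClass G H) :=
  ⟨Quotient.map₂ Biset.sum fun _ _ ⟨e⟩ _ _ ⟨f⟩ => ⟨e.sumCongr f⟩⟩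

/-- Isomorphism classes of bisets form a commutative monoid under disjoint union. -/
instance : AddCommMonoid (BisetClass G H) where
  add_assoc := by
    rintro ⟨X⟩ ⟨Y⟩ ⟨Z⟩
    exact Quotient.sound ⟨⟨Equiv.sumAssoc _ _ _,
      by rintro g ((a | a) | a) <;> rfl, by rintro g ((a | a) | a) <;> rfl⟩⟩
  zero_add := by
    rintro ⟨X⟩
    exact Quotient.sound ⟨⟨Equiv.emptySum PEmpty X.carrier,
      by rintro g (a | a); exacts [a.elim, rfl], by rintro g (a | a); exacts [a.elim, rfl]⟩⟩
  add_zero := by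
    rintro ⟨X⟩
    exact Quotient.sound ⟨⟨Equiv.sumEmpty X.carrier PEmpty,
      by rintro g (a | a); exacts [rfl, a.elim], by rintro g (a | a); exacts [rfl, a.elim]⟩⟩
  add_comm := by
    rintro ⟨X⟩ ⟨Y⟩
    exact Quotient.sound ⟨⟨Equiv.sumComm _ _,
      by rintro g (a | a) <;> rfl, by rintro g (a | a) <;> rfl⟩⟩
  nsmul := nsmulRec

theorem Biset.cls_sum (X Y : Biset G H) : (X.sum Y).cls = X.cls + Y.cls := rfl

theorem Biset.cls_empty : (Biset.empty G H).cls = 0 := rfl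

/-- The orbit relation of the `H`-action `h (a, b) = (a h⁻¹, h b)` on `X × Y`. -/
def tensorSetoid (X : Biset G H) (Y : Biset H K) : Setoid (X.carrier × Y.carrier) where
  r p q := ∃ h : H, q = (MulOpposite.op h⁻¹ • p.1, h • p.2)
  iseqv := by
    refine ⟨fun p => ⟨1, by simp⟩, ?_, ?_⟩
    · rintro p _ ⟨h, rfl⟩
      refine ⟨h⁻¹, ?_⟩
      simp [smul_smul]
    · rintro p _ _ ⟨h, rfl⟩ ⟨h', rfl⟩
      refine ⟨h' * h, ?_⟩
      simp [smul_smul]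

/-- The tensor product `X ×_H Y` of bisets. -/
def Biset.tensor (X : Biset G H) (Y : Biset H K) : Biset G K where
  carrier := Quotient (tensorSetoid X Y)
  left :=
    { smul := fun g => Quotient.map (fun p => (g • p.1, p.2)) (by
        rintro p _ ⟨h, rfl⟩; exact ⟨h, by simp [smul_comm]⟩)
      one_smul := by
        rintro ⟨p⟩; exact congrArg (Quotient.mk _) (by simp)
      mul_smul := by
        rintro g g' ⟨p⟩; exact congrArg (Quotient.mk _) (by simp [mul_smul]) }
  right :=
    { smul := fun k => Quotient.map (fun p => (p.1, k • p.2)) (by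
        rintro p _ ⟨h, rfl⟩; exact ⟨h, by simp [smul_comm]⟩)
      one_smul := by
        rintro ⟨p⟩; exact congrArg (Quotient.mk _) (by simp)
      mul_smul := by
        rintro g g' ⟨p⟩; exact congrArg (Quotient.mk _) (by simp [mul_smul]) }
  comm := @SMulCommClass.mk _ _ _ (_) (_) (by rintro g k ⟨p⟩; rfl)

namespace Biset

/-- The element `a ×_H b` of the tensor product. -/
def tmk (X : Biset G H) (Y : Biset H K) (a : X.carrier) (b : Y.carrier) :
    (X.tensor Y).carrier := Quotient.mk (tensorSetoid X Y) (a, b)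

variable {X : Biset G H} {Y : Biset H K}

theorem tmk_rel (h : H) (a : X.carrier) (b : Y.carrier) :
    tmk X Y (MulOpposite.op h⁻¹ • a) (h • b) = tmk X Y a b :=
  (Quotient.sound (s := tensorSetoid X Y) (a := (a, b)) ⟨h, rfl⟩).symm

theorem tmk_bal (h : H) (a : X.carrier) (b : Y.carrier) :
    tmk X Y (MulOpposite.op h • a) b = tmk X Y a (h • b) := by
  rw [← tmk_rel h (MulOpposite.op h • a) b]; simp [smul_smul]

theorem tmk_left (g : G) (a : X.carrier) (b : Y.carrier) :
    g • tmk X Y a b = tmk X Y (g • a) b := rfl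

theorem tmk_right (k : Kᵐᵒᵖ) (a : X.carrier) (b : Y.carrier) :
    k • tmk X Y a b = tmk X Y a (k • b) := rfl

theorem tind {P : (X.tensor Y).carrier → Prop} (h : ∀ a b, P (tmk X Y a b)) : ∀ t, P t := by
  rintro ⟨a, b⟩; exact h a b

/-- Functions out of a tensor product. -/
def tlift {A : Type*} (f : X.carrier → Y.carrier → A)
    (hf : ∀ (h : H) a b, f (MulOpposite.op h • a) b = f a (h • b)) :
    (X.tensor Y).carrier → A :=
  Quotient.lift (fun p => f p.1 p.2) (by
    rintro p _ ⟨h, rfl⟩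
    simp [← hf, smul_smul])

@[simp] theorem tlift_tmk {A : Type*} (f : X.carrier → Y.carrier → A)
    (hf : ∀ (h : H) a b, f (MulOpposite.op h • a) b = f a (h • b)) (a : X.carrier)
    (b : Y.carrier) : tlift f hf (tmk X Y a b) = f a b := rfl

end Biset

open Biset

def BisetIso.tensorCongr {X X' : Biset G H} {Y Y' : Biset H K} (e : BisetIso X X')
    (f : BisetIso Y Y') : BisetIso (X.tensor Y) (X'.tensor Y') where
  toEquiv :=
    { toFun := tlift (fun a b => tmk X' Y' (e.toEquiv a) (f.toEquiv b)) (by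
        intro h a b; rw [e.map_right, f.map_left, tmk_bal])
      invFun := tlift (fun a b => tmk X Y (e.symm.toEquiv a) (f.symm.toEquiv b)) (by
        intro h a b; rw [e.symm.map_right, f.symm.map_left, tmk_bal])
      left_inv := tind fun a b => by simp [BisetIso.symm]
      right_inv := tind fun a b => by simp [BisetIso.symm] }
  map_left g := tind fun a b => by simp [tmk_left, e.map_left]
  map_right g := tind fun a b => by simp [tmk_right, f.map_right]

theorem tensor_sum_left (X X' : Biset G H) (Y : Biset H K) :
    ((X.sum X').tensor Y).cls = ((X.tensor Y).sum (X'.tensor Y)).cls := by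
  refine cls_eq ⟨
    { toFun := tlift (X := X.sum X') (fun a b => Sum.elim (fun a => Sum.inl (tmk X Y a b))
        (fun a => Sum.inr (tmk X' Y a b)) a) ?_
      invFun := fun t => Sum.elim
        (tlift (fun a b => tmk (X.sum X') Y (Sum.inl a) b) ?_)
        (tlift (fun a b => tmk (X.sum X') Y (Sum.inr a) b) ?_) t
      left_inv := ?_
      right_inv := ?_ }, ?_, ?_⟩
  · rintro h (a | a) b
    · exact congrArg Sum.inl (tmk_bal h a b)
    · exact congrArg Sum.inr (tmk_bal h a b)
  · intro h a b; exact tmk_bal (X := X.sum X') h (Sum.inl a) b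
  · intro h a b; exact tmk_bal (X := X.sum X') h (Sum.inr a) b
  · refine tind ?_
    rintro (a | a) b <;> rfl
  · rintro (t | t)
    · revert t; exact tind fun a b => rfl
    · revert t; exact tind fun a b => rfl
  · intro g; refine tind ?_
    rintro (a | a) b <;> rfl
  · intro g; refine tind ?_
    rintro (a | a) b <;> rfl

theorem tensor_sum_right (X : Biset G H) (Y Y' : Biset H K) :
    (X.tensor (Y.sum Y')).cls = ((X.tensor Y).sum (X.tensor Y')).cls := by
  refine cls_eq ⟨
    { toFun := tlift (Y := Y.sum Y') (fun a b => Sum.elim (fun b => Sum.inl (tmk X Y a b))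
        (fun b => Sum.inr (tmk X Y' a b)) b) ?_
      invFun := fun t => Sum.elim
        (tlift (fun a b => tmk X (Y.sum Y') a (Sum.inl b)) ?_)
        (tlift (fun a b => tmk X (Y.sum Y') a (Sum.inr b)) ?_) t
      left_inv := ?_
      right_inv := ?_ }, ?_, ?_⟩
  · rintro h a (b | b)
    · exact congrArg Sum.inl (tmk_bal h a b)
    · exact congrArg Sum.inr (tmk_bal h a b)
  · intro h a b; exact tmk_bal (Y := Y.sum Y') h a (Sum.inl b)
  · intro h a b; exact tmk_bal (Y := Y.sum Y') h a (Sum.inr b)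
  · refine tind ?_
    rintro a (b | b) <;> rfl
  · rintro (t | t)
    · revert t; exact tind fun a b => rfl
    · revert t; exact tind fun a b => rfl
  · intro g; refine tind ?_
    rintro a (b | b) <;> rfl
  · intro g; refine tind ?_
    rintro a (b | b) <;> rfl

theorem tensor_empty_left (Y : Biset H K) :
    ((Biset.empty G H).tensor Y).cls = (Biset.empty G K).cls := by
  have h : IsEmpty ((Biset.empty G H).tensor Y).carrier := ⟨tind fun a _ => PEmpty.elim a⟩
  exact cls_eq ⟨Equiv.equivPEmpty _, fun _ a => h.elim a, fun _ a => h.elim a⟩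

theorem tensor_empty_right (X : Biset G H) :
    (X.tensor (Biset.empty H K)).cls = (Biset.empty G K).cls := by
  have h : IsEmpty (X.tensor (Biset.empty H K)).carrier := ⟨tind fun _ b => PEmpty.elim b⟩
  exact cls_eq ⟨Equiv.equivPEmpty _, fun _ a => h.elim a, fun _ a => h.elim a⟩

theorem tensor_assoc (X : Biset G H) (Y : Biset H K) (Z : Biset K I) :
    ((X.tensor Y).tensor Z).cls = (X.tensor (Y.tensor Z)).cls := by
  refine cls_eq ⟨
    { toFun := tlift (fun t c => tlift (fun a b => tmk X (Y.tensor Z) a (tmk Y Z b c)) ?_ t) ?_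
      invFun := tlift (fun a t => tlift (fun b c => tmk (X.tensor Y) Z (tmk X Y a b) c) ?_ t) ?_
      left_inv := ?_
      right_inv := ?_ }, ?_, ?_⟩
  · intro h a b
    rw [tmk_bal]; rfl
  · intro h t c
    revert t
    refine tind fun a b => ?_
    rw [tmk_right, tlift_tmk, tlift_tmk, tmk_bal]
  · intro h b c
    rw [← tmk_right, tmk_bal]
  · intro h a t
    revert t
    refine tind fun b c => ?_
    rw [tmk_left, tlift_tmk, tlift_tmk, tmk_bal]
  · refine tind fun t c => ?_
    revert t
    exact tind fun a b => rfl
  · refine tind fun a t => ?_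
    revert t
    exact tind fun b c => rfl
  · refine fun g => tind fun t c => ?_
    revert t
    exact tind fun a b => rfl
  · refine fun g => tind fun t c => ?_
    revert t
    exact tind fun a b => rfl

/-- The `(G, G)`-biset `G`. -/
def Biset.regular (G : Type u) [Group G] [Finite G] : Biset G G where
  carrier := G

theorem regular_tensor [Finite G] (X : Biset G H) : ((Biset.regular G).tensor X).cls = X.cls := by
  refine cls_eq ⟨
    { toFun := tlift (X := Biset.regular G) (fun (g : G) a => g • a) ?_
      invFun := fun a => tmk (Biset.regular G) X (1 : G) a
      left_inv := ?_
      right_inv := ?_ }, ?_, ?_⟩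
  · intro h a b; exact mul_smul (α := G) a h b
  · refine tind fun (g : G) a => ?_
    refine (tmk_bal (X := Biset.regular G) g (1 : G) a).symm.trans ?_
    exact congrArg (fun z => tmk (Biset.regular G) X z a) (one_mul g)
  · intro a; exact one_smul G a
  · refine fun g => tind fun (g' : G) a => ?_
    exact mul_smul g g' a
  · refine fun h => tind fun (g' : G) a => ?_
    exact smul_comm g' h a

theorem tensor_regular [Finite H] (X : Biset G H) : (X.tensor (Biset.regular H)).cls = X.cls := by
  refine cls_eq ⟨
    { toFun := tlift (Y := Biset.regular H) (fun a (h : H) => MulOpposite.op h • a) ?_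
      invFun := fun a => tmk X (Biset.regular H) a (1 : H)
      left_inv := ?_
      right_inv := ?_ }, ?_, ?_⟩
  · intro h a (b : H)
    change MulOpposite.op b • MulOpposite.op h • a = MulOpposite.op (h * b) • a
    rw [smul_smul, MulOpposite.op_mul]
  · refine tind fun a (h : H) => ?_
    refine (tmk_bal (Y := Biset.regular H) h a (1 : H)).trans ?_
    exact congrArg (fun z => tmk X (Biset.regular H) a z) (mul_one h)
  · intro a; exact one_smul Hᵐᵒᵖ a
  · refine fun g => tind fun a (h : H) => ?_
    exact (smul_comm g (MulOpposite.op h) a).symm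
  · refine fun h => tind fun a (h' : H) => ?_
    change MulOpposite.op (h' * h.unop) • a = h • MulOpposite.op h' • a
    rw [smul_smul, MulOpposite.op_mul, MulOpposite.op_unop]

/-- The tensor product on isomorphism classes, as a biadditive map. -/
def tensorClass (G H K : Type u) [Group G] [Group H] [Group K] :
    BisetClass G H →+ BisetClass H K →+ BisetClass G K where
  toFun := Quotient.lift (fun X =>
      { toFun := Quotient.lift (fun Y => (X.tensor Y).cls)
          (fun _ _ ⟨f⟩ => cls_eq ((BisetIso.refl X).tensorCongr f))
        map_zero' := tensor_empty_right X
        map_add' := by rintro ⟨Y⟩ ⟨Y'⟩; exact tensor_sum_right X Y Y' })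
    (by
      rintro X X' ⟨e⟩
      ext ⟨Y⟩
      exact cls_eq (e.tensorCongr (BisetIso.refl Y)))
  map_zero' := by ext ⟨Y⟩; exact tensor_empty_left Y
  map_add' := by rintro ⟨X⟩ ⟨X'⟩; ext ⟨Y⟩; exact tensor_sum_left X X' Y

theorem tensorClass_cls (X : Biset G H) (Y : Biset H K) :
    tensorClass G H K X.cls Y.cls = (X.tensor Y).cls := rfl

/-- The double Burnside group `B(G, H)`. -/
abbrev B (G H : Type u) [Group G] [Group H] : Type (u + 1) :=
  Algebra.GrothendieckAddGroup (BisetClass G H)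

/-- The element `[X]` of `B(G, H)`. -/
def bcls (X : Biset G H) : B G H := Algebra.GrothendieckAddGroup.of X.cls

theorem B_hom_ext {A : Type*} [AddCommGroup A] {f g : B G H →+ A}
    (h : ∀ X : Biset G H, f (bcls X) = g (bcls X)) : f = g := by
  apply Algebra.GrothendieckAddGroup.lift.symm.injective
  ext ⟨X⟩
  exact h X

theorem lift_bcls {A : Type*} [AddCommGroup A] (f : BisetClass G H →+ A) (X : Biset G H) :
    Algebra.GrothendieckAddGroup.lift f (bcls X) = f X.cls :=
  DFunLike.congr_fun (Algebra.GrothendieckAddGroup.lift.symm_apply_apply f) X.cls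

/-- The biadditive map `B(G, H) × B(H, K) → B(G, K)` with `([X], [Y]) ↦ [X ×_H Y]`. -/
noncomputable def tensorB (G H K : Type u) [Group G] [Group H] [Group K] :
    B G H →+ B H K →+ B G K :=
  Algebra.GrothendieckAddGroup.lift
    (AddMonoidHom.flip (Algebra.GrothendieckAddGroup.lift (AddMonoidHom.flip
      ((Algebra.GrothendieckAddGroup.of (M := BisetClass G K)).compHom.comp
        (tensorClass G H K)))))

theorem tensorB_bcls (X : Biset G H) (Y : Biset H K) :
    tensorB G H K (bcls X) (bcls Y) = bcls (X.tensor Y) := by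
  rw [tensorB, lift_bcls, AddMonoidHom.flip_apply, lift_bcls]
  rfl

variable (R : Type w) [CommRing R]

/-- `R B(G, H)`. -/
abbrev RB (G H : Type u) [Group G] [Group H] : Type (max w (u + 1)) := R ⊗[ℤ] B G H

/-- The `R`-bilinear extension of the tensor product. -/
noncomputable def tensorRB (G H K : Type u) [Group G] [Group H] [Group K] :
    RB R G H →ₗ[R] RB R H K →ₗ[R] RB R G K :=
  LinearMap.liftBaseChange R (AddMonoidHom.toIntLinearMap
    { toFun := fun a => LinearMap.baseChange R (tensorB G H K a).toIntLinearMap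
      map_zero' := by ext; simp
      map_add' := fun a b => by ext; simp [TensorProduct.tmul_add] })

theorem tensorRB_tmul (r s : R) (a : B G H) (b : B H K) :
    tensorRB R G H K (r ⊗ₜ a) (s ⊗ₜ b) = (r * s) ⊗ₜ tensorB G H K a b := by
  simp [tensorRB, TensorProduct.smul_tmul']

theorem tensorB_assoc (a : B G H) (b : B H K) (c : B K I) :
    tensorB G K I (tensorB G H K a b) c = tensorB G H I a (tensorB H K I b c) := by
  have h1 : ((tensorB G K I).compHom.comp (tensorB G H K) : B G H →+ B H K →+ B K I →+ B G I) =
      { toFun := fun a => (AddMonoidHom.compHom (tensorB G H I a)).comp (tensorB H K I)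
        map_zero' := by ext; simp
        map_add' := fun a b => by ext; simp } := by
    refine B_hom_ext fun X => B_hom_ext fun Y => B_hom_ext fun Z => ?_
    change tensorB G K I (tensorB G H K _ _) _ = tensorB G H I _ (tensorB H K I _ _)
    simp only [tensorB_bcls]
    exact congrArg Algebra.GrothendieckAddGroup.of (tensor_assoc X Y Z)
  exact DFunLike.congr_fun (DFunLike.congr_fun (DFunLike.congr_fun h1 a) b) c

theorem regular_tensorB [Finite G] (a : B G H) : tensorB G G H (bcls (.regular G)) a = a := by
  have : tensorB G G H (bcls (.regular G)) = AddMonoidHom.id _ :=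
    B_hom_ext fun X => by
      rw [tensorB_bcls]; exact congrArg Algebra.GrothendieckAddGroup.of (regular_tensor X)
  exact DFunLike.congr_fun this a

theorem tensorB_regular [Finite H] (a : B G H) : tensorB G H H a (bcls (.regular H)) = a := by
  have : (tensorB G H H).flip (bcls (.regular H)) = AddMonoidHom.id _ :=
    B_hom_ext fun X => by
      rw [AddMonoidHom.flip_apply, tensorB_bcls]; exact congrArg Algebra.GrothendieckAddGroup.of (tensor_regular X)
  exact DFunLike.congr_fun this a

/-- The `R`-linear category with set of objects given by the groups `G i`, morphism modules
`R B(G i, G j)` and composition induced by the tensor product of bisets. -/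
noncomputable def bisetCat {ι : Type v} (G : ι → Type u) [∀ i, Group (G i)] [∀ i, Finite (G i)] :
    LinCat.{v, w, max w (u + 1)} R ι where
  Hom i j := RB R (G i) (G j)
  comp i j k := tensorRB R (G i) (G j) (G k)
  one i := 1 ⊗ₜ bcls (.regular (G i))
  one_comp i j a := by
    induction a using TensorProduct.induction_on with
    | zero => simp
    | tmul r a => rw [tensorRB_tmul, one_mul, regular_tensorB]
    | add a b ha hb => rw [map_add, ha, hb]
  comp_one i j a := by
    induction a using TensorProduct.induction_on with
    | zero => simp
    | tmul r a => rw [tensorRB_tmul, mul_one, tensorB_regular]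
    | add a b ha hb => rw [map_add, LinearMap.add_apply, ha, hb]
  assoc i j k l a b c := by
    induction a using TensorProduct.induction_on with
    | zero => simp
    | add a a' ha hb => simp only [map_add, LinearMap.add_apply, ha, hb]
    | tmul r a =>
      induction b using TensorProduct.induction_on with
      | zero => simp
      | add a a' ha hb => simp only [map_add, LinearMap.add_apply, ha, hb]
      | tmul s b =>
        induction c using TensorProduct.induction_on with
        | zero => simp
        | add a a' ha hb => simp only [map_add, ha, hb]
        | tmul t c => simp only [tensorRB_tmul, tensorB_assoc, mul_assoc]

/-- The algebra `⊕ R B(G i, G j)`. -/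
abbrev BAlg {ι : Type v} (G : ι → Type u) [∀ i, Group (G i)] [∀ i, Finite (G i)] :
    Type (max v w (u + 1)) := (bisetCat R G).Alg

end Bisets

/-! ### Subgroups of direct products -/

section Subgroups

variable {G H K I : Type u} [Group G] [Group H] [Group K] [Group I]

/-- The first projection `p₁(L)`. -/
def p1 (L : Subgroup (G × H)) : Subgroup G := L.map (MonoidHom.fst G H)

/-- The second projection `p₂(L)`. -/
def p2 (L : Subgroup (G × H)) : Subgroup H := L.map (MonoidHom.snd G H)

/-- `k₁(L) = {g | (g, 1) ∈ L}`. -/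
def k1 (L : Subgroup (G × H)) : Subgroup G := L.comap (MonoidHom.inl G H)

/-- `k₂(L) = {h | (1, h) ∈ L}`. -/
def k2 (L : Subgroup (G × H)) : Subgroup H := L.comap (MonoidHom.inr G H)

theorem mem_p1 {L : Subgroup (G × H)} {g : G} : g ∈ p1 L ↔ ∃ h, (g, h) ∈ L := by
  simp [p1, Subgroup.mem_map]

theorem mem_p2 {L : Subgroup (G × H)} {h : H} : h ∈ p2 L ↔ ∃ g, (g, h) ∈ L := by
  simp [p2, Subgroup.mem_map]

theorem mem_k1 {L : Subgroup (G × H)} {g : G} : g ∈ k1 L ↔ (g, 1) ∈ L := Iff.rfl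

theorem mem_k2 {L : Subgroup (G × H)} {h : H} : h ∈ k2 L ↔ (1, h) ∈ L := Iff.rfl

/-- The index `s(L) = [p₁(L) : k₁(L)]`. -/
noncomputable def sIndex (L : Subgroup (G × H)) : ℕ := (k1 L).relIndex (p1 L)

/-- The composition `L * M`. -/
def star (L : Subgroup (G × H)) (M : Subgroup (H × K)) : Subgroup (G × K) where
  carrier := {p | ∃ h : H, (p.1, h) ∈ L ∧ (h, p.2) ∈ M}
  one_mem' := ⟨1, L.one_mem, M.one_mem⟩
  mul_mem' := by
    rintro p q ⟨h, h1, h2⟩ ⟨h', h1', h2'⟩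
    exact ⟨h * h', L.mul_mem h1 h1', M.mul_mem h2 h2'⟩
  inv_mem' := by
    rintro p ⟨h, h1, h2⟩
    exact ⟨h⁻¹, L.inv_mem h1, M.inv_mem h2⟩

theorem mem_star {L : Subgroup (G × H)} {M : Subgroup (H × K)} {p : G × K} :
    p ∈ star L M ↔ ∃ h : H, (p.1, h) ∈ L ∧ (h, p.2) ∈ M := Iff.rfl

theorem star_assoc (L : Subgroup (G × H)) (M : Subgroup (H × K)) (N : Subgroup (K × I)) :
    star (star L M) N = star L (star M N) := by
  ext ⟨g, i⟩
  simp only [mem_star]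
  constructor
  · rintro ⟨k, ⟨h, h1, h2⟩, h3⟩; exact ⟨h, h1, k, h2, h3⟩
  · rintro ⟨h, h1, k, h2, h3⟩; exact ⟨k, ⟨h, h1, h2⟩, h3⟩

/-- The diagonal subgroup `Δ(U)` of `G × G`, for a subgroup `U` of `G`. -/
def diag (U : Subgroup G) : Subgroup (G × G) where
  carrier := {p | p.1 ∈ U ∧ p.1 = p.2}
  one_mem' := ⟨U.one_mem, rfl⟩
  mul_mem' := by
    rintro p q ⟨h1, h2⟩ ⟨h1', h2'⟩
    exact ⟨U.mul_mem h1 h1', by simp [h2, h2']⟩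
  inv_mem' := by
    rintro p ⟨h1, h2⟩
    exact ⟨U.inv_mem h1, by simp [h2]⟩

theorem mem_diag {U : Subgroup G} {p : G × G} : p ∈ diag U ↔ p.1 ∈ U ∧ p.1 = p.2 := Iff.rfl

theorem diag_star {U : Subgroup G} {L : Subgroup (G × H)} (h : p1 L ≤ U) :
    star (diag U) L = L := by
  ext ⟨g, k⟩
  simp only [mem_star, mem_diag]
  constructor
  · rintro ⟨g', ⟨_, rfl⟩, h2⟩; exact h2
  · intro h2; exact ⟨g, ⟨h (mem_p1.2 ⟨k, h2⟩), rfl⟩, h2⟩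

theorem star_diag {U : Subgroup H} {L : Subgroup (G × H)} (h : p2 L ≤ U) :
    star L (diag U) = L := by
  ext ⟨g, k⟩
  simp only [mem_star, mem_diag]
  constructor
  · rintro ⟨g', h2, ⟨_, rfl⟩⟩; exact h2
  · intro h2; exact ⟨k, h2, h (mem_p2.2 ⟨g, h2⟩), rfl⟩

/-- `𝒫(L)`: the subgroups of `L` with the same projections as `L`. -/
def fullSub (L : Subgroup (G × H)) : Set (Subgroup (G × H)) :=
  {L' | L' ≤ L ∧ p1 L' = p1 L ∧ p2 L' = p2 L}

end Subgroups

/-! ### The Möbius function -/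

section Moebius

open Classical in
/-- The Möbius function of a finite partially ordered set. -/
noncomputable def moebius {X : Type*} [PartialOrder X] [Fintype X] (a b : X) : ℤ :=
  letI : LocallyFiniteOrder X := Fintype.toLocallyFiniteOrder
  IncidenceAlgebra.mu ℤ a b

open Classical in
theorem sum_moebius {X : Type*} [PartialOrder X] [Fintype X] (a b : X) :
    (∑ y : X, if a ≤ y ∧ y ≤ b then moebius a y else 0) = if a = b then 1 else 0 := by
  let : LocallyFiniteOrder X := Fintype.toLocallyFiniteOrder
  rw [← IncidenceAlgebra.sum_Icc_mu_right (𝕜 := ℤ) a b, ← Finset.sum_filter]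
  refine Finset.sum_congr ?_ fun _ _ => rfl
  ext y; simp

open Classical in
theorem moebius_inversion {X : Type*} [PartialOrder X] [Fintype X] {R : Type*} [CommRing R]
    (f : X → R) (z : X) :
    (∑ y : X, if y ≤ z then (∑ x : X, if x ≤ y then (moebius x y : R) * f x else 0) else 0)
      = f z := by
  have h : ∀ x : X, (∑ y : X, if y ≤ z then (if x ≤ y then (moebius x y : R) * f x else 0) else 0)
      = if x = z then f x else 0 := by
    intro x
    have := congrArg (fun n : ℤ => (n : R) * f x) (sum_moebius x z)
    simp only [Int.cast_sum, Finset.sum_mul] at this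
    rw [show (if x = z then f x else 0) = (((if x = z then 1 else 0 : ℤ)) : R) * f x by
      split_ifs <;> simp, ← this]
    refine Finset.sum_congr rfl fun y _ => ?_
    by_cases h1 : y ≤ z <;> by_cases h2 : x ≤ y <;> simp [h1, h2]
  calc _ = ∑ y : X, ∑ x : X,
        if y ≤ z then (if x ≤ y then (moebius x y : R) * f x else 0) else 0 := by
        refine Finset.sum_congr rfl fun y _ => ?_
        split_ifs <;> simp
    _ = _ := by rw [Finset.sum_comm]; simp [h]

end Moebius

/-! ### The algebra on subgroups -/

section SubgroupAlgebra

/-- A finite group has finitely many subgroups. -/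
noncomputable instance subgroupFintype {X : Type*} [Group X] [Finite X] : Fintype (Subgroup X) :=
  Fintype.ofFinite _

variable (R : Type w) [CommRing R]

/-- The free `R`-module on the set of subgroups of `X`. -/
abbrev RS (X : Type u) [Group X] : Type (max u w) := Subgroup X →₀ R

open Classical in
/-- The map `ζ`, sending `U` to the sum of all subgroups of `U`. -/
noncomputable def zetaMap (X : Type u) [Group X] [Finite X] : RS R X →ₗ[R] RS R X :=
  Finsupp.linearCombination R fun U : Subgroup X =>
    ∑ U' : Subgroup X, if U' ≤ U then Finsupp.single U' (1 : R) else 0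

variable {G H K I : Type u} [Group G] [Group H] [Group K] [Group I]

/-- `κ(L, M) = |k₂(L) ∩ k₁(M)| / |H|`. -/
noncomputable def kappa (L : Subgroup (G × H)) (M : Subgroup (H × K)) : R :=
  (Nat.card (k2 L ⊓ k1 M : Subgroup H) : R) * Ring.inverse (Nat.card H : R)

variable [Finite G] [Finite H] [Finite K] [Finite I]

open Classical in
/-- The coefficient `a_N^{L, M}`. -/
noncomputable def coeffA (L : Subgroup (G × H)) (M : Subgroup (H × K)) (N : Subgroup (G × K)) : R :=
  ∑ x : Subgroup (G × H) × Subgroup (H × K),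
    if x ≤ (L, M) ∧ N ≤ star x.1 x.2 then (moebius x (L, M) : R) * kappa R x.1 x.2 else 0

variable (G H K) in
/-- The bilinear map `L ⋆ M = ∑_N a_N^{L, M} N`. -/
noncomputable def tildeMul : RS R (G × H) →ₗ[R] RS R (H × K) →ₗ[R] RS R (G × K) :=
  Finsupp.linearCombination R fun L => Finsupp.linearCombination R fun M =>
    ∑ N : Subgroup (G × K), Finsupp.single N (coeffA R L M N)

variable (G H K) in
/-- The bilinear map with `(L, M) ↦ κ(L, M) (L * M)`. -/
noncomputable def kappaMul : RS R (G × H) →ₗ[R] RS R (H × K) →ₗ[R] RS R (G × K) :=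
  Finsupp.linearCombination R fun L => Finsupp.linearCombination R fun M =>
    Finsupp.single (star L M) (kappa R L M)

theorem kappaMul_single (L : Subgroup (G × H)) (M : Subgroup (H × K)) :
    kappaMul R G H K (Finsupp.single L 1) (Finsupp.single M 1) =
      Finsupp.single (star L M) (kappa R L M) := by
  simp [kappaMul]

theorem RS_hom_ext {X : Type*} {A : Type*} [AddCommGroup A] [Module R A]
    {f g : (X →₀ R) →ₗ[R] A} (h : ∀ L, f (Finsupp.single L 1) = g (Finsupp.single L 1)) : f = g := by
  ext L; simpa using h L

open Classical in
theorem zetaMap_single (X : Type u) [Group X] [Finite X] (U : Subgroup X) :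
    zetaMap R X (Finsupp.single U 1) =
      ∑ U' : Subgroup X, if U' ≤ U then Finsupp.single U' (1 : R) else 0 := by
  simp [zetaMap]

theorem tildeMul_zeta_single (L : Subgroup (G × H)) (M : Subgroup (H × K)) :
    tildeMul R G H K (zetaMap R _ (Finsupp.single L 1)) (zetaMap R _ (Finsupp.single M 1)) =
      zetaMap R _ (Finsupp.single (star L M) (kappa R L M)) := by
  classical
  have e1 : (Finsupp.single (star L M) (kappa R L M) : RS R (G × K)) =
      kappa R L M • Finsupp.single (star L M) 1 := by simp
  rw [e1, map_smul, zetaMap_single, zetaMap_single, zetaMap_single]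
  ext N
  have key := moebius_inversion (R := R)
    (fun x : Subgroup (G × H) × Subgroup (H × K) =>
      if N ≤ star x.1 x.2 then kappa R x.1 x.2 else 0) (L, M)
  have hb : ∀ (L' : Subgroup (G × H)) (M' : Subgroup (H × K)),
      (tildeMul R G H K (Finsupp.single L' 1) (Finsupp.single M' 1)) N = coeffA R L' M' N := by
    intro L' M'
    simp [tildeMul, Finsupp.finsetSum_apply, Finsupp.single_apply]
  have hL : (tildeMul R G H K
      (∑ U' : Subgroup (G × H), if U' ≤ L then Finsupp.single U' (1 : R) else 0)
      (∑ U' : Subgroup (H × K), if U' ≤ M then Finsupp.single U' (1 : R) else 0)) N =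
      ∑ L' : Subgroup (G × H), ∑ M' : Subgroup (H × K),
        if (L', M') ≤ (L, M) then coeffA R L' M' N else 0 := by
    simp only [map_sum, LinearMap.sum_apply, Finsupp.finsetSum_apply]
    rw [Finset.sum_comm]
    refine Finset.sum_congr rfl fun L' _ => Finset.sum_congr rfl fun M' _ => ?_
    by_cases h1 : L' ≤ L <;> by_cases h2 : M' ≤ M <;> simp [h1, h2, hb]
  rw [hL]
  have hR : (kappa R L M • ∑ U' : Subgroup (G × K),
      if U' ≤ star L M then Finsupp.single U' (1 : R) else 0) N =
      if N ≤ star L M then kappa R L M else 0 := by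
    rw [Finsupp.smul_apply, Finsupp.finsetSum_apply, Finset.sum_eq_single N]
    · split_ifs <;> simp
    · intro b _ hb'; split_ifs <;> simp [hb']
    · simp
  rw [hR, ← key, Fintype.sum_prod_type]
  refine Finset.sum_congr rfl fun L' _ => Finset.sum_congr rfl fun M' _ => ?_
  split_ifs with h
  · unfold coeffA
    refine Finset.sum_congr rfl fun x _ => ?_
    by_cases h1 : x ≤ (L', M') <;> by_cases h2 : N ≤ star x.1 x.2 <;> simp [h1, h2]
  · rfl

theorem tildeMul_zeta (a : RS R (G × H)) (b : RS R (H × K)) :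
    tildeMul R G H K (zetaMap R _ a) (zetaMap R _ b) = zetaMap R _ (kappaMul R G H K a b) := by
  have h : (tildeMul R G H K).compl₁₂ (zetaMap R (G × H)) (zetaMap R (H × K)) =
      (kappaMul R G H K).compr₂ (zetaMap R (G × K)) := by
    refine RS_hom_ext R fun L => RS_hom_ext R fun M => ?_
    simp only [LinearMap.compl₁₂_apply, LinearMap.compr₂_apply, kappaMul_single]
    exact tildeMul_zeta_single R L M
  exact DFunLike.congr_fun (DFunLike.congr_fun h a) b

theorem zetaMap_surjective (X : Type u) [Group X] [Finite X] :
    Function.Surjective (zetaMap R X) := by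
  classical
  rw [← LinearMap.range_eq_top, eq_top_iff]
  have h : ∀ U : Subgroup X, Finsupp.single U (1 : R) ∈ LinearMap.range (zetaMap R X) := by
    intro U
    induction U using WellFoundedLT.induction with
    | ind U ih =>
      have h1 : (Finsupp.single U (1 : R) : RS R X) = zetaMap R X (Finsupp.single U 1) -
          ∑ U' : Subgroup X, if U' < U then Finsupp.single U' (1 : R) else 0 := by
        rw [zetaMap_single, eq_sub_iff_add_eq]
        rw [← Finset.sum_filter, ← Finset.sum_filter]
        rw [show (Finset.univ.filter fun U' : Subgroup X => U' ≤ U) =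
          insert U (Finset.univ.filter fun U' : Subgroup X => U' < U) by
            ext V; simp [le_iff_eq_or_lt]]
        rw [Finset.sum_insert (by simp)]
      rw [h1]
      refine Submodule.sub_mem _ ⟨_, rfl⟩ (Submodule.sum_mem _ fun V _ => ?_)
      split_ifs with hV
      · exact ih V hV
      · exact Submodule.zero_mem _
  intro a _
  induction a using Finsupp.induction_linear with
  | zero => exact Submodule.zero_mem _
  | add a b ha hb => exact Submodule.add_mem _ (ha trivial) (hb trivial)
  | single U r =>
    rw [show (Finsupp.single U r : RS R X) = r • Finsupp.single U 1 by simp]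
    exact Submodule.smul_mem _ _ (h U)

theorem card_cocycle (L : Subgroup (G × H)) (M : Subgroup (H × K)) (N : Subgroup (K × I)) :
    Nat.card (k2 L ⊓ k1 M : Subgroup H) * Nat.card (k2 (star L M) ⊓ k1 N : Subgroup K) =
      Nat.card (k2 M ⊓ k1 N : Subgroup K) * Nat.card (k2 L ⊓ k1 (star M N) : Subgroup H) := by
  let S : Subgroup (H × K) :=
    { carrier := {p | (1, p.1) ∈ L ∧ p ∈ M ∧ (p.2, 1) ∈ N}
      one_mem' := ⟨L.one_mem, M.one_mem, N.one_mem⟩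
      mul_mem' := by
        rintro p q ⟨h1, h2, h3⟩ ⟨h1', h2', h3'⟩
        refine ⟨?_, M.mul_mem h2 h2', ?_⟩
        · simpa using L.mul_mem h1 h1'
        · simpa using N.mul_mem h3 h3'
      inv_mem' := by
        rintro p ⟨h1, h2, h3⟩
        refine ⟨?_, M.inv_mem h2, ?_⟩
        · simpa using L.inv_mem h1
        · simpa using N.inv_mem h3 }
  have hS : ∀ p : H × K, p ∈ S ↔ (1, p.1) ∈ L ∧ p ∈ M ∧ (p.2, 1) ∈ N := fun _ => Iff.rfl
  let f : S →* H := (MonoidHom.fst H K).comp S.subtype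
  let g : S →* K := (MonoidHom.snd H K).comp S.subtype
  have hf : f.range = k2 L ⊓ k1 (star M N) := by
    ext h
    simp only [MonoidHom.mem_range, Subgroup.mem_inf, mem_k2, mem_k1, mem_star]
    constructor
    · rintro ⟨⟨⟨h, k⟩, h1, h2, h3⟩, rfl⟩; exact ⟨h1, k, h2, h3⟩
    · rintro ⟨h1, k, h2, h3⟩; exact ⟨⟨(h, k), h1, h2, h3⟩, rfl⟩
  have hg : g.range = k2 (star L M) ⊓ k1 N := by
    ext k
    simp only [MonoidHom.mem_range, Subgroup.mem_inf, mem_k2, mem_k1, mem_star]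
    constructor
    · rintro ⟨⟨⟨h, k⟩, h1, h2, h3⟩, rfl⟩; exact ⟨⟨h, h1, h2⟩, h3⟩
    · rintro ⟨⟨h, h1, h2⟩, h3⟩; exact ⟨⟨(h, k), h1, h2, h3⟩, rfl⟩
  have hf' : Nat.card f.ker = Nat.card (k2 M ⊓ k1 N : Subgroup K) := by
    refine Nat.card_congr
      { toFun := fun s => ⟨s.1.1.2, ?_⟩
        invFun := fun k => ⟨⟨(1, k.1), L.one_mem, k.2.1, k.2.2⟩, rfl⟩
        left_inv := ?_
        right_inv := fun k => rfl }
    · obtain ⟨⟨⟨h, k⟩, h1, h2, h3⟩, h4⟩ := s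
      obtain rfl : h = 1 := h4
      exact ⟨h2, h3⟩
    · rintro ⟨⟨⟨h, k⟩, h1, h2, h3⟩, h4⟩
      obtain rfl : h = 1 := h4
      rfl
  have hg' : Nat.card g.ker = Nat.card (k2 L ⊓ k1 M : Subgroup H) := by
    refine Nat.card_congr
      { toFun := fun s => ⟨s.1.1.1, ?_⟩
        invFun := fun k => ⟨⟨(k.1, 1), k.2.1, k.2.2, N.one_mem⟩, rfl⟩
        left_inv := ?_
        right_inv := fun k => rfl }
    · obtain ⟨⟨⟨h, k⟩, h1, h2, h3⟩, h4⟩ := s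
      obtain rfl : k = 1 := h4
      exact ⟨h1, h2⟩
    · rintro ⟨⟨⟨h, k⟩, h1, h2, h3⟩, h4⟩
      obtain rfl : k = 1 := h4
      rfl
  rw [← hf, ← hg, ← hf', ← hg', ← Subgroup.index_ker, ← Subgroup.index_ker,
    Subgroup.card_mul_index, Subgroup.card_mul_index]

theorem kappaMul_assoc (a : RS R (G × H)) (b : RS R (H × K)) (c : RS R (K × I)) :
    kappaMul R G K I (kappaMul R G H K a b) c = kappaMul R G H I a (kappaMul R H K I b c) := by
  induction a using Finsupp.induction_linear with
  | zero => simp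
  | add a a' ha hb => simp only [map_add, LinearMap.add_apply, ha, hb]
  | single L r =>
    induction b using Finsupp.induction_linear with
    | zero => simp
    | add a a' ha hb => simp only [map_add, LinearMap.add_apply, ha, hb]
    | single M s =>
      induction c using Finsupp.induction_linear with
      | zero => simp
      | add a a' ha hb => simp only [map_add, ha, hb]
      | single N t =>
        simp only [kappaMul, Finsupp.linearCombination_single, LinearMap.smul_apply,
          star_assoc, Finsupp.smul_single, smul_eq_mul]
        congr 1
        have := congrArg (fun n : ℕ => (n : R)) (card_cocycle L M N)
        simp only [Nat.cast_mul] at this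
        unfold kappa
        linear_combination (r * s * t * Ring.inverse (Nat.card H : R) *
          Ring.inverse (Nat.card K : R)) * this

theorem kappa_diag_left (M : Subgroup (G × H)) :
    kappa R (diag (⊤ : Subgroup G)) M = Ring.inverse (Nat.card G : R) := by
  have : k2 (diag (⊤ : Subgroup G)) ⊓ k1 M = ⊥ := by
    rw [eq_bot_iff]; intro g hg
    exact (mem_diag.1 hg.1).2.symm
  simp [kappa, this]

theorem kappa_diag_right (M : Subgroup (G × H)) :
    kappa R M (diag (⊤ : Subgroup H)) = Ring.inverse (Nat.card H : R) := by
  have : k2 M ⊓ k1 (diag (⊤ : Subgroup H)) = ⊥ := by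
    rw [eq_bot_iff]; intro g hg
    exact (mem_diag.1 hg.2).2
  simp [kappa, this]

variable (G) in
/-- The element `|G| Δ(G)`. -/
noncomputable def kappaOne : RS R (G × G) := Finsupp.single (diag ⊤) (Nat.card G : R)

theorem kappaOne_mul (hG : IsUnit (Nat.card G : R)) (a : RS R (G × H)) :
    kappaMul R G G H (kappaOne R G) a = a := by
  induction a using Finsupp.induction_linear with
  | zero => simp
  | add a a' ha hb => rw [map_add, ha, hb]
  | single L r =>
    simp only [kappaMul, kappaOne, Finsupp.linearCombination_single, LinearMap.smul_apply,
      kappa_diag_left, diag_star le_top, Finsupp.smul_single, smul_eq_mul]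
    rw [mul_left_comm, Ring.mul_inverse_cancel _ hG, mul_one]

theorem mul_kappaOne (hH : IsUnit (Nat.card H : R)) (a : RS R (G × H)) :
    kappaMul R G H H a (kappaOne R H) = a := by
  induction a using Finsupp.induction_linear with
  | zero => simp
  | add a a' ha hb => rw [map_add, LinearMap.add_apply, ha, hb]
  | single L r =>
    simp only [kappaMul, kappaOne, Finsupp.linearCombination_single, LinearMap.smul_apply,
      kappa_diag_right, star_diag le_top, Finsupp.smul_single, smul_eq_mul]
    rw [Ring.mul_inverse_cancel _ hH, mul_one]

/-- The `R`-linear category with set of objects given by the groups `G i`, morphism modules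
the free modules on the subgroups of `G i × G j`, and composition `tildeMul`. -/
noncomputable def subgroupCat {ι : Type v} (G : ι → Type u) [∀ i, Group (G i)] [∀ i, Finite (G i)]
    (hG : ∀ i, IsUnit (Nat.card (G i) : R)) : LinCat.{v, w, max u w} R ι where
  Hom i j := RS R (G i × G j)
  comp i j k := tildeMul R (G i) (G j) (G k)
  one i := zetaMap R _ (kappaOne R (G i))
  one_comp i j a := by
    obtain ⟨a, rfl⟩ := zetaMap_surjective R _ a
    rw [tildeMul_zeta, kappaOne_mul R (hG i)]
  comp_one i j a := by
    obtain ⟨a, rfl⟩ := zetaMap_surjective R _ a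
    rw [tildeMul_zeta, mul_kappaOne R (hG j)]
  assoc i j k l a b c := by
    obtain ⟨a, rfl⟩ := zetaMap_surjective R _ a
    obtain ⟨b, rfl⟩ := zetaMap_surjective R _ b
    obtain ⟨c, rfl⟩ := zetaMap_surjective R _ c
    simp only [tildeMul_zeta, kappaMul_assoc]

/-- The algebra `Ã = ⊕ R 𝒮(G i × G j)`. -/
abbrev ATilde {ι : Type v} (G : ι → Type u) [∀ i, Group (G i)] [∀ i, Finite (G i)]
    (hG : ∀ i, IsUnit (Nat.card (G i) : R)) : Type (max v u w) := (subgroupCat R G hG).Alg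

open Classical in
/-- The element `L̃`, the sum of all elements of `𝒫(L)`. -/
noncomputable def hat (L : Subgroup (G × H)) : RS R (G × H) :=
  ∑ L' : Subgroup (G × H), if L' ∈ fullSub L then Finsupp.single L' 1 else 0

end SubgroupAlgebra

/-! ### The map `α` -/

section Alpha

variable (R : Type w) [CommRing R]

variable {G H : Type u} [Group G] [Group H]

/-- The stabilizer of `a` in `G × H`, where `(g, h)` acts by `a ↦ g a h⁻¹`. -/
def Biset.stab (X : Biset G H) (a : X.carrier) : Subgroup (G × H) where
  carrier := {p | p.1 • MulOpposite.op p.2⁻¹ • a = a}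
  one_mem' := by simp
  mul_mem' := by
    intro p q (hp : p.1 • MulOpposite.op p.2⁻¹ • a = a) (hq : q.1 • MulOpposite.op q.2⁻¹ • a = a)
    change (p.1 * q.1) • MulOpposite.op (p.2 * q.2)⁻¹ • a = a
    rw [mul_inv_rev, MulOpposite.op_mul, mul_smul, mul_smul, smul_comm q.1, hq, hp]
  inv_mem' := by
    intro p (hp : p.1 • MulOpposite.op p.2⁻¹ • a = a)
    change p.1⁻¹ • MulOpposite.op p.2⁻¹⁻¹ • a = a
    have h : MulOpposite.op p.2⁻¹⁻¹ • a = p.1 • a := calc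
      _ = MulOpposite.op p.2⁻¹⁻¹ • p.1 • MulOpposite.op p.2⁻¹ • a := by rw [hp]
      _ = p.1 • a := by rw [← smul_comm p.1, smul_smul (MulOpposite.op _)]; simp
    rw [h, inv_smul_smul]

theorem Biset.mem_stab {X : Biset G H} {a : X.carrier} {p : G × H} :
    p ∈ X.stab a ↔ p.1 • MulOpposite.op p.2⁻¹ • a = a := Iff.rfl

theorem BisetIso.stab_eq {X Y : Biset G H} (e : BisetIso X Y) (a : X.carrier) :
    Y.stab (e.toEquiv a) = X.stab a := by
  ext p
  rw [Biset.mem_stab, Biset.mem_stab, ← e.map_right, ← e.map_left, e.toEquiv.injective.eq_iff]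

/-- The sum of the stabilizers of the elements of `X`. -/
noncomputable def Biset.stabSum (X : Biset G H) : RS R (G × H) :=
  ∑ᶠ a : X.carrier, Finsupp.single (X.stab a) (1 : R)

theorem Biset.stabSum_sum (X Y : Biset G H) :
    (X.sum Y).stabSum R = X.stabSum R + Y.stabSum R := by
  let := Fintype.ofFinite X.carrier
  let := Fintype.ofFinite Y.carrier
  let : Fintype (X.sum Y).carrier := inferInstanceAs (Fintype (X.carrier ⊕ Y.carrier))
  unfold Biset.stabSum
  rw [finsum_eq_sum_of_fintype, finsum_eq_sum_of_fintype, finsum_eq_sum_of_fintype]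
  refine (Fintype.sum_sum_type (α₁ := X.carrier) (α₂ := Y.carrier) _).trans ?_
  congr 1
  · refine Finset.sum_congr rfl fun a _ => congrArg (fun U => Finsupp.single U (1 : R)) ?_
    ext p; exact Sum.inl_injective.eq_iff (a := p.1 • MulOpposite.op p.2⁻¹ • a) (b := a)
  · refine Finset.sum_congr rfl fun a _ => congrArg (fun U => Finsupp.single U (1 : R)) ?_
    ext p; exact Sum.inr_injective.eq_iff (a := p.1 • MulOpposite.op p.2⁻¹ • a) (b := a)

variable (G H) in
/-- The map `α : R B(G, H) → R 𝒮(G × H)`, with `[X]` mapped to the sum of the stabilizers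
of the elements of `X`. -/
noncomputable def alphaMap : RB R G H →ₗ[R] RS R (G × H) :=
  LinearMap.liftBaseChange R (AddMonoidHom.toIntLinearMap
    (Algebra.GrothendieckAddGroup.lift
      { toFun := Quotient.lift (fun X : Biset G H => X.stabSum R) (by
          rintro X Y ⟨e⟩
          exact finsum_eq_of_bijective e.toEquiv e.toEquiv.bijective
            fun a => by rw [e.stab_eq])
        map_zero' := by
          have : IsEmpty (Biset.empty G H).carrier := inferInstanceAs (IsEmpty PEmpty)
          exact finsum_of_isEmpty _
        map_add' := by
          rintro ⟨X⟩ ⟨Y⟩; exact X.stabSum_sum R Y }))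

theorem alphaMap_tmul_bcls (r : R) (X : Biset G H) :
    alphaMap R G H (r ⊗ₜ bcls X) = r • X.stabSum R := by
  rw [alphaMap, LinearMap.liftBaseChange_tmul, AddMonoidHom.coe_toIntLinearMap, lift_bcls]
  rfl

end Alpha

/-! ### Twisted category algebras -/

section CategoryAlgebra

/-- A morphism of a category, together with its domain and codomain. -/
structure Mor (C : Type x) [Category.{u} C] where
  dom : C
  cod : C
  hom : dom ⟶ cod

/-- A `2`-cocycle of `C` with values in `Rˣ`; `α t s` stands for the value at the pair `(t, s)`
such that `t ∘ s` exists. Recall that `t ∘ s` is denoted by `s ≫ t`. -/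
structure TwoCocycle (R : Type w) [CommRing R] (C : Type x) [Category.{u} C] where
  toFun : ∀ {X Y Z : C}, (Y ⟶ Z) → (X ⟶ Y) → Rˣ
  cocycle : ∀ {W X Y Z : C} (s : W ⟶ X) (t : X ⟶ Y) (r : Y ⟶ Z),
    toFun (t ≫ r) s * toFun r t = toFun r (s ≫ t) * toFun t s

variable {R : Type w} [CommRing R] {C : Type x} [Category.{u} C]

/-- The trivial `2`-cocycle. -/
def TwoCocycle.trivial (R : Type w) [CommRing R] (C : Type x) [Category.{u} C] :
    TwoCocycle R C := ⟨fun _ _ => 1, fun _ _ _ => rfl⟩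

/-- The twisted category algebra: the free `R`-module on the set of morphisms. -/
def TwistedAlg (_α : TwoCocycle R C) : Type (max u w x) := Mor C →₀ R

/-- The category algebra `R C`. -/
abbrev CatAlg (R : Type w) [CommRing R] (C : Type x) [Category.{u} C] : Type (max u w x) :=
  TwistedAlg (TwoCocycle.trivial R C)

namespace TwistedAlg

variable (α : TwoCocycle R C)

noncomputable instance : AddCommGroup (TwistedAlg α) := inferInstanceAs (AddCommGroup (Mor C →₀ R))

noncomputable instance : Module R (TwistedAlg α) := inferInstanceAs (Module R (Mor C →₀ R))

/-- The basis element given by a morphism. -/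
noncomputable def basis (s : Mor C) : TwistedAlg α := Finsupp.single s (1 : R)

open Classical in
/-- The product of two basis elements: `α(t, s) (t ∘ s)` if `t ∘ s` exists and `0` otherwise. -/
noncomputable def basisMul (t s : Mor C) : TwistedAlg α :=
  if h : s.cod = t.dom then
    ((α.toFun t.hom (s.hom ≫ eqToHom h) : Rˣ) : R) • basis α ⟨s.dom, t.cod, s.hom ≫ eqToHom h ≫ t.hom⟩
  else 0

/-- The multiplication, as a bilinear map. -/
noncomputable def mulLin : TwistedAlg α →ₗ[R] TwistedAlg α →ₗ[R] TwistedAlg α :=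
  Finsupp.linearCombination R fun t : Mor C =>
    (Finsupp.linearCombination R fun s : Mor C => basisMul α t s : (Mor C →₀ R) →ₗ[R] TwistedAlg α)

theorem mulLin_basis (t s : Mor C) : mulLin α (basis α t) (basis α s) = basisMul α t s := by
  have h1 : mulLin α (basis α t) =
      (Finsupp.linearCombination R fun s : Mor C => basisMul α t s :
        (Mor C →₀ R) →ₗ[R] TwistedAlg α) :=
    (Finsupp.linearCombination_single R (1 : R) t).trans (one_smul R _)
  rw [h1]
  exact (Finsupp.linearCombination_single R (1 : R) s).trans (one_smul R _)

variable {α}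

@[elab_as_elim]
theorem induction_basis {P : TwistedAlg α → Prop} (a : TwistedAlg α) (h0 : P 0)
    (hadd : ∀ a b, P a → P b → P (a + b)) (hb : ∀ (r : R) s, P (r • basis α s)) : P a := by
  refine Finsupp.induction_linear (motive := P) a h0 hadd fun s r => ?_
  have := hb r s
  rwa [show r • basis α s = Finsupp.single s r by
    change r • Finsupp.single s (1 : R) = _; simp] at this

variable (α)

theorem basisMul_comp {X Y Z : C} (s : X ⟶ Y) (t : Y ⟶ Z) :
    basisMul α ⟨Y, Z, t⟩ ⟨X, Y, s⟩ = ((α.toFun t s : Rˣ) : R) • basis α ⟨X, Z, s ≫ t⟩ := by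
  simp [basisMul]

theorem basisMul_zero {t s : Mor C} (h : s.cod ≠ t.dom) : basisMul α t s = 0 := dif_neg h

theorem mulLin_assoc (a b c : TwistedAlg α) :
    mulLin α (mulLin α a b) c = mulLin α a (mulLin α b c) := by
  induction a using induction_basis with
  | h0 => simp
  | hadd a a' ha hb => simp only [map_add, LinearMap.add_apply, ha, hb]
  | hb r t =>
    induction b using induction_basis with
    | h0 => simp
    | hadd a a' ha hb => simp only [map_add, LinearMap.add_apply, ha, hb]
    | hb r' s =>
      induction c using induction_basis with
      | h0 => simp
      | hadd a a' ha hb => simp only [map_add, ha, hb]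
      | hb r'' q =>
        simp only [map_smul, LinearMap.smul_apply, mulLin_basis]
        congr 3
        obtain ⟨Y, Z, t⟩ := t
        obtain ⟨X, Y', s⟩ := s
        obtain ⟨W, X', q⟩ := q
        by_cases h1 : Y' = Y
        · subst h1
          by_cases h2 : X' = X
          · subst h2
            rw [basisMul_comp, basisMul_comp, map_smul, LinearMap.smul_apply, map_smul,
              mulLin_basis, mulLin_basis, basisMul_comp, basisMul_comp, smul_smul, smul_smul,
              Category.assoc]
            congr 1
            rw [← Units.val_mul, ← Units.val_mul, mul_comm, α.cocycle, mul_comm]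
          · rw [basisMul_comp, basisMul_zero α (t := ⟨X, Y', s⟩) (s := ⟨W, X', q⟩) h2, map_smul,
              LinearMap.smul_apply, mulLin_basis, basisMul_zero α (t := ⟨X, Z, s ≫ t⟩) h2]
            simp
        · rw [basisMul_zero α (t := ⟨Y, Z, t⟩) (s := ⟨X, Y', s⟩) h1]
          by_cases h2 : X' = X
          · subst h2
            rw [basisMul_comp, map_smul, mulLin_basis,
              basisMul_zero α (t := ⟨Y, Z, t⟩) (s := ⟨W, Y', q ≫ s⟩) h1]
            simp
          · rw [basisMul_zero α (t := ⟨X, Y', s⟩) (s := ⟨W, X', q⟩) h2]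
            simp

variable [Finite C]

/-- The identity element `∑ α(1_X, 1_X)⁻¹ 1_X`. -/
noncomputable def one : TwistedAlg α :=
  letI := Fintype.ofFinite C
  ∑ X : C, (((α.toFun (𝟙 X) (𝟙 X))⁻¹ : Rˣ) : R) • basis α ⟨X, X, 𝟙 X⟩

theorem cocycle_left {X Y : C} (s : X ⟶ Y) : α.toFun (𝟙 Y) s = α.toFun (𝟙 Y) (𝟙 Y) := by
  have := α.cocycle s (𝟙 Y) (𝟙 Y)
  simp only [Category.comp_id] at this
  exact (mul_left_cancel this).symm

theorem cocycle_right {X Y : C} (s : X ⟶ Y) : α.toFun s (𝟙 X) = α.toFun (𝟙 X) (𝟙 X) := by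
  have := α.cocycle (𝟙 X) (𝟙 X) s
  simp only [Category.id_comp] at this
  exact mul_left_cancel this

theorem one_mulLin (a : TwistedAlg α) : mulLin α (one α) a = a := by
  induction a using induction_basis with
  | h0 => simp
  | hadd a a' ha hb => rw [map_add, ha, hb]
  | hb r s =>
    obtain ⟨X, Y, s⟩ := s
    rw [map_smul]
    congr 1
    let := Fintype.ofFinite C
    rw [one, map_sum, LinearMap.sum_apply, Finset.sum_eq_single Y]
    · rw [map_smul, LinearMap.smul_apply, mulLin_basis, basisMul_comp, cocycle_left α s, smul_smul,
        Category.comp_id, Units.inv_mul, one_smul]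
    · intro Z _ hZ
      rw [map_smul, LinearMap.smul_apply, mulLin_basis,
        basisMul_zero α (t := ⟨Z, Z, 𝟙 Z⟩) (s := ⟨X, Y, s⟩) hZ.symm, smul_zero]
    · intro h; exact absurd (Finset.mem_univ _) h

theorem mulLin_one (a : TwistedAlg α) : mulLin α a (one α) = a := by
  induction a using induction_basis with
  | h0 => simp
  | hadd a a' ha hb => rw [map_add, LinearMap.add_apply, ha, hb]
  | hb r s =>
    obtain ⟨X, Y, s⟩ := s
    rw [map_smul, LinearMap.smul_apply]
    congr 1
    let := Fintype.ofFinite C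
    rw [one, map_sum, Finset.sum_eq_single X]
    · rw [map_smul, mulLin_basis, basisMul_comp, cocycle_right α s, smul_smul,
        Category.id_comp, Units.inv_mul, one_smul]
    · intro Z _ hZ
      rw [map_smul, mulLin_basis,
        basisMul_zero α (t := ⟨X, Y, s⟩) (s := ⟨Z, Z, 𝟙 Z⟩) hZ, smul_zero]
    · intro h; exact absurd (Finset.mem_univ _) h

noncomputable instance : Ring (TwistedAlg α) where
  __ := (inferInstance : AddCommGroup (TwistedAlg α))
  mul a b := mulLin α a b
  one := one α
  left_distrib a b c := (mulLin α a).map_add b c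
  right_distrib a b c := (mulLin α).map_add₂ a b c
  zero_mul a := (mulLin α).map_zero₂ a
  mul_zero a := (mulLin α a).map_zero
  mul_assoc := mulLin_assoc α
  one_mul := one_mulLin α
  mul_one := mulLin_one α

theorem mul_def (a b : TwistedAlg α) : a * b = mulLin α a b := rfl

noncomputable instance : Algebra R (TwistedAlg α) := Algebra.ofModule
  (fun r a b => (mulLin α).map_smul₂ r a b) (fun r a b => (mulLin α a).map_smul r b)

end TwistedAlg

/-- The partial order on the morphisms of an inverse category: `s ≤ t` if `s` and `t` have the same
domain and codomain and `s = t ∘ e` for some idempotent endomorphism `e` of the domain. -/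
def Mor.Le (s t : Mor C) : Prop :=
  ∃ e : t.dom ⟶ t.dom, e ≫ e = e ∧ s = ⟨t.dom, t.cod, e ≫ t.hom⟩

end CategoryAlgebra

/-! ### The category attached to a family of groups -/

section SubCat

variable {ι : Type v} (G : ι → Type u) [∀ i, Group (G i)]

/-- The objects: pairs `(G i, U)` where `U` is a subgroup of `G i`. -/
structure SubCat where
  idx : ι
  sub : Subgroup (G idx)

instance [Finite ι] [∀ i, Finite (G i)] : Finite (SubCat G) :=
  Finite.of_injective (β := Σ i, Subgroup (G i)) (fun X => ⟨X.idx, X.sub⟩) (by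
    rintro ⟨i, U⟩ ⟨j, V⟩ h
    simp only [Sigma.mk.injEq] at h
    obtain ⟨rfl, h⟩ := h
    obtain rfl := eq_of_heq h
    rfl)

variable {G}

theorem p1_prod {A B : Type u} [Group A] [Group B] (U : Subgroup A) (V : Subgroup B) :
    p1 (U.prod V) = U := by
  ext g; simp only [mem_p1, Subgroup.mem_prod]
  exact ⟨fun ⟨_, h, _⟩ => h, fun h => ⟨1, h, V.one_mem⟩⟩

theorem p2_prod {A B : Type u} [Group A] [Group B] (U : Subgroup A) (V : Subgroup B) :
    p2 (U.prod V) = V := by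
  ext g; simp only [mem_p2, Subgroup.mem_prod]
  exact ⟨fun ⟨_, _, h⟩ => h, fun h => ⟨1, U.one_mem, h⟩⟩

theorem mem_fullSub_prod {A B : Type u} [Group A] [Group B] {U : Subgroup A} {V : Subgroup B}
    {L : Subgroup (A × B)} : L ∈ fullSub (U.prod V) ↔ p1 L = U ∧ p2 L = V := by
  simp only [fullSub, Set.mem_ofPred_eq, p1_prod, p2_prod]
  refine ⟨fun h => h.2, fun h => ⟨?_, h⟩⟩
  rintro ⟨a, b⟩ hab
  exact ⟨h.1 ▸ mem_p1.2 ⟨b, hab⟩, h.2 ▸ mem_p2.2 ⟨a, hab⟩⟩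

theorem star_mem {A B C : Type u} [Group A] [Group B] [Group C] {U : Subgroup A} {V : Subgroup B}
    {W : Subgroup C} {L : Subgroup (A × B)} {M : Subgroup (B × C)} (hL : L ∈ fullSub (U.prod V))
    (hM : M ∈ fullSub (V.prod W)) : star L M ∈ fullSub (U.prod W) := by
  rw [mem_fullSub_prod] at *
  obtain ⟨rfl, h⟩ := hL
  obtain ⟨h', rfl⟩ := hM
  constructor
  · ext a; simp only [mem_p1, mem_star]
    refine ⟨fun ⟨_, b, h1, _⟩ => ⟨b, h1⟩, fun ⟨b, h1⟩ => ?_⟩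
    obtain ⟨c, hc⟩ := mem_p1.1 (h' ▸ h ▸ mem_p2.2 ⟨a, h1⟩ : b ∈ p1 M)
    exact ⟨c, b, h1, hc⟩
  · ext c; simp only [mem_p2, mem_star]
    refine ⟨fun ⟨_, b, _, h1⟩ => ⟨b, h1⟩, fun ⟨b, h1⟩ => ?_⟩
    obtain ⟨a, ha⟩ := mem_p2.1 (h ▸ h' ▸ mem_p1.2 ⟨c, h1⟩ : b ∈ p2 L)
    exact ⟨a, b, ha, h1⟩

theorem diag_mem {A : Type u} [Group A] (U : Subgroup A) : diag U ∈ fullSub (U.prod U) := by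
  rw [mem_fullSub_prod]
  constructor
  · ext a; simp only [mem_p1, mem_diag]
    exact ⟨fun ⟨_, h, _⟩ => h, fun h => ⟨a, h, rfl⟩⟩
  · ext a; simp only [mem_p2, mem_diag]
    exact ⟨fun ⟨b, h, e⟩ => e ▸ h, fun h => ⟨a, h, rfl⟩⟩

/-- The morphisms from `X = (H, H')` to `Y = (G, G')` are the elements of `𝒫(G' × H')`, and the
composition of `L : Y ⟶ Z` after `M : X ⟶ Y` is `L * M`. -/
instance : Category.{u} (SubCat G) where
  Hom X Y := {L : Subgroup (G Y.idx × G X.idx) // L ∈ fullSub (Y.sub.prod X.sub)}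
  id X := ⟨diag X.sub, diag_mem X.sub⟩
  comp M L := ⟨star L.1 M.1, star_mem L.2 M.2⟩
  id_comp M := Subtype.ext (star_diag (mem_fullSub_prod.1 M.2).2.le)
  comp_id L := Subtype.ext (diag_star (mem_fullSub_prod.1 L.2).1.le)
  assoc M L N := Subtype.ext (star_assoc N.1 L.1 M.1).symm

/-- A subgroup `L` of `G i × G j`, as a morphism from `(G j, p₂(L))` to `(G i, p₁(L))`. -/
def toMor {i j : ι} (L : Subgroup (G i × G j)) : Mor (SubCat G) where
  dom := ⟨j, p2 L⟩
  cod := ⟨i, p1 L⟩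
  hom := ⟨L, mem_fullSub_prod.2 ⟨rfl, rfl⟩⟩

end SubCat

/-! ### The cocycle and the cochain -/

section Cocycle

/-- The `p`-primary part (Sylow `p`-subgroup) of a subgroup of a finite commutative group. -/
def pPart {A : Type*} [CommGroup A] (p : ℕ) (U : Subgroup A) : Subgroup A where
  carrier := {a | a ∈ U ∧ ∃ n : ℕ, a ^ p ^ n = 1}
  one_mem' := ⟨U.one_mem, 0, by simp⟩
  mul_mem' := by
    rintro a b ⟨ha, n, hn⟩ ⟨hb, m, hm⟩
    refine ⟨U.mul_mem ha hb, n + m, ?_⟩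
    rw [mul_pow, pow_add, pow_mul, hn, one_pow, mul_comm (p ^ n), pow_mul, hm, one_pow, one_mul]
  inv_mem' := by
    rintro a ⟨ha, n, hn⟩
    exact ⟨U.inv_mem ha, n, by rw [inv_pow, hn, inv_one]⟩

variable (R : Type w) [CommRing R] {G H K : Type u} [CommGroup G] [CommGroup H] [CommGroup K]

open Classical in
/-- `λ_p(L, M)`. -/
noncomputable def lamP (p : ℕ) (L : Subgroup (G × H)) (M : Subgroup (H × K)) : R :=
  if p2 (pPart p L) ≠ p1 (pPart p M) then 0
  else if sIndex (pPart p L) = 1 ∧ sIndex (pPart p M) = 1 then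
    (Nat.totient (Nat.card (k2 (pPart p L) ⊓ k1 (pPart p M) : Subgroup H)) : R) *
      Ring.inverse (Nat.card (pPart p (⊤ : Subgroup H)) : R)
  else
    (Nat.card (k2 (pPart p L) ⊓ k1 (pPart p M) : Subgroup H) : R) *
      Ring.inverse (Nat.card (pPart p (⊤ : Subgroup H)) : R)

/-- `λ(L, M)`; all but finitely many factors are equal to `1`. -/
noncomputable def lam (L : Subgroup (G × H)) (M : Subgroup (H × K)) : R :=
  ∏ᶠ p : Nat.Primes, lamP R p L M

open Classical in
/-- `μ_p(L)`. -/
noncomputable def muP (p : ℕ) (L : Subgroup (G × H)) : R :=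
  if sIndex (pPart p L) = 1 then
    (Nat.totient (Nat.card (p1 (pPart p L))) : R) *
      Ring.inverse (Nat.card (pPart p (⊤ : Subgroup H)) : R)
  else
    (Nat.card (k1 (pPart p L)) : R) * Ring.inverse (Nat.card (pPart p (⊤ : Subgroup H)) : R)

/-- `μ(L)`; all but finitely many factors are equal to `1`. -/
noncomputable def mu (L : Subgroup (G × H)) : R := ∏ᶠ p : Nat.Primes, muP R p L

end Cocycle

/-! ### Sections and the matrix decomposition -/

section Sections

/-- A section `(P, K)` of a group: `K` is a normal subgroup of the subgroup `P`. -/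
structure Sec (A : Type u) [Group A] where
  P : Subgroup A
  K : Subgroup A
  le : K ≤ P
  normal : (K.subgroupOf P).Normal

attribute [instance] Sec.normal

/-- The quotient `P / K` of a section `(P, K)`. -/
abbrev Sec.Quot {A : Type u} [Group A] (σ : Sec A) : Type u := σ.P ⧸ σ.K.subgroupOf σ.P

/-- The subgroup `{(a, b) ∈ P × P' | η(b K') = a K}` of `A × B` given by sections `σ = (P, K)` of `A`
and `τ = (P', K')` of `B` and an isomorphism `η : P' / K' → P / K`. -/
def quintuple {A B : Type u} [Group A] [Group B] (σ : Sec A) (τ : Sec B) (η : τ.Quot ≃* σ.Quot) :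
    Subgroup (A × B) where
  carrier := {p | ∃ (ha : p.1 ∈ σ.P) (hb : p.2 ∈ τ.P),
    η (QuotientGroup.mk ⟨p.2, hb⟩) = QuotientGroup.mk ⟨p.1, ha⟩}
  one_mem' := ⟨σ.P.one_mem, τ.P.one_mem, η.map_one⟩
  mul_mem' := by
    rintro p q ⟨ha, hb, h⟩ ⟨ha', hb', h'⟩
    refine ⟨σ.P.mul_mem ha ha', τ.P.mul_mem hb hb', ?_⟩
    refine (η.map_mul (QuotientGroup.mk ⟨p.2, hb⟩) (QuotientGroup.mk ⟨q.2, hb'⟩)).trans ?_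
    rw [h, h']
    rfl
  inv_mem' := by
    rintro p ⟨ha, hb, h⟩
    refine ⟨σ.P.inv_mem ha, τ.P.inv_mem hb, ?_⟩
    refine (η.map_inv (QuotientGroup.mk ⟨p.2, hb⟩)).trans ?_
    rw [h]
    rfl

theorem quintuple_mem {A B : Type u} [Group A] [Group B] (σ : Sec A) (τ : Sec B)
    (η : τ.Quot ≃* σ.Quot) : quintuple σ τ η ∈ fullSub (σ.P.prod τ.P) := by
  rw [mem_fullSub_prod]
  constructor
  · ext a; rw [mem_p1]
    constructor
    · rintro ⟨b, ha, _⟩; exact ha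
    · intro ha
      obtain ⟨b, hb⟩ := QuotientGroup.mk_surjective (η.symm (QuotientGroup.mk ⟨a, ha⟩))
      exact ⟨b.1, ha, b.2, by rw [Subtype.coe_eta, hb, η.apply_symm_apply]⟩
  · ext b; rw [mem_p2]
    constructor
    · rintro ⟨a, _, hb, _⟩; exact hb
    · intro hb
      obtain ⟨a, ha⟩ := QuotientGroup.mk_surjective (η (QuotientGroup.mk ⟨b, hb⟩))
      exact ⟨a.1, a.2, hb, by rw [Subtype.coe_eta, ha]⟩

variable {ι : Type v} (G : ι → Type u) [∀ i, Group (G i)]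

/-- The cyclic group `C_k` of order `k`. -/
abbrev Cyc (k : ℕ) : Type := Multiplicative (ZMod k)

/-- The set of all divisors of all group orders `|G i|`. -/
def Divs : Type := {k : ℕ // ∃ i, k ∣ Nat.card (G i)}

/-- The set of all sections of the groups `G i` that are isomorphic to `C_k`. -/
def SecOf (k : ℕ) : Type (max u v) := {σ : Σ i, Sec (G i) // Nonempty (Cyc k ≃* σ.2.Quot)}

/-- The number `n(k)` of sections of the groups `G i` that are isomorphic to `C_k`. -/
noncomputable def numSec (k : ℕ) : ℕ := Nat.card (SecOf G k)

/-- The product of the matrix algebras `Mat_{n(k)}(R Aut(C_k))`. -/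
abbrev MatProd (R : Type w) [CommRing R] : Type w :=
  ∀ k : Divs G, Matrix (Fin (numSec G k.1)) (Fin (numSec G k.1)) (MonoidAlgebra R (MulAut (Cyc k.1)))

variable {G}

/-- For isomorphisms `θ_σ : C_k → P / K` for every section `σ = (P, K)` isomorphic to `C_k`, for two such
sections `σ`, `τ`, and for `a ∈ Aut(C_k)`, the morphism of `SubCat G` from `τ` to `σ` given by the
isomorphism `θ_σ ∘ a ∘ θ_τ⁻¹`. -/
def unitMor {k : ℕ} (θ : ∀ σ : SecOf G k, Cyc k ≃* σ.1.2.Quot) (σ τ : SecOf G k)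
    (a : MulAut (Cyc k)) : Mor (SubCat G) where
  dom := ⟨τ.1.1, τ.1.2.P⟩
  cod := ⟨σ.1.1, σ.1.2.P⟩
  hom := ⟨quintuple σ.1.2 τ.1.2 (((θ τ).symm.trans a).trans (θ σ)), quintuple_mem _ _ _⟩

open Classical in
/-- The image of a morphism `s` under `ω`: the sum, over all morphisms `t ≤ s`, of the elementary
matrices belonging to `t`. Here the elementary matrix with the entry `a` at position `(m, n)` of the
`k`-th component belongs to the morphism `unitMor` given by the sections with numbers `m` and `n`
and by `a`. -/
noncomputable def omegaMor (R : Type w) [CommRing R]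
    (enum : ∀ k : Divs G, Fin (numSec G k.1) ≃ SecOf G k.1)
    (θ : ∀ (k : Divs G) (σ : SecOf G k.1), Cyc k.1 ≃* σ.1.2.Quot) (s : Mor (SubCat G)) :
    MatProd G R := fun k => Matrix.of fun m n =>
  ∑ᶠ a : MulAut (Cyc k.1),
    if (unitMor (θ k) (enum k m) (enum k n) a).Le s then MonoidAlgebra.of R _ a else 0

end Sections

end DoubleBurnside

namespace DoubleBurnside

/-! ### Möbius inversion -/

/-! Each of the four maps is triangular with respect to some partial order, so bijectivity is Möbius
inversion up to unit factors. The substance is multiplicativity.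

For γ: the stabilizer of `a ×_H b` is the composite of the stabilizers of `a` and `b`, and a fibre
of X × Y → X ×_H Y is an H-orbit whose point stabilizers are k₂ ∩ k₁ of the two stabilizers. Hence α
carries the tensor product to the product κ(L, M) (L * M) (`alphaMap_tensor`), and ζ carries the
latter to the product of Ã. As the groups are abelian, α maps the transitive biset (G × H)/L to [G ×
H : L] L, a unit multiple of a basis element.

For δ: the element L̃ = ∑ 𝒫(L) has a preimage under ζ that is a Möbius-weighted sum of the groups L
∩ (U × V). In the product of two such sums the two middle variables enter only through their
intersection, so the sum is zero if p₂(L) ≠ p₁(M) and collapses to a single sum over V ≤ Q = p₁(M)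
otherwise (`sum_mw_inf`). Subgroup lattices of cyclic groups are distributive, so the surviving V
are those with VT = Q, where T = k₂(L) ∩ k₁(M). The sum of μ(V, Q) |V ∩ T| over these V counts the
elements of T whose order has the full part of |Q| at every prime where |T| and |Q| agree; divided
by |H| this is λ(L, M) (`sum_moebius_card_inf`, `tildeMul_hat`).

For ε: λ is the coboundary of μ (`lam_mul_mu`). This is checked one prime at a time, from |k₁(L *
M)| |k₂(L) ∩ k₁(M)| = |k₁(L)| |k₁(M)| and [p₁ : k₁] = [p₂ : k₂]. As the values of μ are units, λ is
a cocycle and rescaling the basis removes the twist.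

For ω: by Goursat a morphism is an isomorphism between two cyclic sections, and t ≤ s means that t
contains s and has the same projections. Isomorphisms with matching sections form a groupoid, whose
algebra is the product of matrix rings over R Aut(C_k). The sum over t ≤ s is multiplicative because
every t below a composite factors uniquely into morphisms with matching sections below the two
factors (`exists_factorization`, `unitMor_eq_of_le`). Over a field, Maschke's theorem applies since
|Aut(C_k)| = φ(k) is invertible. -/

open Classical in
theorem sum_moebius_right {X : Type*} [PartialOrder X] [Fintype X] (a b : X) :
    (∑ y : X, if a ≤ y ∧ y ≤ b then moebius y b else 0) = if a = b then 1 else 0 := by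
  let : LocallyFiniteOrder X := Fintype.toLocallyFiniteOrder
  rw [← IncidenceAlgebra.sum_Icc_mu_left (𝕜 := ℤ) a b, ← Finset.sum_filter]
  refine Finset.sum_congr ?_ fun _ _ => rfl
  ext y; simp

open Classical in
theorem sum_moebius_right_cast {X : Type*} [PartialOrder X] [Fintype X] (R : Type*) [CommRing R]
    (a b : X) :
    (∑ y : X, if y ≤ b then (if a ≤ y then (moebius y b : R) else 0) else 0) =
      if a = b then 1 else 0 := by
  have := congrArg (Int.cast : ℤ → R) (sum_moebius_right a b)
  rw [Int.cast_sum] at this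
  rw [show (if a = b then (1 : R) else 0) = ((if a = b then 1 else 0 : ℤ) : R) by
    split_ifs <;> simp, ← this]
  refine Finset.sum_congr rfl fun y _ => ?_
  by_cases h1 : a ≤ y <;> by_cases h2 : y ≤ b <;> simp [h1, h2]

open Classical in
/-- Möbius inversion, with the Möbius function on the right of the summation. -/
theorem moebius_inversion_right {X : Type*} [PartialOrder X] [Fintype X] {R : Type*} [CommRing R]
    (f : X → R) (z : X) :
    (∑ y : X, if y ≤ z then (moebius y z : R) * (∑ x : X, if x ≤ y then f x else 0) else 0)
      = f z := by
  calc _ = ∑ y : X, ∑ x : X, f x * (if y ≤ z then (if x ≤ y then (moebius y z : R) else 0) else 0) := by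
        refine Finset.sum_congr rfl fun y _ => ?_
        split_ifs
        · rw [Finset.mul_sum]
          refine Finset.sum_congr rfl fun x _ => ?_
          split_ifs <;> ring
        · simp
    _ = _ := by
        rw [Finset.sum_comm]
        simp only [← Finset.mul_sum, sum_moebius_right_cast]
        simp

open Classical in
/-- The map `c ↦ (t ↦ ∑_{s ≤ t} c(s))`. -/
noncomputable def zetaTransform (R : Type*) [CommRing R] (X : Type*) [PartialOrder X] [Fintype X] :
    (X →₀ R) →ₗ[R] (X → R) where
  toFun c t := ∑ s : X, if s ≤ t then c s else 0
  map_add' c d := by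
    ext t
    simp only [Pi.add_apply, ← Finset.sum_add_distrib]
    refine Finset.sum_congr rfl fun s _ => ?_
    split_ifs <;> simp
  map_smul' r c := by
    ext t
    simp [Finset.mul_sum]

open Classical in
theorem zetaTransform_single {R : Type*} [CommRing R] {X : Type*} [PartialOrder X] [Fintype X]
    (s t : X) : zetaTransform R X (Finsupp.single s 1) t = if s ≤ t then 1 else 0 := by
  change (∑ s' : X, if s' ≤ t then Finsupp.single s (1 : R) s' else 0) = _
  rw [Finset.sum_eq_single s]
  · simp
  · intro b _ hb; simp [hb.symm]
  · simp

/-- The two Möbius inversion formulas give the two halves: one recovers `c` from its transform, the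
other produces a preimage. Both δ and ω become this map in suitable coordinates. -/
theorem zetaTransform_bijective (R : Type*) [CommRing R] (X : Type*) [PartialOrder X] [Fintype X] :
    Function.Bijective (zetaTransform R X) := by
  classical
  constructor
  · intro c d h
    ext x
    rw [← moebius_inversion_right (fun s => c s) x, ← moebius_inversion_right (fun s => d s) x]
    refine Finset.sum_congr rfl fun y _ => ?_
    have := congrFun h y
    change (∑ s : X, if s ≤ y then c s else 0) = ∑ s : X, if s ≤ y then d s else 0 at this
    simp only [this]
  · intro f
    refine ⟨Finsupp.equivFunOnFinite.symm
      fun y => ∑ x : X, if x ≤ y then (moebius x y : R) * f x else 0, ?_⟩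
    ext t
    exact moebius_inversion f t

/-- A bijective multiplicative linear map is an isomorphism of algebras. -/
theorem exists_algEquiv_of_bijective {R A A' : Type*} [CommRing R] [Ring A] [Ring A'] [Algebra R A]
    [Algebra R A'] (f : A →ₗ[R] A') (hf : Function.Bijective f)
    (hmul : ∀ a b, f (a * b) = f a * f b) : ∃ e : A ≃ₐ[R] A', ∀ a, e a = f a := by
  -- Preservation of the identity need not be assumed: `f 1` is a left identity on the image of `f`,
  -- which is everything.
  have h1 : f 1 = 1 := by
    obtain ⟨e, he⟩ := hf.2 1
    have := hmul 1 e
    rwa [one_mul, he, mul_one, eq_comm] at this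
  exact ⟨AlgEquiv.ofLinearEquiv (LinearEquiv.ofBijective f hf) h1 hmul, fun a => rfl⟩

open scoped TensorProduct

/-! ### The isomorphism `γ` -/

section Tensor

variable (R : Type w) [CommRing R] {G H K : Type u} [Group G] [Group H] [Group K]

theorem RB_hom_ext {A : Type*} [AddCommGroup A] [Module R A] {f g : RB R G H →ₗ[R] A}
    (h : ∀ X : Biset G H, f (1 ⊗ₜ bcls X) = g (1 ⊗ₜ bcls X)) : f = g := by
  ext b
  have : (f.toAddMonoidHom.comp (TensorProduct.mk ℤ R (B G H) 1).toAddMonoidHom) =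
      (g.toAddMonoidHom.comp (TensorProduct.mk ℤ R (B G H) 1).toAddMonoidHom) :=
    B_hom_ext h
  exact DFunLike.congr_fun this b

/-- If (g, k) fixes the class of (a, b), then it moves the pair (a, b) within its H-orbit, and the
element h doing so is the middle element required by the composition. -/
theorem stab_tmk (X : Biset G H) (Y : Biset H K) (a : X.carrier) (b : Y.carrier) :
    (X.tensor Y).stab (Biset.tmk X Y a b) = star (X.stab a) (Y.stab b) := by
  ext ⟨g, k⟩
  simp only [Biset.mem_stab, mem_star]
  rw [Biset.tmk_right, Biset.tmk_left]
  constructor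
  · intro e
    obtain ⟨h, hh⟩ := Quotient.exact (s := tensorSetoid X Y) e
    simp only [Prod.mk.injEq] at hh
    exact ⟨h, by rw [smul_comm]; exact hh.1.symm, hh.2.symm⟩
  · rintro ⟨h, h1, h2⟩
    rw [← Biset.tmk_rel h, ← smul_comm g, h1, h2]

/-- The action `h (a, b) = (a h⁻¹, h b)` of `H` on `X × Y`. -/
@[reducible] def Biset.midAction (X : Biset G H) (Y : Biset H K) : MulAction H (X.carrier × Y.carrier) where
  smul h p := (MulOpposite.op h⁻¹ • p.1, h • p.2)
  one_smul p := by
    change (MulOpposite.op (1 : H)⁻¹ • p.1, (1 : H) • p.2) = p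
    simp
  mul_smul h h' p := by
    change (MulOpposite.op (h * h')⁻¹ • p.1, (h * h') • p.2) =
      (MulOpposite.op h⁻¹ • MulOpposite.op h'⁻¹ • p.1, h • h' • p.2)
    simp [smul_smul]

/-- A fibre F of X × Y → X ×_H Y is an H-orbit, and the stabilizer of (a, b) in H is k₂ ∩ k₁ of the
two stabilizers. By orbit-stabilizer each of the |F| summands is therefore 1/|F|. -/
theorem card_fiber_smul_kappa [Finite H] (hH : IsUnit (Nat.card H : R)) (X : Biset G H)
    (Y : Biset H K) (z : (X.tensor Y).carrier) :
    ∑ᶠ p : {p : X.carrier × Y.carrier // Biset.tmk X Y p.1 p.2 = z},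
      kappa R (X.stab p.1.1) (Y.stab p.1.2) = 1 := by
  classical
  let := X.midAction Y
  let := Fintype.ofFinite X.carrier
  let := Fintype.ofFinite Y.carrier
  set F := {p : X.carrier × Y.carrier // Biset.tmk X Y p.1 p.2 = z} with hF
  have hne : 0 < Nat.card F := by
    have : Nonempty F := by
      clear_value F
      subst hF
      revert z
      exact Biset.tind fun a b => ⟨⟨(a, b), rfl⟩⟩
    exact Nat.card_pos
  have key : ∀ p : F, Nat.card F *
      Nat.card (k2 (X.stab p.1.1) ⊓ k1 (Y.stab p.1.2) : Subgroup H) = Nat.card H := by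
    intro p
    have h1 : Nat.card (MulAction.orbit H p.1) = Nat.card F := by
      refine Nat.card_congr (Equiv.subtypeEquivRight fun q => ?_)
      constructor
      · rintro ⟨h, rfl⟩
        exact (Biset.tmk_rel h _ _).trans p.2
      · intro hq
        obtain ⟨h, hh⟩ := Quotient.exact (s := tensorSetoid X Y) (p.2.trans hq.symm)
        exact ⟨h, hh.symm⟩
    have h2 : (MulAction.stabilizer H p.1) =
        (k2 (X.stab p.1.1) ⊓ k1 (Y.stab p.1.2) : Subgroup H) := by
      ext h
      rw [MulAction.mem_stabilizer_iff, Subgroup.mem_inf, mem_k2, mem_k1, Biset.mem_stab,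
        Biset.mem_stab]
      change (MulOpposite.op h⁻¹ • p.1.1, h • p.1.2) = p.1 ↔ _
      rw [Prod.ext_iff]
      simp
    rw [← h1, ← h2, Nat.card_coe_set_eq, ← MulAction.index_stabilizer, mul_comm,
      Subgroup.card_mul_index]
  rw [finsum_eq_sum_of_fintype]
  -- The summation takes place in ℕ, where |F| can be cancelled; the only division in R is by |H|.
  have h3 : ∑ p : F, Nat.card (k2 (X.stab p.1.1) ⊓ k1 (Y.stab p.1.2) : Subgroup H) = Nat.card H := by
    refine Nat.eq_of_mul_eq_mul_left hne ?_
    rw [Finset.mul_sum, Finset.sum_congr rfl fun p _ => key p]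
    simp
  simp only [kappa]
  rw [← Finset.sum_mul, ← Nat.cast_sum, h3, Ring.mul_inverse_cancel _ hH]

/-- The double sum over X × Y is grouped by the fibres over X ×_H Y: on a fibre the composite of the
stabilizers is constant and the weights κ add up to 1. -/
theorem stabSum_tensor [Finite G] [Finite H] [Finite K] (hH : IsUnit (Nat.card H : R))
    (X : Biset G H) (Y : Biset H K) :
    (X.tensor Y).stabSum R = kappaMul R G H K (X.stabSum R) (Y.stabSum R) := by
  classical
  let := Fintype.ofFinite X.carrier
  let := Fintype.ofFinite Y.carrier
  let := Fintype.ofFinite (X.tensor Y).carrier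
  simp only [Biset.stabSum, finsum_eq_sum_of_fintype, map_sum, LinearMap.sum_apply,
    kappaMul_single]
  rw [Finset.sum_comm, ← Fintype.sum_prod_type' (f := fun a b =>
    Finsupp.single (star (X.stab a) (Y.stab b)) (kappa R (X.stab a) (Y.stab b)))]
  rw [← Fintype.sum_fiberwise (fun p : X.carrier × Y.carrier => Biset.tmk X Y p.1 p.2)]
  refine Finset.sum_congr rfl fun z _ => ?_
  have h1 := card_fiber_smul_kappa R hH X Y z
  rw [finsum_eq_sum_of_fintype] at h1
  rw [← h1, Finsupp.single_finsetSum]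
  refine Finset.sum_congr rfl fun p _ => ?_
  rw [← stab_tmk, p.2]

theorem alphaMap_tensor [Finite G] [Finite H] [Finite K] (hH : IsUnit (Nat.card H : R))
    (a : RB R G H) (b : RB R H K) :
    alphaMap R G K (tensorRB R G H K a b) =
      kappaMul R G H K (alphaMap R G H a) (alphaMap R H K b) := by
  have h : (tensorRB R G H K).compr₂ (alphaMap R G K) =
      (kappaMul R G H K).compl₁₂ (alphaMap R G H) (alphaMap R H K) := by
    refine RB_hom_ext R fun X => RB_hom_ext R fun Y => ?_
    simp only [LinearMap.compl₁₂_apply, LinearMap.compr₂_apply, tensorRB_tmul, tensorB_bcls,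
      alphaMap_tmul_bcls, one_mul, one_smul]
    exact stabSum_tensor R hH X Y
  exact DFunLike.congr_fun (DFunLike.congr_fun h a) b

end Tensor

/-! ### Transitive bisets and the decomposition into orbits -/

section Transitive

variable {G H : Type u} [Group G] [Group H]

/-- The transitive biset `(G × H) / L`. -/
def Biset.transitive [Finite G] [Finite H] (L : Subgroup (G × H)) : Biset G H where
  carrier := (G × H) ⧸ L
  left := MulAction.compHom _ (MonoidHom.inl G H)
  right :=
    { smul := fun h q => ((1, h.unop⁻¹) : G × H) • q
      one_smul := fun q => by
        change ((1, (1 : H)⁻¹) : G × H) • q = q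
        rw [inv_one]; exact one_smul (G × H) q
      mul_smul := fun h h' q => by
        change ((1, (h'.unop * h.unop)⁻¹) : G × H) • q = ((1, h.unop⁻¹) : G × H) • ((1, h'.unop⁻¹) : G × H) • q
        rw [smul_smul]; simp }
  comm := @SMulCommClass.mk _ _ _ (_) (_) fun g h q => by
    change ((g, 1) : G × H) • ((1, h.unop⁻¹) : G × H) • q = ((1, h.unop⁻¹) : G × H) • ((g, 1) : G × H) • q
    rw [smul_smul, smul_smul]; simp

theorem Biset.transitive_act [Finite G] [Finite H] (L : Subgroup (G × H)) (g : G) (h : H)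
    (q : (Biset.transitive L).carrier) :
    g • MulOpposite.op h⁻¹ • q = (show (G × H) ⧸ L from ((g, h) : G × H) • (show (G × H) ⧸ L from q)) := by
  change ((g, 1) : G × H) • ((1, h⁻¹⁻¹) : G × H) • (show (G × H) ⧸ L from q) = _
  rw [smul_smul]; simp

/-- The sub-biset on an invariant subset. -/
def Biset.sub (X : Biset G H) (S : Set X.carrier) (hl : ∀ (g : G), ∀ a ∈ S, g • a ∈ S)
    (hr : ∀ (h : Hᵐᵒᵖ), ∀ a ∈ S, h • a ∈ S) : Biset G H where
  carrier := S
  left :=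
    { smul := fun g a => ⟨g • a.1, hl g _ a.2⟩
      one_smul := fun _ => Subtype.ext (one_smul _ _)
      mul_smul := fun _ _ _ => Subtype.ext (mul_smul _ _ _) }
  right :=
    { smul := fun g a => ⟨g • a.1, hr g _ a.2⟩
      one_smul := fun _ => Subtype.ext (one_smul _ _)
      mul_smul := fun _ _ _ => Subtype.ext (mul_smul _ _ _) }
  comm := @SMulCommClass.mk _ _ _ (_) (_) fun _ _ _ => Subtype.ext (smul_comm _ _ _)

/-- Splits off the orbit of `a`, leaving a smaller biset; this drives the induction in
`cls_induction`. -/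
theorem Biset.exists_split [Finite G] [Finite H] (X : Biset G H) (a : X.carrier) :
    ∃ Y : Biset G H, Nat.card Y.carrier < Nat.card X.carrier ∧
      X.cls = (Biset.transitive (X.stab a)).cls + Y.cls := by
  let act : G × H → X.carrier := fun p => p.1 • MulOpposite.op p.2⁻¹ • a
  have hact : ∀ p q : G × H, p.1 • MulOpposite.op p.2⁻¹ • act q = act (p * q) := by
    intro p q
    change p.1 • MulOpposite.op p.2⁻¹ • q.1 • MulOpposite.op q.2⁻¹ • a =
      (p.1 * q.1) • MulOpposite.op (p.2 * q.2)⁻¹ • a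
    rw [mul_inv_rev, MulOpposite.op_mul, mul_smul, mul_smul, 
      ← smul_comm q.1 (MulOpposite.op p.2⁻¹)]
  -- The complement of the orbit of `a`.
  let S : Set X.carrier := {b | ¬ ∃ p, act p = b}
  have hS : ∀ (p : G × H) (b : X.carrier), b ∈ S → p.1 • MulOpposite.op p.2⁻¹ • b ∈ S := by
    rintro p b hb ⟨q, hq⟩
    refine hb ⟨p⁻¹ * q, ?_⟩
    rw [← hact, hq]
    simp only [Prod.fst_inv, Prod.snd_inv]
    rw [smul_comm p.1, smul_smul (MulOpposite.op _) (MulOpposite.op _)]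
    simp
  have hl : ∀ (g : G), ∀ b ∈ S, g • b ∈ S := fun g b hb => by
    simpa using hS (g, 1) b hb
  have hr : ∀ (h : Hᵐᵒᵖ), ∀ b ∈ S, h • b ∈ S := fun h b hb => by
    simpa using hS (1, h.unop⁻¹) b hb
  refine ⟨X.sub S hl hr, ?_, ?_⟩
  · have ha : a ∉ S := fun h => h ⟨1, by simp [act]⟩
    exact Set.ncard_lt_card (s := S) fun h => ha (h ▸ Set.mem_univ a)
  · rw [← cls_sum]
    have hiff : ∀ p q : G × H, act p = act q ↔ p⁻¹ * q ∈ X.stab a := by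
      intro p q
      rw [Biset.mem_stab]
      change _ ↔ act (p⁻¹ * q) = a
      have h1 : act 1 = a := by simp [act]
      constructor
      · intro h
        rw [← hact, ← h, hact, inv_mul_cancel, h1]
      · intro h
        have : p.1 • MulOpposite.op p.2⁻¹ • act (p⁻¹ * q) = act p := by rw [h]
        rw [hact, mul_inv_cancel_left] at this
        exact this.symm
    -- The orbit map on cosets of the stabilizer, which `hiff` makes well defined and injective,
    -- glued with the inclusion of the complement.
    let F : (((Biset.transitive (X.stab a)).sum (X.sub S hl hr))).carrier → X.carrier :=
      fun t => Sum.elim (fun q : (G × H) ⧸ X.stab a => Quotient.lift act (fun p q h =>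
        (hiff p q).2 (QuotientGroup.leftRel_apply.1 h)) q) (fun b : S => b.1) t
    have hFl : ∀ p : G × H, F (Sum.inl (QuotientGroup.mk p : (G × H) ⧸ X.stab a)) = act p :=
      fun p => rfl
    have hbij : Function.Bijective F := by
      constructor
      · rintro (q | b) (q' | b') h
        · obtain ⟨p, rfl⟩ := QuotientGroup.mk_surjective q
          obtain ⟨p', rfl⟩ := QuotientGroup.mk_surjective q'
          rw [hFl, hFl, hiff] at h
          exact congrArg Sum.inl (QuotientGroup.eq.2 h)
        · obtain ⟨p, rfl⟩ := QuotientGroup.mk_surjective q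
          exact (b'.2 ⟨p, h⟩).elim
        · obtain ⟨p, rfl⟩ := QuotientGroup.mk_surjective q'
          exact (b.2 ⟨p, h.symm⟩).elim
        · exact congrArg Sum.inr (Subtype.ext h)
      · intro b
        by_cases hb : ∃ p, act p = b
        · obtain ⟨p, rfl⟩ := hb
          exact ⟨Sum.inl (QuotientGroup.mk p), rfl⟩
        · exact ⟨Sum.inr ⟨b, hb⟩, rfl⟩
    refine (cls_eq ⟨Equiv.ofBijective F hbij, ?_, ?_⟩).symm
    · rintro g (q | b)
      · obtain ⟨p, rfl⟩ := QuotientGroup.mk_surjective q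
        have := hact (g, 1) p
        simp only [inv_one, MulOpposite.op_one, one_smul] at this
        exact this.symm
      · rfl
    · rintro h (q | b)
      · obtain ⟨p, rfl⟩ := QuotientGroup.mk_surjective q
        have := hact (1, h.unop⁻¹) p
        simp only [inv_inv, MulOpposite.op_unop, one_smul] at this
        exact this.symm
      · rfl

theorem Biset.cls_induction [Finite G] [Finite H] {P : BisetClass G H → Prop} (h0 : P 0)
    (hadd : ∀ a b, P a → P b → P (a + b)) (ht : ∀ L, P (Biset.transitive L).cls) (X : Biset G H) :
    P X.cls := by
  induction hn : Nat.card X.carrier using Nat.strong_induction_on generalizing X with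
  | _ n ih =>
    by_cases hX : IsEmpty X.carrier
    · have : X.cls = 0 := cls_eq ⟨Equiv.equivPEmpty _, fun _ a => hX.elim a, fun _ a => hX.elim a⟩
      rwa [this]
    · obtain ⟨a⟩ := not_isEmpty_iff.1 hX
      obtain ⟨Y, hY, h⟩ := X.exists_split a
      rw [h]
      exact hadd _ _ (ht _) (ih _ (hn ▸ hY) Y rfl)

end Transitive

/-! ### Bijectivity of α and the isomorphism γ -/

section AlphaBijective

variable (R : Type w) [CommRing R] {G H : Type u} [CommGroup G] [CommGroup H] [Finite G] [Finite H]

/-- In general the stabilizers of the cosets are the conjugates of L; here G × H is commutative, so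
all of them are L itself. -/
theorem stab_transitive (L : Subgroup (G × H)) (q : (Biset.transitive L).carrier) :
    (Biset.transitive L).stab q = L := by
  ext ⟨g, h⟩
  rw [Biset.mem_stab, Biset.transitive_act]
  obtain ⟨p, rfl⟩ := QuotientGroup.mk_surjective q
  change (QuotientGroup.mk ((g, h) * p) : (G × H) ⧸ L) = QuotientGroup.mk p ↔ _
  rw [eq_comm, QuotientGroup.eq, mul_comm (g, h), inv_mul_cancel_left]

theorem stabSum_transitive (L : Subgroup (G × H)) :
    (Biset.transitive L).stabSum R = (L.index : R) • Finsupp.single L 1 := by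
  let := Fintype.ofFinite (Biset.transitive L).carrier
  rw [Biset.stabSum, finsum_eq_sum_of_fintype]
  simp only [stab_transitive, Finset.sum_const, Finset.card_univ]
  rw [Nat.cast_smul_eq_nsmul, Subgroup.index, ← Nat.card_eq_fintype_card]
  rfl

theorem isUnit_index (hG : IsUnit (Nat.card G : R)) (hH : IsUnit (Nat.card H : R))
    (L : Subgroup (G × H)) : IsUnit (L.index : R) := by
  refine isUnit_of_dvd_unit ?_ (hG.mul hH)
  rw [← Nat.cast_mul, ← Nat.card_prod]
  exact Nat.cast_dvd_cast L.index_dvd_card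

/-- The transitive bisets span, and α takes the one of L to [G × H : L] L. The index divides |G|
|H|, so it is a unit and the inverse map divides by it. -/
theorem alphaMap_bijective (hG : IsUnit (Nat.card G : R)) (hH : IsUnit (Nat.card H : R)) :
    Function.Bijective (alphaMap R G H) := by
  let β : RS R (G × H) →ₗ[R] RB R G H := Finsupp.linearCombination R fun L =>
    Ring.inverse (L.index : R) • (1 ⊗ₜ bcls (Biset.transitive L))
  have h1 : β ∘ₗ alphaMap R G H = LinearMap.id := by
    refine RB_hom_ext R fun X => ?_
    refine Biset.cls_induction (P := fun c => (β ∘ₗ alphaMap R G H)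
      (1 ⊗ₜ Algebra.GrothendieckAddGroup.of c) =
        LinearMap.id (R := R) (1 ⊗ₜ Algebra.GrothendieckAddGroup.of c)) ?_ ?_ ?_ X
    · simp
    · intro a b ha hb
      rw [map_add, TensorProduct.tmul_add, map_add, map_add, ha, hb]
    · intro L
      change β (alphaMap R G H (1 ⊗ₜ bcls (Biset.transitive L))) = 1 ⊗ₜ bcls (Biset.transitive L)
      rw [alphaMap_tmul_bcls, one_smul, stabSum_transitive, map_smul]
      simp only [β, Finsupp.linearCombination_single, one_smul]
      rw [smul_smul, Ring.mul_inverse_cancel _ (isUnit_index R hG hH L), one_smul]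
  have h2 : alphaMap R G H ∘ₗ β = LinearMap.id := by
    refine RS_hom_ext R fun L => ?_
    simp only [β, LinearMap.comp_apply, Finsupp.linearCombination_single, one_smul, map_smul,
      alphaMap_tmul_bcls, stabSum_transitive, LinearMap.id_apply]
    rw [smul_smul, Ring.inverse_mul_cancel _ (isUnit_index R hG hH L), one_smul]
  exact ⟨Function.LeftInverse.injective (g := β) fun a => LinearMap.congr_fun h1 a,
    Function.RightInverse.surjective (g := β) fun a => LinearMap.congr_fun h2 a⟩

end AlphaBijective

/-- A surjective endomorphism of a finitely generated module over a commutative ring is injective.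
-/
theorem zetaMap_bijective (R : Type w) [CommRing R] (X : Type u) [Group X] [Finite X] :
    Function.Bijective (zetaMap R X) :=
  ⟨OrzechProperty.injective_of_surjective_endomorphism _ (zetaMap_surjective R X),
    zetaMap_surjective R X⟩

theorem LinCat.exists_algEquiv {R : Type w} [CommRing R] {ι : Type v} [Fintype ι] [DecidableEq ι]
    {A : LinCat.{v, w, x} R ι} {A' : LinCat.{v, w, u} R ι}
    (f : ∀ i j, A.Hom i j →ₗ[R] A'.Hom i j) (hf : ∀ i j, Function.Bijective (f i j))
    (hmul : ∀ i j k a b, f i k (A.comp i j k a b) = A'.comp i j k (f i j a) (f j k b)) :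
    ∃ e : A.Alg ≃ₐ[R] A'.Alg, ∀ (a : A.Alg) (i j : ι), e a i j = f i j (a i j) := by
  let F : A.Alg →ₗ[R] A'.Alg :=
    { toFun := fun a i j => f i j (a i j)
      map_add' := fun a b => LinCat.ext fun i j => map_add (f i j) (a i j) (b i j)
      map_smul' := fun r a => LinCat.ext fun i j => map_smul (f i j) r (a i j) }
  obtain ⟨e, he⟩ := exists_algEquiv_of_bijective F
    ⟨fun a b h => LinCat.ext fun i j => (hf i j).1 (congrFun (congrFun h i) j),
    fun a => ⟨fun i j => ((hf i j).2 (a i j)).choose,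
      LinCat.ext fun i j => ((hf i j).2 (a i j)).choose_spec⟩⟩
    (fun a b => LinCat.ext fun i k => by
      change f i k ((a * b) i k) = ∑ j, A'.comp i j k (f i j (a i j)) (f j k (b j k))
      rw [LinCat.mul_apply, map_sum]
      exact Finset.sum_congr rfl fun j _ => hmul i j k _ _)
  exact ⟨e, fun a i j => congrFun (congrFun (he a) i) j⟩

theorem exists_gamma {ι : Type v} [Fintype ι] [DecidableEq ι] (G : ι → Type u)
    [∀ i, CommGroup (G i)] [∀ i, Finite (G i)] (R : Type w) [CommRing R]
    (hG : ∀ i, IsUnit (Nat.card (G i) : R)) :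
    ∃ γ : BAlg R G ≃ₐ[R] ATilde R G hG, ∀ (a : BAlg R G) (i j : ι),
      γ a i j = zetaMap R (G i × G j) (alphaMap R (G i) (G j) (a i j)) :=
  LinCat.exists_algEquiv (A := bisetCat R G) (A' := subgroupCat R G hG)
    (fun i j => zetaMap R (G i × G j) ∘ₗ alphaMap R (G i) (G j))
    (fun i j => (zetaMap_bijective R _).comp (alphaMap_bijective R (hG i) (hG j)))
    (fun _ j _ a b => (congrArg (zetaMap R _) (alphaMap_tensor R (hG j) a b)).trans
      (tildeMul_zeta R _ _).symm)

/-! ### Subgroups of finite cyclic groups -/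

section Cyclic

variable {A : Type u} [CommGroup A] [Finite A] [IsCyclic A]

/-- The equation x^n = 1 has gcd(|A|, n) solutions in a cyclic group A. For n = |U| this is |U|, so
the elements of U are all of them. Consequently the subgroup lattice of A is the divisor lattice of
|A|. -/
theorem mem_iff_pow_card_eq_one (U : Subgroup A) (a : A) : a ∈ U ↔ a ^ Nat.card U = 1 := by
  have hle : U ≤ (powMonoidHom (Nat.card U) : A →* A).ker := fun b hb =>
    congrArg Subtype.val (pow_card_eq_one' (x := (⟨b, hb⟩ : U)))
  have hcard : Nat.card U = Nat.card (powMonoidHom (Nat.card U) : A →* A).ker := by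
    rw [IsCyclic.card_powMonoidHom_ker, Nat.gcd_eq_right U.card_subgroup_dvd_card]
  have := Subgroup.eq_of_le_of_card_ge hle hcard.ge
  exact (SetLike.ext_iff.1 this a).trans MonoidHom.mem_ker

theorem mem_iff_orderOf_dvd (U : Subgroup A) (a : A) : a ∈ U ↔ orderOf a ∣ Nat.card U := by
  rw [mem_iff_pow_card_eq_one, orderOf_dvd_iff_pow_eq_one]

theorem le_iff_card_dvd (U V : Subgroup A) : U ≤ V ↔ Nat.card U ∣ Nat.card V := by
  refine ⟨Subgroup.card_dvd_of_le, fun h a ha => ?_⟩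
  rw [mem_iff_orderOf_dvd] at *
  exact ha.trans h

theorem eq_iff_card_eq (U V : Subgroup A) : U = V ↔ Nat.card U = Nat.card V :=
  ⟨fun h => h ▸ rfl, fun h => le_antisymm ((le_iff_card_dvd U V).2 h.dvd)
    ((le_iff_card_dvd V U).2 h.symm.dvd)⟩

theorem exists_card_eq (d : ℕ) (hd : d ∣ Nat.card A) : ∃ U : Subgroup A, Nat.card U = d :=
  ⟨(powMonoidHom d).ker, by rw [IsCyclic.card_powMonoidHom_ker, Nat.gcd_eq_right hd]⟩

theorem card_inf (U V : Subgroup A) :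
    Nat.card (U ⊓ V : Subgroup A) = (Nat.card U).gcd (Nat.card V) := by
  refine Nat.dvd_antisymm (Nat.dvd_gcd (Subgroup.card_dvd_of_le inf_le_left)
    (Subgroup.card_dvd_of_le inf_le_right)) ?_
  obtain ⟨W, hW⟩ := exists_card_eq (A := A) ((Nat.card U).gcd (Nat.card V))
    ((Nat.gcd_dvd_left _ _).trans U.card_subgroup_dvd_card)
  rw [← hW]
  refine Subgroup.card_dvd_of_le (le_inf ?_ ?_)
  · rw [le_iff_card_dvd, hW]; exact Nat.gcd_dvd_left _ _
  · rw [le_iff_card_dvd, hW]; exact Nat.gcd_dvd_right _ _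

theorem card_sup (U V : Subgroup A) :
    Nat.card (U ⊔ V : Subgroup A) = (Nat.card U).lcm (Nat.card V) := by
  refine Nat.dvd_antisymm ?_ (Nat.lcm_dvd (Subgroup.card_dvd_of_le le_sup_left)
    (Subgroup.card_dvd_of_le le_sup_right))
  obtain ⟨W, hW⟩ := exists_card_eq (A := A) ((Nat.card U).lcm (Nat.card V))
    (Nat.lcm_dvd U.card_subgroup_dvd_card V.card_subgroup_dvd_card)
  rw [← hW]
  refine Subgroup.card_dvd_of_le (sup_le ?_ ?_)
  · rw [le_iff_card_dvd, hW]; exact Nat.dvd_lcm_left _ _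
  · rw [le_iff_card_dvd, hW]; exact Nat.dvd_lcm_right _ _

/-- Distributivity of the divisor lattice: on exponents of a prime it reads max(b, min(u, v)) =
min(max(b, u), max(b, v)). It fails for the three subgroups of order 2 in a Klein four-group, so
cyclicity is essential. -/
theorem sup_inf_eq_of_sup_eq {B U V Q : Subgroup A} (hU : B ⊔ U = Q) (hV : B ⊔ V = Q) :
    B ⊔ U ⊓ V = Q := by
  rw [eq_iff_card_eq, card_sup] at hU hV ⊢
  rw [card_inf]
  have hpos : ∀ W : Subgroup A, Nat.card W ≠ 0 := fun W => Nat.card_pos.ne'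
  refine Nat.eq_of_factorization_eq (Nat.lcm_ne_zero (hpos _) (Nat.gcd_ne_zero_left (hpos _)))
    (hpos _) fun p => ?_
  have h1 := congrArg (fun n => n.factorization p) hU
  have h2 := congrArg (fun n => n.factorization p) hV
  simp only [Nat.factorization_lcm (hpos _) (hpos _), Finsupp.sup_apply] at h1 h2
  rw [Nat.factorization_lcm (hpos _) (Nat.gcd_ne_zero_left (hpos _)),
    Nat.factorization_gcd (hpos _) (hpos _), Finsupp.sup_apply, Finsupp.inf_apply]
  omega

end Cyclic

/-! ### Orders of projections and kernels -/

section Orders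

variable {A B C : Type u} [Group A] [Group B] [Group C]

/-- The projection of L to A has image p₁(L) and kernel 1 × k₂(L). -/
theorem card_p1_mul_card_k2 (L : Subgroup (A × B)) :
    Nat.card (p1 L) * Nat.card (k2 L) = Nat.card L := by
  let f : L →* A := (MonoidHom.fst A B).comp L.subtype
  have hr : f.range = p1 L := by
    ext a; simp [f, p1, MonoidHom.mem_range, Subgroup.mem_map]
  have hk : Nat.card f.ker = Nat.card (k2 L) := Nat.card_congr
    { toFun := fun s => ⟨s.1.1.2, by
        obtain ⟨⟨⟨a, b⟩, h⟩, rfl : a = 1⟩ := s; exact h⟩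
      invFun := fun b => ⟨⟨(1, b.1), b.2⟩, rfl⟩
      left_inv := by rintro ⟨⟨⟨a, b⟩, h⟩, rfl : a = 1⟩; rfl
      right_inv := fun _ => rfl }
  rw [← hr, ← hk, ← Subgroup.index_ker, mul_comm, Subgroup.card_mul_index]

theorem card_p2_mul_card_k1 (L : Subgroup (A × B)) :
    Nat.card (p2 L) * Nat.card (k1 L) = Nat.card L := by
  let f : L →* B := (MonoidHom.snd A B).comp L.subtype
  have hr : f.range = p2 L := by
    ext a; simp [f, p2, MonoidHom.mem_range, Subgroup.mem_map]
  have hk : Nat.card f.ker = Nat.card (k1 L) := Nat.card_congr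
    { toFun := fun s => ⟨s.1.1.1, by
        obtain ⟨⟨⟨a, b⟩, h⟩, rfl : b = 1⟩ := s; exact h⟩
      invFun := fun b => ⟨⟨(b.1, 1), b.2⟩, rfl⟩
      left_inv := by rintro ⟨⟨⟨a, b⟩, h⟩, rfl : b = 1⟩; rfl
      right_inv := fun _ => rfl }
  rw [← hr, ← hk, ← Subgroup.index_ker, mul_comm, Subgroup.card_mul_index]

theorem card_p1_mul_card_k2_eq (L : Subgroup (A × B)) :
    Nat.card (p1 L) * Nat.card (k2 L) = Nat.card (p2 L) * Nat.card (k1 L) := by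
  rw [card_p1_mul_card_k2, card_p2_mul_card_k1]

theorem k1_le_p1 (L : Subgroup (A × B)) : k1 L ≤ p1 L := fun _ h => mem_p1.2 ⟨1, h⟩

theorem k2_le_p2 (L : Subgroup (A × B)) : k2 L ≤ p2 L := fun _ h => mem_p2.2 ⟨1, h⟩

/-- This is |p₁(S)| |k₂(S)| = |p₂(S)| |k₁(S)| for S = L ∩ (A × k₁(M)). The condition on the
projections gives p₂(S) = k₁(M). -/
theorem card_k1_star {L : Subgroup (A × B)} {M : Subgroup (B × C)} (h : p2 L = p1 M) :
    Nat.card (k1 (star L M)) * Nat.card (k2 L ⊓ k1 M : Subgroup B) =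
      Nat.card (k1 L) * Nat.card (k1 M) := by
  let S : Subgroup (A × B) := L ⊓ (⊤ : Subgroup A).prod (k1 M)
  have hS : ∀ p : A × B, p ∈ S ↔ p ∈ L ∧ (p.2, 1) ∈ M := by
    intro p; simp [S, Subgroup.mem_prod, mem_k1]
  have h1 : p1 S = k1 (star L M) := by
    ext a; simp only [mem_p1, mem_k1, mem_star, hS]
  have h2 : k2 S = k2 L ⊓ k1 M := by
    ext b; simp only [mem_k2, Subgroup.mem_inf, hS]; rfl
  have h3 : p2 S = k1 M := by
    ext b; simp only [mem_p2, mem_k1, hS]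
    refine ⟨fun ⟨_, _, hb⟩ => hb, fun hb => ?_⟩
    obtain ⟨a, ha⟩ := mem_p2.1 (h ▸ k1_le_p1 M hb : b ∈ p2 L)
    exact ⟨a, ha, hb⟩
  have h4 : k1 S = k1 L := by
    ext a; simp only [mem_k1, hS]
    exact ⟨fun h => h.1, fun h => ⟨h, M.one_mem⟩⟩
  rw [← h1, ← h2, card_p1_mul_card_k2_eq, h3, h4, mul_comm]

theorem p1_star {L : Subgroup (A × B)} {M : Subgroup (B × C)} (h : p2 L = p1 M) :
    p1 (star L M) = p1 L :=
  (mem_fullSub_prod.1 (star_mem (mem_fullSub_prod.2 ⟨rfl, rfl⟩)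
    (mem_fullSub_prod.2 ⟨h.symm, rfl⟩))).1

theorem p2_star {L : Subgroup (A × B)} {M : Subgroup (B × C)} (h : p2 L = p1 M) :
    p2 (star L M) = p2 M :=
  (mem_fullSub_prod.1 (star_mem (mem_fullSub_prod.2 ⟨rfl, rfl⟩)
    (mem_fullSub_prod.2 ⟨h.symm, rfl⟩))).2

end Orders

/-! ### Primary parts -/

section Primary

variable {A B : Type u} [CommGroup A] [CommGroup B]

theorem mem_pPart {p : ℕ} {U : Subgroup A} {a : A} :
    a ∈ pPart p U ↔ a ∈ U ∧ ∃ n : ℕ, a ^ p ^ n = 1 := Iff.rfl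

theorem pPart_inf (p : ℕ) (U V : Subgroup A) : pPart p (U ⊓ V) = pPart p U ⊓ pPart p V := by
  ext a; simp only [mem_pPart, Subgroup.mem_inf]; tauto

theorem k1_pPart (p : ℕ) (L : Subgroup (A × B)) : k1 (pPart p L) = pPart p (k1 L) := by
  ext a; simp [mem_pPart, mem_k1, Prod.ext_iff]

theorem k2_pPart (p : ℕ) (L : Subgroup (A × B)) : k2 (pPart p L) = pPart p (k2 L) := by
  ext a; simp [mem_pPart, mem_k2, Prod.ext_iff]

/-- A power of `b` with exponent `≡ 1` modulo `p ^ n` that has `p`-power order. -/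
theorem exists_pow_pPower [Finite B] {p : ℕ} (hp : p.Prime) (n : ℕ) (b : B) :
    ∃ e m : ℕ, e ≡ 1 [MOD p ^ n] ∧ (b ^ e) ^ p ^ m = 1 := by
  obtain ⟨k, r, hr, hk⟩ := Nat.exists_eq_pow_mul_and_not_dvd (orderOf_pos b).ne' p hp.ne_one
  have hc : (p ^ n).Coprime r := Nat.Coprime.pow_left n ((Nat.Prime.coprime_iff_not_dvd hp).2 hr)
  -- With r the part of the order of `b` prime to p, an exponent that is 1 modulo p^n and 0 modulo r
  -- kills the p'-part of `b`.
  obtain ⟨e, he1, he2⟩ := Nat.chineseRemainder hc 1 0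
  refine ⟨e, k, he1, ?_⟩
  rw [← pow_mul, ← orderOf_dvd_iff_pow_eq_one, hk, mul_comm]
  exact Nat.mul_dvd_mul ((Nat.modEq_zero_iff_dvd).1 he2) dvd_rfl

theorem pow_eq_self_of_modEq {p n e : ℕ} {a : A} (ha : a ^ p ^ n = 1) (he : e ≡ 1 [MOD p ^ n]) :
    a ^ e = a := by
  conv_rhs => rw [← pow_one a]
  exact pow_eq_pow_iff_modEq.2 (he.of_dvd (orderOf_dvd_of_pow_eq_one ha))

theorem p1_pPart [Finite B] {p : ℕ} (hp : p.Prime) (L : Subgroup (A × B)) :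
    p1 (pPart p L) = pPart p (p1 L) := by
  ext a
  simp only [mem_p1, mem_pPart]
  constructor
  · rintro ⟨b, hL, n, hn⟩
    exact ⟨⟨b, hL⟩, n, congrArg Prod.fst hn⟩
  · rintro ⟨⟨b, hL⟩, n, hn⟩
    -- A partner `b` of the p-element `a` need not be a p-element; the power (a, b)^e = (a, b^e) has
    -- the same first coordinate and lies in the p-part of L.
    obtain ⟨e, m, he, hm⟩ := exists_pow_pPower hp n b
    refine ⟨b ^ e, ?_, n + m, ?_⟩
    · have := L.pow_mem hL e
      rwa [Prod.pow_mk, pow_eq_self_of_modEq hn he] at this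
    · rw [Prod.pow_mk, pow_add, pow_mul, hn, one_pow, mul_comm, pow_mul, hm, one_pow]
      rfl

theorem p2_pPart [Finite A] {p : ℕ} (hp : p.Prime) (L : Subgroup (A × B)) :
    p2 (pPart p L) = pPart p (p2 L) := by
  ext b
  simp only [mem_p2, mem_pPart]
  constructor
  · rintro ⟨a, hL, n, hn⟩
    exact ⟨⟨a, hL⟩, n, congrArg Prod.snd hn⟩
  · rintro ⟨⟨a, hL⟩, n, hn⟩
    obtain ⟨e, m, he, hm⟩ := exists_pow_pPower hp n a
    refine ⟨a ^ e, ?_, n + m, ?_⟩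
    · have := L.pow_mem hL e
      rwa [Prod.pow_mk, pow_eq_self_of_modEq hn he] at this
    · rw [Prod.pow_mk, pow_add, pow_mul b, hn, one_pow, mul_comm, pow_mul, hm, one_pow]
      rfl

/-- The set of p-elements of U is a p-group, and it contains every Sylow p-subgroup of U. -/
theorem card_pPart [Finite A] {p : ℕ} (hp : p.Prime) (U : Subgroup A) :
    Nat.card (pPart p U) = p ^ (Nat.card U).factorization p := by
  have := Fact.mk hp
  have hle : pPart p U ≤ U := fun a ha => ha.1
  obtain ⟨n, hn⟩ := IsPGroup.iff_card.1 (show IsPGroup p (pPart p U) from fun ⟨a, _, n, hn⟩ =>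
    ⟨n, Subtype.ext hn⟩)
  obtain ⟨P⟩ : Nonempty (Sylow p U) := inferInstance
  have hP : (P : Subgroup U).map U.subtype ≤ pPart p U := by
    rintro _ ⟨a, ha, rfl⟩
    obtain ⟨k, hk⟩ := P.isPGroup' ⟨a, ha⟩
    exact ⟨a.2, k, congrArg (fun z : (P : Subgroup U) => (z.1.1 : A)) hk⟩
  have h1 := Subgroup.card_dvd_of_le hP
  rw [Subgroup.card_map_of_injective U.subtype_injective, Sylow.card_eq_multiplicity] at h1
  refine Nat.dvd_antisymm ?_ h1
  have h2 := Subgroup.card_dvd_of_le hle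
  rw [hn] at h2 ⊢
  exact pow_dvd_pow _ ((hp.pow_dvd_iff_le_factorization Nat.card_pos.ne').1 h2)

end Primary

/-! ### Products over all primes -/

section Primes

variable (R : Type w) [CommRing R]

theorem finite_primes_dvd {n : ℕ} (hn : n ≠ 0) : {p : Nat.Primes | (p : ℕ) ∣ n}.Finite := by
  refine Set.Finite.of_finite_image (f := fun p : Nat.Primes => (p : ℕ))
    ((n.primeFactors.finite_toSet).subset ?_) (Subtype.val_injective.injOn)
  rintro _ ⟨p, hp, rfl⟩
  exact Nat.mem_primeFactors.2 ⟨p.2, hp, hn⟩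

/-- A multiplicative function is the product of its values at the prime powers dividing `n`. -/
theorem finprod_primes_eq (f : ℕ → ℕ) (hf : ∀ x y : ℕ, x.Coprime y → f (x * y) = f x * f y)
    (h1 : f 1 = 1) {n : ℕ} (hn : n ≠ 0) :
    ∏ᶠ p : Nat.Primes, (f ((p : ℕ) ^ n.factorization p) : R) = f n := by
  rw [Nat.multiplicative_factorization f hf h1 hn, Finsupp.prod, Nat.cast_prod,
    Nat.support_factorization]
  refine (finprod_eq_prod_of_mulSupport_subset (α := Nat.Primes) _
    (s := (finite_primes_dvd hn).toFinset) ?_).trans ?_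
  · intro p hp
    simp only [Set.Finite.coe_toFinset, Set.mem_ofPred_eq]
    by_contra h
    refine hp ?_
    simp only
    rw [Nat.factorization_eq_zero_of_not_dvd h, pow_zero, h1, Nat.cast_one]
  · refine Finset.prod_nbij (fun p : Nat.Primes => (p : ℕ)) ?_ ?_ ?_ fun _ _ => rfl
    · intro p hp
      exact Nat.mem_primeFactors.2 ⟨p.2, (finite_primes_dvd hn).mem_toFinset.1 hp, hn⟩
    · exact Subtype.val_injective.injOn
    · intro p hp
      obtain ⟨h1, h2, _⟩ := Nat.mem_primeFactors.1 hp
      exact ⟨⟨p, h1⟩, (finite_primes_dvd hn).mem_toFinset.2 h2, rfl⟩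

theorem hasFiniteMulSupport_of_dvd {M : Type*} [One M] {f : Nat.Primes → M} {n : ℕ} (hn : n ≠ 0)
    (h : ∀ p : Nat.Primes, ¬ (p : ℕ) ∣ n → f p = 1) : f.HasFiniteMulSupport :=
  (finite_primes_dvd hn).subset fun p hp => by
    by_contra h'
    exact hp (h p h')

/-- The function `φ(p^b)` if `a = b` and `p^a` if not. -/
def primeWeight (p a b : ℕ) : ℕ := if a = b then Nat.totient (p ^ b) else p ^ a

theorem primeWeight_zero (p : ℕ) : primeWeight p 0 0 = 1 := by simp [primeWeight]

/-- The coboundary identity at a single prime. Here P, a, b, c, s are the exponents of p in the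
orders of p₁(L), k₁(L), k₂(L), k₁(M), k₁(L * M), and Q belongs to p₂(L) = p₁(M). By `h`, a = P
exactly if b = Q. If a = P, then s = a and both sides agree factor by factor. If a < P and c = Q,
then s = P and each side has one totient factor, with positive exponent. Otherwise all weights are
pure powers of p. -/
theorem primeWeight_mul {p : ℕ} (hp : p.Prime) {P a Q b c : ℕ} (ha : a ≤ P) (hb : b ≤ Q)
    (hc : c ≤ Q) (h : P + b = Q + a) {s : ℕ} (hs : s + min b c = a + c) :
    primeWeight p (min b c) Q * primeWeight p s P = primeWeight p a P * primeWeight p c Q := by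
  by_cases haP : a = P
  · obtain rfl : b = Q := by omega
    subst haP
    rw [min_eq_right hc] at hs ⊢
    obtain rfl : s = a := by omega
    exact mul_comm _ _
  · have hbQ : b ≠ Q := by omega
    by_cases hcQ : c = Q
    · subst hcQ
      rw [min_eq_left hb] at hs ⊢
      obtain rfl : s = P := by omega
      simp only [primeWeight, if_neg haP, if_neg hbQ, if_true]
      rw [Nat.totient_prime_pow hp (by omega), Nat.totient_prime_pow hp (by omega), ← mul_assoc,
        ← mul_assoc, ← pow_add, ← pow_add]
      congr 2
      omega
    · have h1 : min b c ≠ Q := by omega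
      have h2 : s ≠ P := by
        rcases le_total b c with h' | h'
        · rw [min_eq_left h'] at hs; omega
        · rw [min_eq_right h'] at hs; omega
      simp only [primeWeight, if_neg haP, if_neg hcQ, if_neg h1, if_neg h2]
      rw [← pow_add, ← pow_add]
      congr 1
      omega

/-- For a divisor `t` of `q`, the largest divisor of `t` whose prime powers are those of `q`. -/
noncomputable def fullPart (t q : ℕ) : ℕ :=
  (q.factorization.filter fun p => t.factorization p = q.factorization p).prod fun p k => p ^ k

theorem factorization_fullPart (t q : ℕ) : (fullPart t q).factorization =
    q.factorization.filter fun p => t.factorization p = q.factorization p :=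
  Nat.prod_pow_factorization_eq_self fun p hp => by
    rw [Finsupp.support_filter, Finset.mem_filter] at hp
    exact Nat.prime_of_mem_primeFactors hp.1

theorem factorization_fullPart_apply (t q p : ℕ) : (fullPart t q).factorization p =
    if t.factorization p = q.factorization p then q.factorization p else 0 := by
  classical
  rw [factorization_fullPart, Finsupp.filter_apply]

theorem fullPart_ne_zero (t q : ℕ) : fullPart t q ≠ 0 := by
  unfold fullPart Finsupp.prod
  refine Finset.prod_ne_zero_iff.2 fun p hp => pow_ne_zero _ ?_
  rw [Finsupp.support_filter, Finset.mem_filter] at hp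
  exact (Nat.prime_of_mem_primeFactors hp.1).ne_zero

theorem fullPart_dvd_left {t q : ℕ} (ht : t ≠ 0) : fullPart t q ∣ t := by
  rw [← Nat.factorization_le_iff_dvd (fullPart_ne_zero t q) ht]
  intro p
  rw [factorization_fullPart_apply]
  split_ifs <;> omega

theorem fullPart_dvd_right {t q : ℕ} (hq : q ≠ 0) : fullPart t q ∣ q := by
  rw [← Nat.factorization_le_iff_dvd (fullPart_ne_zero t q) hq]
  intro p
  rw [factorization_fullPart_apply]
  split_ifs <;> omega

theorem coprime_fullPart_div {t q : ℕ} (ht : t ≠ 0) :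
    (fullPart t q).Coprime (t / fullPart t q) := by
  have hd := fullPart_dvd_left (q := q) ht
  refine Nat.Coprime.symm (Nat.coprime_of_dvd fun p hp h1 h2 => ?_)
  have h3 := (hp.dvd_iff_one_le_factorization (Nat.div_ne_zero_iff_of_dvd hd |>.2
    ⟨ht, fullPart_ne_zero t q⟩)).1 h1
  have h4 := (hp.dvd_iff_one_le_factorization (fullPart_ne_zero t q)).1 h2
  rw [Nat.factorization_div hd, Finsupp.tsub_apply, factorization_fullPart_apply] at h3
  rw [factorization_fullPart_apply] at h4
  split_ifs at h3 h4 <;> omega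

/-- At a prime where t already has the full exponent of q there is no condition on b; at the others
b must have the full exponent itself. The quotient q / `fullPart t q` collects exactly the latter
prime powers. -/
theorem lcm_eq_iff_div_fullPart_dvd {t q b : ℕ} (htq : t ∣ q) (hb : b ∣ q) (hq : q ≠ 0) :
    b.lcm t = q ↔ q / fullPart t q ∣ b := by
  have ht : t ≠ 0 := ne_zero_of_dvd_ne_zero hq htq
  have hb0 : b ≠ 0 := ne_zero_of_dvd_ne_zero hq hb
  have hd := fullPart_dvd_right (t := t) hq
  have hdiv : q / fullPart t q ≠ 0 := (Nat.div_ne_zero_iff_of_dvd hd).2 ⟨hq, fullPart_ne_zero t q⟩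
  have h1 := (Nat.factorization_le_iff_dvd ht hq).2 htq
  have h2 := (Nat.factorization_le_iff_dvd hb0 hq).2 hb
  rw [← Nat.factorization_le_iff_dvd hdiv hb0]
  constructor
  · intro h p
    have h3 := congrArg (fun n => n.factorization p) h
    simp only [Nat.factorization_lcm hb0 ht, Finsupp.sup_apply] at h3
    rw [Nat.factorization_div hd, Finsupp.tsub_apply, factorization_fullPart_apply]
    have := h1 p
    split_ifs <;> omega
  · intro h
    refine Nat.eq_of_factorization_eq (Nat.lcm_ne_zero hb0 ht) hq fun p => ?_
    have h3 := h p
    rw [Nat.factorization_div hd, Finsupp.tsub_apply, factorization_fullPart_apply] at h3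
    rw [Nat.factorization_lcm hb0 ht, Finsupp.sup_apply]
    have := h1 p
    have := h2 p
    split_ifs at h3 <;> omega

/-- The complementary statement: q is the product of the coprime numbers `fullPart t q` and q /
`fullPart t q`, so only the primes of the former constrain d. -/
theorem lcm_div_fullPart_eq_iff {t q d : ℕ} (hd : d ∣ q) (hq : q ≠ 0) :
    d.lcm (q / fullPart t q) = q ↔ fullPart t q ∣ d := by
  have hd0 : d ≠ 0 := ne_zero_of_dvd_ne_zero hq hd
  have hf := fullPart_dvd_right (t := t) hq
  have hdiv : q / fullPart t q ≠ 0 := (Nat.div_ne_zero_iff_of_dvd hf).2 ⟨hq, fullPart_ne_zero t q⟩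
  have h2 := (Nat.factorization_le_iff_dvd hd0 hq).2 hd
  rw [← Nat.factorization_le_iff_dvd (fullPart_ne_zero t q) hd0]
  constructor
  · intro h p
    have h3 := congrArg (fun n => n.factorization p) h
    simp only [Nat.factorization_lcm hd0 hdiv, Finsupp.sup_apply, Nat.factorization_div hf,
      Finsupp.tsub_apply, factorization_fullPart_apply] at h3
    rw [factorization_fullPart_apply]
    split_ifs at h3 ⊢ <;> omega
  · intro h
    refine Nat.eq_of_factorization_eq (Nat.lcm_ne_zero hd0 hdiv) hq fun p => ?_
    have h3 := h p
    have := h2 p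
    rw [factorization_fullPart_apply] at h3
    simp only [Nat.factorization_lcm hd0 hdiv, Finsupp.sup_apply, Nat.factorization_div hf,
      Finsupp.tsub_apply, factorization_fullPart_apply]
    split_ifs at h3 ⊢ <;> omega

/-- With f the full part, the divisors in question are f e with e dividing t/f. As f and t/f are
coprime, φ(f e) = φ(f) φ(e), and the φ(e) add up to t/f. -/
theorem sum_totient_fullPart {t q : ℕ} (htq : t ∣ q) (hq : q ≠ 0) :
    ∑ d ∈ t.divisors with fullPart t q ∣ d, Nat.totient d =
      Nat.totient (fullPart t q) * (t / fullPart t q) := by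
  have ht : t ≠ 0 := ne_zero_of_dvd_ne_zero hq htq
  have hd := fullPart_dvd_left (q := q) ht
  have hc := coprime_fullPart_div (q := q) ht
  set f := fullPart t q with hf
  have hf0 : f ≠ 0 := fullPart_ne_zero t q
  conv_rhs => rw [← Nat.sum_totient (t / f)]
  rw [Finset.mul_sum]
  symm
  refine Finset.sum_bij (fun e _ => f * e) ?_ ?_ ?_ ?_
  · intro e he
    rw [Nat.mem_divisors] at he
    rw [Finset.mem_filter, Nat.mem_divisors]
    exact ⟨⟨(Nat.mul_dvd_mul_left f he.1).trans (Nat.mul_div_cancel' hd).dvd, ht⟩,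
      Nat.dvd_mul_right _ _⟩
  · intro e _ e' _ h
    exact Nat.eq_of_mul_eq_mul_left (Nat.pos_of_ne_zero hf0) h
  · intro d hd'
    rw [Finset.mem_filter, Nat.mem_divisors] at hd'
    obtain ⟨⟨h1, _⟩, e, rfl⟩ := hd'
    refine ⟨e, ?_, rfl⟩
    rw [Nat.mem_divisors]
    refine ⟨?_, (Nat.div_ne_zero_iff_of_dvd hd).2 ⟨ht, hf0⟩⟩
    rw [Nat.dvd_div_iff_mul_dvd hd]
    exact h1
  · intro e he
    rw [Nat.mem_divisors] at he
    exact (Nat.totient_mul (hc.coprime_dvd_right he.1)).symm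

/-- The primes with equal exponents contribute φ of the full part, the others contribute their
powers in t. This closed form is what the Möbius sum produces, and it links that sum to the
definition of λ. -/
theorem finprod_primeWeight {t q : ℕ} (htq : t ∣ q) (hq : q ≠ 0) :
    ∏ᶠ p : Nat.Primes, (primeWeight p (t.factorization p) (q.factorization p) : R) =
      (Nat.totient (fullPart t q) * (t / fullPart t q) : ℕ) := by
  have ht : t ≠ 0 := ne_zero_of_dvd_ne_zero hq htq
  have hd := fullPart_dvd_left (q := q) ht
  have hdiv : t / fullPart t q ≠ 0 := (Nat.div_ne_zero_iff_of_dvd hd).2 ⟨ht, fullPart_ne_zero t q⟩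
  rw [Nat.cast_mul, ← finprod_primes_eq R Nat.totient (fun _ _ => Nat.totient_mul) Nat.totient_one
    (fullPart_ne_zero t q), show ((t / fullPart t q : ℕ) : R) = (id (t / fullPart t q) : ℕ) from rfl,
    ← finprod_primes_eq R id (fun _ _ _ => rfl) rfl hdiv, ← finprod_mul_distrib]
  · refine finprod_congr fun p => ?_
    rw [← Nat.cast_mul, Nat.factorization_div hd, Finsupp.tsub_apply, factorization_fullPart_apply,
      primeWeight]
    split_ifs with h
    · simp [h]
    · simp
  · refine hasFiniteMulSupport_of_dvd (fullPart_ne_zero t q) fun p hp => ?_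
    simp [Nat.factorization_eq_zero_of_not_dvd hp]
  · refine hasFiniteMulSupport_of_dvd hdiv fun p hp => ?_
    simp [Nat.factorization_eq_zero_of_not_dvd hp]

theorem finprod_inverse_primes {n : ℕ} (hn : n ≠ 0) :
    ∏ᶠ p : Nat.Primes, Ring.inverse (((p : ℕ) ^ n.factorization p : ℕ) : R) =
      Ring.inverse (n : R) := by
  -- In a commutative ring `Ring.inverse` is multiplicative even on non-units, so no invertibility
  -- is needed here.
  let I : R →* R :=
    { toFun := Ring.inverse
      map_one' := Ring.inverse_one R
      map_mul' := fun a b => by rw [Ring.mul_inverse_rev, mul_comm] }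
  have h := finprod_primes_eq R id (fun _ _ _ => rfl) rfl hn
  simp only [id] at h
  conv_rhs => rw [← h]
  refine (I.map_finprod ?_).symm
  refine hasFiniteMulSupport_of_dvd hn fun p hp => ?_
  simp [Nat.factorization_eq_zero_of_not_dvd hp]

end Primes

/-! ### The cocycle `λ` and the cochain `μ` -/

section Coboundary

variable (R : Type w) [CommRing R] {A B C : Type u} [CommGroup A] [CommGroup B] [CommGroup C]
  [Finite A] [Finite B] [Finite C]

theorem factorization_card_le {D : Type*} [Group D] [Finite D] {U V : Subgroup D} (h : U ≤ V)
    (p : ℕ) : (Nat.card U).factorization p ≤ (Nat.card V).factorization p :=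
  (Nat.factorization_le_iff_dvd Nat.card_pos.ne' Nat.card_pos.ne').2
    (Subgroup.card_dvd_of_le h) p

theorem sIndex_pPart_eq_one_iff {p : ℕ} (hp : p.Prime) (L : Subgroup (A × B)) :
    sIndex (pPart p L) = 1 ↔
      (Nat.card (k1 L)).factorization p = (Nat.card (p1 L)).factorization p := by
  rw [sIndex, Subgroup.relIndex_eq_one, ← (Nat.pow_right_injective hp.two_le).eq_iff,
    ← card_pPart hp, ← card_pPart hp, ← k1_pPart, ← p1_pPart hp]
  constructor
  · intro h
    rw [le_antisymm h (k1_le_p1 _)]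
  · intro h
    exact (Subgroup.eq_of_le_of_card_ge (k1_le_p1 _) h.ge).ge

theorem factorization_p1_add_k2 (L : Subgroup (A × B)) (p : ℕ) :
    (Nat.card (p1 L)).factorization p + (Nat.card (k2 L)).factorization p =
      (Nat.card (p2 L)).factorization p + (Nat.card (k1 L)).factorization p := by
  have h := congrArg (fun n => n.factorization p) (card_p1_mul_card_k2_eq L)
  simpa [Nat.factorization_mul Nat.card_pos.ne' Nat.card_pos.ne'] using h

theorem muP_eq {p : ℕ} (hp : p.Prime) (L : Subgroup (A × B)) :
    muP R p L = (primeWeight p ((Nat.card (k1 L)).factorization p)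
      ((Nat.card (p1 L)).factorization p) : R) *
        Ring.inverse ((p ^ (Nat.card B).factorization p : ℕ) : R) := by
  have htop : Nat.card (pPart p (⊤ : Subgroup B)) = p ^ (Nat.card B).factorization p := by
    rw [card_pPart hp, Subgroup.card_top]
  unfold muP primeWeight
  rw [htop, p1_pPart hp, k1_pPart, card_pPart hp, card_pPart hp]
  simp only [sIndex_pPart_eq_one_iff hp]
  split_ifs <;> rfl

theorem lamP_eq [IsCyclic B] {p : ℕ} (hp : p.Prime) {L : Subgroup (A × B)} {M : Subgroup (B × C)}
    (h : p2 L = p1 M) :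
    lamP R p L M = (primeWeight p ((Nat.card (k2 L ⊓ k1 M : Subgroup B)).factorization p)
      ((Nat.card (p1 M)).factorization p) : R) *
        Ring.inverse ((p ^ (Nat.card B).factorization p : ℕ) : R) := by
  have htop : Nat.card (pPart p (⊤ : Subgroup B)) = p ^ (Nat.card B).factorization p := by
    rw [card_pPart hp, Subgroup.card_top]
  -- Because [p₁(L) : k₁(L)] = [p₂(L) : k₂(L)], the condition on L says that k₂(L) has the full
  -- p-part of p₂(L) = p₁(M). Together the two conditions say that k₂(L) ∩ k₁(M) has the full
  -- p-part, so a single pair of exponents decides the case.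
  have hiff : (sIndex (pPart p L) = 1 ∧ sIndex (pPart p M) = 1) ↔
      (Nat.card (k2 L ⊓ k1 M : Subgroup B)).factorization p =
        (Nat.card (p1 M)).factorization p := by
    rw [sIndex_pPart_eq_one_iff hp, sIndex_pPart_eq_one_iff hp, card_inf,
      Nat.factorization_gcd Nat.card_pos.ne' Nat.card_pos.ne', Finsupp.inf_apply]
    have h1 := factorization_p1_add_k2 L p
    have h2 := factorization_card_le (k2_le_p2 L) p
    have h3 := factorization_card_le (k1_le_p1 M) p
    rw [h] at h1 h2
    omega
  unfold lamP primeWeight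
  rw [if_neg (by rw [not_not, p2_pPart hp, p1_pPart hp, h]), htop, k2_pPart, k1_pPart, ← pPart_inf,
    card_pPart hp]
  simp only [hiff]
  split_ifs with h'
  · rw [h']
  · rfl

theorem hasFiniteMulSupport_primeWeight {t q : ℕ} (htq : t ∣ q) (hq : q ≠ 0) :
    (fun p : Nat.Primes =>
      (primeWeight p (t.factorization p) (q.factorization p) : R)).HasFiniteMulSupport :=
  hasFiniteMulSupport_of_dvd hq fun p hp => by
    rw [Nat.factorization_eq_zero_of_not_dvd hp,
      Nat.factorization_eq_zero_of_not_dvd fun h => hp (h.trans htq), primeWeight_zero, Nat.cast_one]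

theorem hasFiniteMulSupport_inverse {n : ℕ} (hn : n ≠ 0) :
    (fun p : Nat.Primes =>
      Ring.inverse (((p : ℕ) ^ n.factorization p : ℕ) : R)).HasFiniteMulSupport :=
  hasFiniteMulSupport_of_dvd hn fun p hp => by
    simp [Nat.factorization_eq_zero_of_not_dvd hp]

theorem card_k2_inf_k1_dvd (L : Subgroup (A × B)) (M : Subgroup (B × C)) :
    Nat.card (k2 L ⊓ k1 M : Subgroup B) ∣ Nat.card (p1 M) :=
  Subgroup.card_dvd_of_le (inf_le_right.trans (k1_le_p1 M))

theorem mu_eq (L : Subgroup (A × B)) :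
    mu R L = ((Nat.totient (fullPart (Nat.card (k1 L)) (Nat.card (p1 L))) *
      (Nat.card (k1 L) / fullPart (Nat.card (k1 L)) (Nat.card (p1 L))) : ℕ) : R) *
        Ring.inverse (Nat.card B : R) := by
  have hd := Subgroup.card_dvd_of_le (k1_le_p1 L)
  have h0 : Nat.card (p1 L) ≠ 0 := Nat.card_pos.ne'
  have h1 : Nat.card B ≠ 0 := Nat.card_pos.ne'
  rw [← finprod_primeWeight R hd h0, ← finprod_inverse_primes R h1, ← finprod_mul_distrib
    (hasFiniteMulSupport_primeWeight R hd h0) (hasFiniteMulSupport_inverse R h1)]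
  exact finprod_congr fun p => muP_eq R p.2 L

theorem lam_eq [IsCyclic B] {L : Subgroup (A × B)} {M : Subgroup (B × C)} (h : p2 L = p1 M) :
    lam R L M = ((Nat.totient (fullPart (Nat.card (k2 L ⊓ k1 M : Subgroup B)) (Nat.card (p1 M))) *
      (Nat.card (k2 L ⊓ k1 M : Subgroup B) /
        fullPart (Nat.card (k2 L ⊓ k1 M : Subgroup B)) (Nat.card (p1 M))) : ℕ) : R) *
          Ring.inverse (Nat.card B : R) := by
  have hd := card_k2_inf_k1_dvd L M
  have h0 : Nat.card (p1 M) ≠ 0 := Nat.card_pos.ne'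
  have h1 : Nat.card B ≠ 0 := Nat.card_pos.ne'
  rw [← finprod_primeWeight R hd h0, ← finprod_inverse_primes R h1, ← finprod_mul_distrib
    (hasFiniteMulSupport_primeWeight R hd h0) (hasFiniteMulSupport_inverse R h1)]
  exact finprod_congr fun p => lamP_eq R p.2 h

theorem isUnit_of_natCast_dvd {R : Type w} [CommRing R] {m n : ℕ} (h : m ∣ n)
    (hn : IsUnit (n : R)) : IsUnit (m : R) :=
  isUnit_of_dvd_unit (Nat.cast_dvd_cast h) hn

/-- Both factors divide units: the full part divides n, hence its totient divides φ(n), and the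
cofactor divides n. -/
theorem isUnit_totient_fullPart {t q n : ℕ} (ht : t ≠ 0) (htn : t ∣ n)
    (h1 : IsUnit (n : R)) (h2 : IsUnit (n.totient : R)) :
    IsUnit ((Nat.totient (fullPart t q) * (t / fullPart t q) : ℕ) : R) := by
  have hd := fullPart_dvd_left (q := q) ht
  rw [Nat.cast_mul]
  exact (isUnit_of_natCast_dvd (Nat.totient_dvd_of_dvd (hd.trans htn)) h2).mul
    (isUnit_of_natCast_dvd ((Nat.div_dvd_of_dvd hd).trans htn) h1)

theorem isUnit_mu (hA : IsUnit (Nat.card A : R)) (hA' : IsUnit (Nat.totient (Nat.card A) : R))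
    (hB : IsUnit (Nat.card B : R)) (L : Subgroup (A × B)) : IsUnit (mu R L) := by
  rw [mu_eq]
  exact (isUnit_totient_fullPart R Nat.card_pos.ne' (k1 L).card_subgroup_dvd_card hA hA').mul
    (isUnit_ringInverse.2 hB)

theorem isUnit_lam [IsCyclic B] (hB : IsUnit (Nat.card B : R))
    (hB' : IsUnit (Nat.totient (Nat.card B) : R)) {L : Subgroup (A × B)} {M : Subgroup (B × C)}
    (h : p2 L = p1 M) : IsUnit (lam R L M) := by
  rw [lam_eq R h]
  exact (isUnit_totient_fullPart R Nat.card_pos.ne'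
    (k2 L ⊓ k1 M : Subgroup B).card_subgroup_dvd_card hB hB').mul (isUnit_ringInverse.2 hB)

/-- On composable pairs, `λ` is the coboundary of `μ`. -/
theorem lam_mul_mu [IsCyclic B] {L : Subgroup (A × B)} {M : Subgroup (B × C)} (h : p2 L = p1 M) :
    lam R L M * mu R (star L M) = mu R L * mu R M := by
  -- Almost all local factors must be 1 before the products over the primes can be merged into one.
  have hfin : ∀ {D E : Type u} [CommGroup D] [CommGroup E] [Finite D] [Finite E]
      (N : Subgroup (D × E)), (fun p : Nat.Primes => muP R p N).HasFiniteMulSupport := by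
    intro D E _ _ _ _ N
    simp only [fun p : Nat.Primes => muP_eq R p.2 N]
    exact (hasFiniteMulSupport_primeWeight R (Subgroup.card_dvd_of_le (k1_le_p1 N))
      Nat.card_pos.ne').mul (hasFiniteMulSupport_inverse R Nat.card_pos.ne')
  have hfin' : (fun p : Nat.Primes => lamP R p L M).HasFiniteMulSupport := by
    simp only [fun p : Nat.Primes => lamP_eq R p.2 h]
    exact (hasFiniteMulSupport_primeWeight R (card_k2_inf_k1_dvd L M)
      Nat.card_pos.ne').mul (hasFiniteMulSupport_inverse R Nat.card_pos.ne')
  unfold lam mu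
  rw [← finprod_mul_distrib hfin' (hfin _), ← finprod_mul_distrib (hfin _) (hfin _)]
  refine finprod_congr fun ⟨p, hp⟩ => ?_
  rw [lamP_eq R hp h, muP_eq R hp, muP_eq R hp, muP_eq R hp, p1_star h]
  have key := primeWeight_mul hp (factorization_card_le (k1_le_p1 L) p)
    (h ▸ factorization_card_le (k2_le_p2 L) p : _ ≤ (Nat.card (p1 M)).factorization p)
    (factorization_card_le (k1_le_p1 M) p) (h ▸ factorization_p1_add_k2 L p)
    (s := (Nat.card (k1 (star L M))).factorization p) (by
      have h1 := congrArg (fun n => n.factorization p) (card_k1_star h)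
      simp only [Nat.factorization_mul Nat.card_pos.ne' Nat.card_pos.ne', Finsupp.add_apply] at h1
      rwa [card_inf, Nat.factorization_gcd Nat.card_pos.ne' Nat.card_pos.ne',
        Finsupp.inf_apply] at h1)
  have ht : (Nat.card (k2 L ⊓ k1 M : Subgroup B)).factorization p =
      min ((Nat.card (k2 L)).factorization p) ((Nat.card (k1 M)).factorization p) := by
    rw [card_inf, Nat.factorization_gcd Nat.card_pos.ne' Nat.card_pos.ne', Finsupp.inf_apply]
  rw [ht]
  have key' := congrArg (Nat.cast : ℕ → R) key
  rw [Nat.cast_mul, Nat.cast_mul] at key'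
  linear_combination Ring.inverse ((p ^ (Nat.card B).factorization p : ℕ) : R) *
    Ring.inverse ((p ^ (Nat.card C).factorization p : ℕ) : R) * key'

end Coboundary

/-! ### A sum over the subgroups of a cyclic group -/

section CyclicSum

variable {A : Type u} [CommGroup A] [Finite A] [IsCyclic A]

open Classical in
theorem card_filter_dvd_orderOf (T : Subgroup A) [Fintype T] (f : ℕ) :
    (Finset.univ.filter fun a : T => f ∣ orderOf (a : A)).card =
      ∑ d ∈ (Nat.card T).divisors with f ∣ d, Nat.totient d := by
  rw [Finset.card_eq_sum_card_fiberwise (f := fun a : T => orderOf (a : A))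
    (t := (Nat.card T).divisors.filter fun d => f ∣ d)]
  · refine Finset.sum_congr rfl fun d hd => ?_
    rw [Finset.mem_filter, Nat.mem_divisors] at hd
    have hT : IsCyclic T := inferInstance
    have := IsCyclic.card_orderOf_eq_totient (α := T) (d := d) (by
      rw [← Nat.card_eq_fintype_card]; exact hd.1.1)
    rw [← this]
    congr 1
    ext a
    simp only [Finset.mem_filter, Finset.mem_univ, true_and, Subgroup.orderOf_coe]
    exact ⟨fun h => h.2, fun h => ⟨h ▸ hd.2, h⟩⟩
  · intro a ha
    simp only [Finset.coe_filter, Finset.mem_univ, true_and, Set.mem_ofPred_eq] at ha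
    simp only [Finset.coe_filter, Nat.mem_divisors, Set.mem_ofPred_eq]
    exact ⟨⟨Subgroup.orderOf_dvd_natCard T a.2, Nat.card_pos.ne'⟩, ha⟩

-- Let f be the full part of |T| in |Q| and S the subgroup of order |Q|/f. Then BT = Q means S ≤ B.
-- Writing |B ∩ T| as the number of a ∈ T lying in B and interchanging the sums, the inner sum runs
-- over the B above ⟨a⟩S and equals 1 if ⟨a⟩S = Q, that is, if f divides the order of a, and 0
-- otherwise. It remains to count the a ∈ T with f dividing their order.
open Classical in
theorem sum_moebius_card_inf (R : Type w) [CommRing R] {T Q : Subgroup A} (hTQ : T ≤ Q) :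
    (∑ B : Subgroup A, if B ≤ Q then (moebius B Q : R) *
      (if B ⊔ T = Q then (Nat.card (B ⊓ T : Subgroup A) : R) else 0) else 0) =
      ((Nat.totient (fullPart (Nat.card T) (Nat.card Q)) *
        (Nat.card T / fullPart (Nat.card T) (Nat.card Q)) : ℕ) : R) := by
  let := Fintype.ofFinite T
  have hq : Nat.card Q ≠ 0 := Nat.card_pos.ne'
  have htq := Subgroup.card_dvd_of_le hTQ
  have hfd := fullPart_dvd_right (t := Nat.card T) hq
  obtain ⟨S, hS⟩ := exists_card_eq (A := A) (Nat.card Q / fullPart (Nat.card T) (Nat.card Q))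
    ((Nat.div_dvd_of_dvd hfd).trans Q.card_subgroup_dvd_card)
  have hB : ∀ B : Subgroup A, B ≤ Q → (B ⊔ T = Q ↔ S ≤ B) := by
    intro B hBQ
    rw [eq_iff_card_eq, card_sup, le_iff_card_dvd, hS]
    exact lcm_eq_iff_div_fullPart_dvd htq (Subgroup.card_dvd_of_le hBQ) hq
  have hx : ∀ a : T, Subgroup.zpowers (a : A) ⊔ S = Q ↔
      fullPart (Nat.card T) (Nat.card Q) ∣ orderOf (a : A) := by
    intro a
    rw [eq_iff_card_eq, card_sup, hS, Nat.card_zpowers]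
    exact lcm_div_fullPart_eq_iff (Subgroup.orderOf_dvd_natCard Q (hTQ a.2)) hq
  have hcard : ∀ B : Subgroup A, (Nat.card (B ⊓ T : Subgroup A) : R) =
      ∑ a : T, if (a : A) ∈ B then (1 : R) else 0 := by
    intro B
    rw [Finset.sum_boole, ← Fintype.card_subtype, ← Nat.card_eq_fintype_card]
    refine congrArg Nat.cast (Nat.card_congr ?_)
    exact
      { toFun := fun b => ⟨⟨b.1, b.2.2⟩, b.2.1⟩
        invFun := fun b => ⟨b.1.1, b.2, b.1.2⟩
        left_inv := fun _ => rfl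
        right_inv := fun _ => rfl }
  calc _ = ∑ B : Subgroup A, ∑ a : T, (if B ≤ Q then
        (if Subgroup.zpowers (a : A) ⊔ S ≤ B then (moebius B Q : R) else 0) else 0) := by
        refine Finset.sum_congr rfl fun B _ => ?_
        by_cases hBQ : B ≤ Q
        · simp only [if_pos hBQ, hB B hBQ, hcard, sup_le_iff, Subgroup.zpowers_le]
          by_cases hSB : S ≤ B
          · simp only [hSB, and_true, if_true, Finset.mul_sum, mul_ite, mul_one, mul_zero]
          · simp [hSB]
        · simp [hBQ]
    _ = ∑ a : T, if fullPart (Nat.card T) (Nat.card Q) ∣ orderOf (a : A) then (1 : R) else 0 := by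
        rw [Finset.sum_comm]
        refine Finset.sum_congr rfl fun a _ => ?_
        rw [sum_moebius_right_cast]
        simp only [hx]
    _ = _ := by
        rw [Finset.sum_boole, card_filter_dvd_orderOf, sum_totient_fullPart htq hq]

end CyclicSum

/-! ### The product of the elements `L̃` -/

section MoebiusWeight

variable (R : Type w) [CommRing R] {X : Type*}

open Classical in
/-- The Möbius function with values in `R`, extended by zero. -/
noncomputable def mw [PartialOrder X] [Fintype X] (a b : X) : R :=
  if a ≤ b then (moebius a b : R) else 0

open Classical in
theorem sum_mw [PartialOrder X] [Fintype X] (a b : X) :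
    (∑ y : X, mw R y b * if a ≤ y then 1 else 0) = if a = b then 1 else 0 := by
  rw [← sum_moebius_right_cast R a b]
  refine Finset.sum_congr rfl fun y _ => ?_
  simp only [mw, mul_ite, mul_one, mul_zero]
  split_ifs <;> rfl

-- Write F(z) as the sum of f(x) over x ≤ z. Since x ≤ y ⊓ z means x ≤ y and x ≤ z, the double sum
-- factors for each x and leaves f(x) only when x = a and x = b. This is why products of L̃ and M̃
-- with p₂(L) ≠ p₁(M) vanish.
open Classical in
theorem sum_mw_inf [SemilatticeInf X] [Fintype X] (F : X → R) (a b : X) :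
    ∑ y : X, ∑ z : X, mw R y a * mw R z b * F (y ⊓ z) =
      if a = b then ∑ y : X, mw R y a * F y else 0 := by
  let f : X → R := fun z => ∑ y : X, if y ≤ z then (moebius y z : R) * F y else 0
  have hF : ∀ z, F z = ∑ y : X, f y * if y ≤ z then 1 else 0 := by
    intro z
    rw [← moebius_inversion F z]
    refine Finset.sum_congr rfl fun y _ => ?_
    simp [f]
  have hf : ∀ a, ∑ y : X, mw R y a * F y = f a := by
    intro a
    refine Finset.sum_congr rfl fun y _ => ?_
    simp [mw]
  rw [hf]
  calc _ = ∑ x : X, f x * ((∑ y : X, mw R y a * if x ≤ y then 1 else 0) *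
        ∑ z : X, mw R z b * if x ≤ z then 1 else 0) := by
        simp only [hF, Finset.mul_sum, Finset.sum_mul]
        refine (Finset.sum_congr rfl fun y _ => Finset.sum_comm).trans (Finset.sum_comm.trans ?_)
        refine Finset.sum_congr rfl fun x _ => Finset.sum_comm.trans ?_
        refine Finset.sum_congr rfl fun z _ => Finset.sum_congr rfl fun y _ => ?_
        by_cases h1 : x ≤ y <;> by_cases h2 : x ≤ z <;> simp [h1, h2]
        ring
    _ = _ := by
        simp only [sum_mw]
        by_cases h : a = b
        · subst h; simp
        · rw [if_neg h]
          refine Finset.sum_eq_zero fun x _ => ?_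
          by_cases h1 : x = a
          · subst h1; simp [h]
          · simp [h1]

end MoebiusWeight

section HatProduct

variable (R : Type w) [CommRing R] {A B C : Type u} [CommGroup A] [CommGroup B] [CommGroup C]
  [Finite A] [Finite B] [Finite C]

open Classical in
theorem zetaMap_single_apply {X : Type u} [Group X] [Finite X] (U N : Subgroup X) :
    zetaMap R X (Finsupp.single U 1) N = if N ≤ U then 1 else 0 := by
  rw [zetaMap_single, Finsupp.finsetSum_apply, Finset.sum_eq_single N]
  · split_ifs <;> simp
  · intro b _ hb
    split_ifs <;> simp [hb]
  · simp

open Classical in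
theorem hat_apply (L N : Subgroup (A × B)) : hat R L N = if N ∈ fullSub L then 1 else 0 := by
  rw [hat, Finsupp.finsetSum_apply, Finset.sum_eq_single N]
  · split_ifs <;> simp
  · intro b _ hb
    split_ifs <;> simp [hb]
  · simp

/-- The preimage of `L̃` under `ζ`. -/
noncomputable def hatPre (L : Subgroup (A × B)) : RS R (A × B) :=
  ∑ U : Subgroup A, ∑ V : Subgroup B,
    (mw R U (p1 L) * mw R V (p2 L)) • Finsupp.single (L ⊓ U.prod V) 1

theorem le_prod_iff {N : Subgroup (A × B)} {U : Subgroup A} {V : Subgroup B} :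
    N ≤ U.prod V ↔ p1 N ≤ U ∧ p2 N ≤ V := by
  rw [Subgroup.le_prod_iff]; rfl

/-- N lies in L ∩ (U × V) exactly if N ≤ L, p₁(N) ≤ U and p₂(N) ≤ V. The sums over U and V thus
separate, and each Möbius sum forces equality of the respective projections. -/
theorem zetaMap_hatPre (L : Subgroup (A × B)) : zetaMap R (A × B) (hatPre R L) = hat R L := by
  classical
  ext N
  simp only [hatPre, map_sum, map_smul, Finsupp.finsetSum_apply, Finsupp.smul_apply,
    zetaMap_single_apply, hat_apply, smul_eq_mul]
  calc _ = (if N ≤ L then 1 else 0) * ((∑ U : Subgroup A, mw R U (p1 L) * if p1 N ≤ U then 1 else 0) *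
        ∑ V : Subgroup B, mw R V (p2 L) * if p2 N ≤ V then 1 else 0) := by
        rw [Finset.sum_mul_sum, Finset.mul_sum]
        refine Finset.sum_congr rfl fun U _ => ?_
        rw [Finset.mul_sum]
        refine Finset.sum_congr rfl fun V _ => ?_
        rw [le_inf_iff, le_prod_iff]
        by_cases h1 : N ≤ L <;> by_cases h2 : p1 N ≤ U <;> by_cases h3 : p2 N ≤ V <;>
          simp [h1, h2, h3]
    _ = _ := by
        rw [sum_mw, sum_mw]
        simp only [fullSub, Set.mem_ofPred_eq]
        by_cases h1 : N ≤ L <;> by_cases h2 : p1 N = p1 L <;> by_cases h3 : p2 N = p2 L <;>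
          simp [h1, h2, h3]

theorem kappa_inf_prod (L : Subgroup (A × B)) (M : Subgroup (B × C)) (U : Subgroup A)
    (V V' : Subgroup B) (W : Subgroup C) :
    kappa R (L ⊓ U.prod V) (M ⊓ V'.prod W) =
      (Nat.card ((V ⊓ V') ⊓ (k2 L ⊓ k1 M) : Subgroup B) : R) * Ring.inverse (Nat.card B : R) := by
  have : k2 (L ⊓ U.prod V) ⊓ k1 (M ⊓ V'.prod W) = (V ⊓ V') ⊓ (k2 L ⊓ k1 M) := by
    ext b
    simp only [Subgroup.mem_inf, mem_k2, mem_k1, Subgroup.mem_prod, one_mem]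
    tauto
  rw [kappa, this]

/-- As in `kappa_inf_prod`, only V ∩ V' matters in the middle, and the conditions on U and W split
off. This is the form in which `sum_mw_inf` applies. -/
theorem le_star_inf_prod_iff (L : Subgroup (A × B)) (M : Subgroup (B × C)) (U : Subgroup A)
    (V V' : Subgroup B) (W : Subgroup C) (N : Subgroup (A × C)) :
    N ≤ star (L ⊓ U.prod V) (M ⊓ V'.prod W) ↔
      p1 N ≤ U ∧ p2 N ≤ W ∧ N ≤ star (L ⊓ (⊤ : Subgroup A).prod (V ⊓ V')) M := by
  constructor
  · intro h
    refine ⟨fun a ha => ?_, fun c hc => ?_, ?_⟩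
    · obtain ⟨c, hc⟩ := mem_p1.1 ha
      obtain ⟨b, h1, _⟩ := h hc
      exact h1.2.1
    · obtain ⟨a, ha⟩ := mem_p2.1 hc
      obtain ⟨b, _, h1⟩ := h ha
      exact h1.2.2
    · rintro ⟨a, c⟩ hN
      obtain ⟨b, h1, h2⟩ := h hN
      exact ⟨b, ⟨h1.1, trivial, h1.2.2, h2.2.1⟩, h2.1⟩
  · rintro ⟨h1, h2, h3⟩ ⟨a, c⟩ hN
    obtain ⟨b, ⟨h4, _, h5, h6⟩, h7⟩ := h3 hN
    exact ⟨b, ⟨h4, h1 (mem_p1.2 ⟨c, hN⟩), h5⟩, h7, h6, h2 (mem_p2.2 ⟨a, hN⟩)⟩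

/-- If every element of N passes through V, then, as N has full projections, each b ∈ p₁(M) can be
corrected to an element of V modulo k₂(L), and also modulo k₁(M); distributivity gives a correction
modulo the intersection. Conversely, a factor of the middle element lying in both kernels can be
dropped. -/
theorem le_star_inf_iff [IsCyclic B] {L : Subgroup (A × B)} {M : Subgroup (B × C)}
    (h : p2 L = p1 M) {N : Subgroup (A × C)} (h1 : p1 N = p1 L) (h2 : p2 N = p2 M)
    {V : Subgroup B} (hV : V ≤ p1 M) :
    N ≤ star (L ⊓ (⊤ : Subgroup A).prod V) M ↔ V ⊔ (k2 L ⊓ k1 M) = p1 M ∧ N ≤ star L M := by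
  constructor
  · intro hN
    -- The two goals are V k₂(L) = p₁(M) and V k₁(M) = p₁(M).
    refine ⟨sup_inf_eq_of_sup_eq ?_ ?_, fun p hp => ?_⟩
    · refine le_antisymm (sup_le hV (h ▸ k2_le_p2 L)) fun b hb => ?_
      obtain ⟨a, ha⟩ := mem_p2.1 (h ▸ hb : b ∈ p2 L)
      obtain ⟨c, hc⟩ := mem_p1.1 (h1 ▸ mem_p1.2 ⟨b, ha⟩ : a ∈ p1 N)
      obtain ⟨b', ⟨h3, _, h4⟩, _⟩ := hN hc
      refine Subgroup.mem_sup.2 ⟨b', h4, b'⁻¹ * b, ?_, mul_inv_cancel_left _ _⟩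
      have := L.mul_mem (L.inv_mem h3) ha
      rw [mem_k2]
      simpa using this
    · refine le_antisymm (sup_le hV (k1_le_p1 M)) fun b hb => ?_
      obtain ⟨c, hc⟩ := mem_p1.1 hb
      obtain ⟨a, ha⟩ := mem_p2.1 (h2 ▸ mem_p2.2 ⟨b, hc⟩ : c ∈ p2 N)
      obtain ⟨b', ⟨_, _, h4⟩, h3⟩ := hN ha
      refine Subgroup.mem_sup.2 ⟨b', h4, b'⁻¹ * b, ?_, mul_inv_cancel_left _ _⟩
      have := M.mul_mem (M.inv_mem h3) hc
      rw [mem_k1]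
      simpa using this
    · obtain ⟨b, h3, h4⟩ := hN hp
      exact ⟨b, h3.1, h4⟩
  · rintro ⟨h3, hN⟩ ⟨a, c⟩ hp
    obtain ⟨b, h4, h5⟩ := hN hp
    obtain ⟨v, hv, t, ht, rfl⟩ := Subgroup.mem_sup.1
      (h3 ▸ mem_p1.2 ⟨c, h5⟩ : b ∈ V ⊔ (k2 L ⊓ k1 M))
    refine ⟨v, ⟨?_, trivial, hv⟩, ?_⟩
    · have := L.mul_mem h4 (L.inv_mem ht.1)
      simpa using this
    · have := M.mul_mem h5 (M.inv_mem ht.2)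
      simpa using this

theorem mem_fullSub_star {L : Subgroup (A × B)} {M : Subgroup (B × C)} (h : p2 L = p1 M)
    {N : Subgroup (A × C)} :
    N ∈ fullSub (star L M) ↔ p1 N = p1 L ∧ p2 N = p2 M ∧ N ≤ star L M := by
  simp only [fullSub, Set.mem_ofPred_eq, p1_star h, p2_star h]
  tauto

theorem sum_mul_sum_mul_sum_sum {I J K N S : Type*} [Fintype I] [Fintype J] [Fintype K] [Fintype N]
    [CommRing S] (a : I → S) (b : J → S) (c : K → N → S) :
    (∑ i, a i) * (∑ j, b j) * ∑ k, ∑ n, c k n =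
      ∑ n, ∑ j, ∑ i, ∑ k, a i * b j * c k n := by
  rw [Finset.sum_comm (f := c)]
  simp only [← Finset.mul_sum, ← Finset.sum_mul]

-- Of the four Möbius sums in the product of the two preimages, the outer ones force N to have the
-- outer projections of L and M, and the two middle ones collapse by `sum_mw_inf`. No cyclicity is
-- involved yet.
open Classical in
theorem tildeMul_hat_apply (L : Subgroup (A × B)) (M : Subgroup (B × C)) (N : Subgroup (A × C)) :
    tildeMul R A B C (hat R L) (hat R M) N =
      (if p1 N = p1 L ∧ p2 N = p2 M then 1 else 0) * if p2 L = p1 M then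
        ∑ V : Subgroup B, mw R V (p2 L) *
          ((Nat.card (V ⊓ (k2 L ⊓ k1 M) : Subgroup B) : R) * Ring.inverse (Nat.card B : R) *
            if N ≤ star (L ⊓ (⊤ : Subgroup A).prod V) M then 1 else 0) else 0 := by
  rw [← zetaMap_hatPre, ← zetaMap_hatPre, tildeMul_zeta]
  rw [← sum_mw_inf R (fun V => (Nat.card (V ⊓ (k2 L ⊓ k1 M) : Subgroup B) : R) *
    Ring.inverse (Nat.card B : R) * if N ≤ star (L ⊓ (⊤ : Subgroup A).prod V) M then 1 else 0)]
  have hsingle : ∀ (S : Subgroup (A × C)) (r : R), zetaMap R (A × C) (Finsupp.single S r) N =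
      r * if N ≤ S then 1 else 0 := by
    intro S r
    rw [show (Finsupp.single S r : RS R (A × C)) = r • Finsupp.single S 1 by simp, map_smul,
      Finsupp.smul_apply, zetaMap_single_apply, smul_eq_mul]
  have h1 : (if p1 N = p1 L ∧ p2 N = p2 M then (1 : R) else 0) =
      (∑ U : Subgroup A, mw R U (p1 L) * if p1 N ≤ U then 1 else 0) *
        ∑ W : Subgroup C, mw R W (p2 M) * if p2 N ≤ W then 1 else 0 := by
    rw [sum_mw, sum_mw]
    by_cases h2 : p1 N = p1 L <;> by_cases h3 : p2 N = p2 M <;> simp [h2, h3]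
  rw [h1]
  simp only [hatPre, map_sum, map_smul, LinearMap.sum_apply, LinearMap.smul_apply, kappaMul_single,
    Finsupp.finsetSum_apply, Finsupp.smul_apply, hsingle, smul_eq_mul, kappa_inf_prod,
    le_star_inf_prod_iff]
  rw [sum_mul_sum_mul_sum_sum]
  refine Finset.sum_congr rfl fun V' _ => Finset.sum_congr rfl fun W _ => ?_
  simp only [Finset.mul_sum]
  refine Finset.sum_congr rfl fun U _ => Finset.sum_congr rfl fun V _ => ?_
  by_cases h2 : p1 N ≤ U <;> by_cases h3 : p2 N ≤ W <;>
    by_cases h4 : N ≤ star (L ⊓ (⊤ : Subgroup A).prod (V ⊓ V')) M <;> simp [h2, h3, h4]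
  ring

theorem tildeMul_hat_of_ne {L : Subgroup (A × B)} {M : Subgroup (B × C)} (h : p2 L ≠ p1 M) :
    tildeMul R A B C (hat R L) (hat R M) = 0 := by
  classical
  ext N
  rw [tildeMul_hat_apply, if_neg h, mul_zero]
  rfl

theorem tildeMul_hat [IsCyclic B] {L : Subgroup (A × B)} {M : Subgroup (B × C)}
    (h : p2 L = p1 M) :
    tildeMul R A B C (hat R L) (hat R M) = lam R L M • hat R (star L M) := by
  classical
  ext N
  rw [tildeMul_hat_apply, if_pos h, Finsupp.smul_apply, hat_apply, smul_eq_mul]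
  by_cases hN : p1 N = p1 L ∧ p2 N = p2 M
  -- Expanding λ back into the Möbius sum for T = k₂(L) ∩ k₁(M) and Q = p₁(M) reduces the claim to a
  -- comparison of summands for each V.
  · rw [if_pos hN, one_mul, lam_eq R h, ← sum_moebius_card_inf R
      (inf_le_right.trans (k1_le_p1 M) : k2 L ⊓ k1 M ≤ p1 M), h, Finset.sum_mul, Finset.sum_mul]
    refine Finset.sum_congr rfl fun V _ => ?_
    by_cases hV : V ≤ p1 M
    · rw [le_star_inf_iff h hN.1 hN.2 hV]
      by_cases h3 : V ⊔ (k2 L ⊓ k1 M) = p1 M <;> by_cases h4 : N ≤ star L M <;>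
        simp [mw, hV, h3, h4, mem_fullSub_star h, hN.1, hN.2, mul_assoc]
    · simp [mw, hV]
  · rw [if_neg hN, zero_mul, if_neg, mul_zero]
    rw [mem_fullSub_star h]
    tauto

end HatProduct

open CategoryTheory

/-! ### Linear maps on twisted category algebras -/

namespace TwistedAlg

variable {R : Type w} [CommRing R] {C : Type x} [Category.{u} C] (α : TwoCocycle R C)

/-- The linear map with given values on the basis of morphisms. -/
noncomputable def lin {V : Type*} [AddCommGroup V] [Module R V] (f : Mor C → V) :
    TwistedAlg α →ₗ[R] V :=
  (Finsupp.linearCombination R f : (Mor C →₀ R) →ₗ[R] V)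

theorem lin_basis {V : Type*} [AddCommGroup V] [Module R V] (f : Mor C → V) (s : Mor C) :
    lin α f (basis α s) = f s :=
  (Finsupp.linearCombination_single R (1 : R) s).trans (one_smul R _)

variable {α}

theorem linearMap_ext {V : Type*} [AddCommGroup V] [Module R V] {f g : TwistedAlg α →ₗ[R] V}
    (h : ∀ s, f (basis α s) = g (basis α s)) : f = g := by
  ext a
  induction a using induction_basis with
  | h0 => simp
  | hadd a b ha hb => rw [map_add, map_add, ha, hb]
  | hb r s => rw [map_smul, map_smul, h]

theorem basis_mul_basis [Finite C] (t s : Mor C) : basis α t * basis α s = basisMul α t s :=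
  mulLin_basis α t s

theorem map_mul_of_basis [Finite C] {V : Type*} [Ring V] [Algebra R V] (f : TwistedAlg α →ₗ[R] V)
    (h : ∀ t s, f (basisMul α t s) = f (basis α t) * f (basis α s)) (a b : TwistedAlg α) :
    f (a * b) = f a * f b := by
  have : (mulLin α).compr₂ f = (LinearMap.mul R V).compl₁₂ f f := by
    refine linearMap_ext fun t => linearMap_ext fun s => ?_
    simp only [LinearMap.compr₂_apply, LinearMap.compl₁₂_apply, mulLin_basis, LinearMap.mul_apply',
      h]
  exact DFunLike.congr_fun (DFunLike.congr_fun this a) b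

end TwistedAlg

/-! ### Products of elements of the summands -/

section Of

variable {R : Type w} [CommRing R] {ι : Type v} [Fintype ι] [DecidableEq ι]
  {A : LinCat.{v, w, x} R ι}

theorem LinCat.of_apply_self (i j : ι) (a : A.Hom i j) : (LinCat.of i j a : A.Alg) i j = a := by
  simp [LinCat.of]

theorem LinCat.of_apply_of_ne {i j i' j' : ι} (a : A.Hom i j) (h : ¬ (i' = i ∧ j' = j)) :
    (LinCat.of i j a : A.Alg) i' j' = 0 := by
  by_cases h1 : i' = i
  · subst h1
    have h2 : j' ≠ j := fun h2 => h ⟨rfl, h2⟩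
    simp [LinCat.of, h2]
  · simp [LinCat.of, h1]

theorem LinCat.of_mul_of (i j k : ι) (a : A.Hom i j) (b : A.Hom j k) :
    (LinCat.of i j a : A.Alg) * LinCat.of j k b = LinCat.of i k (A.comp i j k a b) := by
  ext i' k'
  rw [LinCat.mul_apply]
  by_cases h : i' = i ∧ k' = k
  · obtain ⟨rfl, rfl⟩ := h
    rw [LinCat.of_apply_self, Finset.sum_eq_single j]
    · rw [LinCat.of_apply_self, LinCat.of_apply_self]
    · intro j' _ hj
      rw [LinCat.of_apply_of_ne a (fun h => hj h.2), map_zero, LinearMap.zero_apply]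
    · intro h; exact absurd (Finset.mem_univ _) h
  · rw [LinCat.of_apply_of_ne _ h]
    refine Finset.sum_eq_zero fun j' _ => ?_
    by_cases h1 : i' = i
    · rw [LinCat.of_apply_of_ne b fun h2 => h ⟨h1, h2.2⟩, map_zero]
    · rw [LinCat.of_apply_of_ne a fun h2 => h1 h2.1, map_zero, LinearMap.zero_apply]

theorem LinCat.of_mul_of_ne {i j j' k : ι} (hj : j ≠ j') (a : A.Hom i j) (b : A.Hom j' k) :
    (LinCat.of i j a : A.Alg) * LinCat.of j' k b = 0 := by
  ext i' k'
  rw [LinCat.mul_apply, LinCat.zero_apply]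
  refine Finset.sum_eq_zero fun l _ => ?_
  by_cases h1 : l = j
  · rw [LinCat.of_apply_of_ne b fun h2 => hj (h1.symm.trans h2.1), map_zero]
  · rw [LinCat.of_apply_of_ne a fun h2 => h1 h2.2, map_zero, LinearMap.zero_apply]

theorem LinCat.of_zero (i j : ι) : (LinCat.of i j 0 : A.Alg) = 0 := by
  ext i' j'
  by_cases h : i' = i ∧ j' = j
  · obtain ⟨rfl, rfl⟩ := h
    rw [LinCat.of_apply_self, LinCat.zero_apply]
  · rw [LinCat.of_apply_of_ne _ h, LinCat.zero_apply]

theorem LinCat.of_smul (i j : ι) (r : R) (a : A.Hom i j) :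
    (LinCat.of i j (r • a) : A.Alg) = r • LinCat.of i j a := by
  ext i' j'
  rw [LinCat.smul_apply]
  by_cases h : i' = i ∧ j' = j
  · obtain ⟨rfl, rfl⟩ := h
    rw [LinCat.of_apply_self, LinCat.of_apply_self]
  · rw [LinCat.of_apply_of_ne _ h, LinCat.of_apply_of_ne _ h, smul_zero]

end Of

/-! ### The order on the morphisms -/

section MorOrder

variable {ι : Type v} {G : ι → Type u} [∀ i, Group (G i)]

/-- The projections of the subgroup determine the objects, so morphisms are the same thing as
subgroups of the products `G i × G j`. -/
theorem eq_toMor (s : Mor (SubCat G)) : s = toMor s.hom.1 := by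
  obtain ⟨⟨j, V⟩, ⟨i, U⟩, L, hL⟩ := s
  change Subgroup (G i × G j) at L
  change L ∈ fullSub (U.prod V) at hL
  obtain ⟨rfl, rfl⟩ := mem_fullSub_prod.1 hL
  rfl

theorem exists_eq_toMor (s : Mor (SubCat G)) :
    ∃ (i j : ι) (L : Subgroup (G i × G j)), s = toMor L := ⟨_, _, _, eq_toMor s⟩

theorem toMor_injective {i j : ι} :
    Function.Injective (toMor : Subgroup (G i × G j) → Mor (SubCat G)) := by
  intro L L' h
  have := congrArg (fun s : Mor (SubCat G) =>
    (⟨(s.cod.idx, s.dom.idx), s.hom.1⟩ : Σ x : ι × ι, Subgroup (G x.1 × G x.2))) h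
  exact eq_of_heq (Sigma.mk.inj this).2

/-- An idempotent subgroup contains the diagonal of its projection. -/
theorem diag_le_of_star_self {A : Type u} [Group A] {E : Subgroup (A × A)} (h : star E E = E)
    (hp : p1 E = p2 E) : diag (p2 E) ≤ E := by
  have hst : ∀ {a b c : A}, (a, b) ∈ E → (b, c) ∈ E → (a, c) ∈ E := fun {a b c} h1 h2 =>
    h ▸ (⟨b, h1, h2⟩ : (a, c) ∈ star E E)
  rintro ⟨b, b'⟩ ⟨hb, rfl : b = b'⟩
  -- With (c, d) ∈ E, transitivity gives (1, d) ∈ E, and (c, d)(1, d)⁻¹ = (c, 1).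
  have k21 : ∀ c : A, (1, c) ∈ E → (c, 1) ∈ E := by
    intro c hc
    obtain ⟨d, hd⟩ := mem_p1.1 (hp ▸ mem_p2.2 ⟨1, hc⟩ : c ∈ p1 E)
    have h1 := hst hc hd
    have := E.mul_mem hd (E.inv_mem h1)
    simpa using this
  -- For (y, a), (a, b) ∈ E also (y, b) ∈ E, so (1, b⁻¹a) ∈ E and then (b⁻¹a, 1) ∈ E. Dividing (a,
  -- b) by the latter leaves (b, b).
  obtain ⟨a, ha⟩ := mem_p2.1 hb
  obtain ⟨y, hy⟩ := mem_p2.1 (hp ▸ mem_p1.2 ⟨b, ha⟩ : a ∈ p2 E)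
  have h1 := E.mul_mem (E.inv_mem (hst hy ha)) (E.mul_mem hy (E.inv_mem E.one_mem))
  have h2 : ((1 : A), b⁻¹ * a) ∈ E := by simpa using h1
  have h3 := E.mul_mem ha (E.inv_mem (k21 _ h2))
  have h4 : ((a * (a⁻¹ * b) : A), b) ∈ E := by simpa using h3
  rwa [mul_inv_cancel_left] at h4

/-- For `L ∈ 𝒫(L')` we have `L' = L * E` where `E` is an idempotent. -/
theorem exists_idempotent_star_eq {A B : Type u} [Group A] [Group B] {L L' : Subgroup (A × B)}
    (h : L ∈ fullSub L') : ∃ E ∈ fullSub ((p2 L).prod (p2 L)), star E E = E ∧ star L E = L' := by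
  obtain ⟨hle, h1, h2⟩ := h
  -- p₂(L) normalizes k₂(L'), which replaces commutativity in the construction of `E`.
  have hk : ∀ {b : B}, b ∈ p2 L → ∀ c, (1, c) ∈ L' → (1, b⁻¹ * c * b) ∈ L' := by
    intro b hb c hc
    obtain ⟨a, ha⟩ := mem_p2.1 hb
    have := L'.mul_mem (L'.mul_mem (L'.inv_mem (hle ha)) hc) (hle ha)
    simpa using this
  -- The relation on p₂(L) of lying in the same coset of k₂(L'). An equivalence relation is
  -- idempotent under composition.
  let E : Subgroup (B × B) :=
    { carrier := {p | p.1 ∈ p2 L ∧ (1, p.1⁻¹ * p.2) ∈ L'}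
      one_mem' := ⟨one_mem _, by
        change (1, (1 : B)⁻¹ * 1) ∈ L'
        rw [inv_one, mul_one]; exact L'.one_mem⟩
      mul_mem' := by
        rintro ⟨a, b⟩ ⟨a', b'⟩ ⟨ha, hb⟩ ⟨ha', hb'⟩
        refine ⟨mul_mem ha ha', ?_⟩
        have := L'.mul_mem (hk ha' _ hb) hb'
        rw [Prod.mk_mul_mk, one_mul] at this
        convert this using 2
        simp [mul_assoc]
      inv_mem' := by
        rintro ⟨a, b⟩ ⟨ha, hb⟩
        refine ⟨inv_mem ha, ?_⟩
        have := L'.inv_mem (hk (inv_mem ha) _ hb)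
        simpa [mul_assoc] using this }
  have hE : ∀ a b : B, (a, b) ∈ E ↔ a ∈ p2 L ∧ (1, a⁻¹ * b) ∈ L' := fun _ _ => Iff.rfl
  have hE2 : ∀ a b : B, (a, b) ∈ E → b ∈ p2 L := by
    intro a b hab
    rw [hE] at hab
    have h3 : a⁻¹ * b ∈ p2 L := h2 ▸ mem_p2.2 ⟨1, hab.2⟩
    simpa using mul_mem hab.1 h3
  have hrefl : ∀ b ∈ p2 L, (b, b) ∈ E := fun b hb => by
    rw [hE, inv_mul_cancel]; exact ⟨hb, L'.one_mem⟩
  refine ⟨E, mem_fullSub_prod.2 ⟨?_, ?_⟩, ?_, ?_⟩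
  · ext b; rw [mem_p1]
    exact ⟨fun ⟨c, hc⟩ => hc.1, fun hb => ⟨b, hrefl b hb⟩⟩
  · ext b; rw [mem_p2]
    exact ⟨fun ⟨c, hc⟩ => hE2 c b hc, fun hb => ⟨b, hrefl b hb⟩⟩
  · ext ⟨a, c⟩
    rw [mem_star]
    constructor
    · rintro ⟨b, h3, h4⟩
      rw [hE] at h3 h4 ⊢
      refine ⟨h3.1, ?_⟩
      have := L'.mul_mem h3.2 h4.2
      simpa [mul_assoc] using this
    · intro h3
      exact ⟨a, hrefl a h3.1, h3⟩
  · ext ⟨a, c⟩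
    rw [mem_star]
    constructor
    · rintro ⟨b, h3, h4⟩
      have := L'.mul_mem (hle h3) h4.2
      simpa using this
    · intro h3
      obtain ⟨b, hb⟩ := mem_p1.1 (h1.symm ▸ mem_p1.2 ⟨c, h3⟩ : a ∈ p1 L)
      refine ⟨b, hb, mem_p2.2 ⟨a, hb⟩, ?_⟩
      have := L'.mul_mem (L'.inv_mem (hle hb)) h3
      simpa using this

/-- The order is reverse inclusion among subgroups with equal projections. Composing with an
idempotent enlarges L, because the idempotent contains a diagonal, and `exists_idempotent_star_eq`
shows that every enlargement arises in this way. -/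
theorem mor_le_toMor_iff {i j : ι} {L : Subgroup (G i × G j)} {s : Mor (SubCat G)} :
    s.Le (toMor L) ↔ ∃ L', L ∈ fullSub L' ∧ s = toMor L' := by
  constructor
  · rintro ⟨⟨E, hE⟩, hid, rfl⟩
    have hE' := mem_fullSub_prod.1 hE
    have hid' : star E E = E := congrArg Subtype.val hid
    have hcat := star_mem (mem_fullSub_prod.2 ⟨rfl, rfl⟩ : L ∈ fullSub ((p1 L).prod (p2 L))) hE
    have hcat' := mem_fullSub_prod.1 hcat
    refine ⟨star L E, ⟨?_, hcat'.1.symm, hcat'.2.symm⟩, eq_toMor _⟩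
    rintro ⟨a, b⟩ hab
    refine ⟨b, hab, diag_le_of_star_self hid' (hE'.1.trans hE'.2.symm) ⟨?_, rfl⟩⟩
    rw [hE'.2]
    exact mem_p2.2 ⟨a, hab⟩
  · rintro ⟨L', hL, rfl⟩
    obtain ⟨E, hE, hid, rfl⟩ := exists_idempotent_star_eq hL
    refine ⟨⟨E, hE⟩, Subtype.ext hid, ?_⟩
    exact (eq_toMor ⟨⟨j, p2 L⟩, ⟨i, p1 L⟩,
      ⟨star L E, star_mem (mem_fullSub_prod.2 ⟨rfl, rfl⟩) hE⟩⟩).symm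

theorem toMor_le_toMor_iff {i j : ι} {L L' : Subgroup (G i × G j)} :
    (toMor L').Le (toMor L) ↔ L ∈ fullSub L' := by
  rw [mor_le_toMor_iff]
  exact ⟨fun ⟨N, h, e⟩ => toMor_injective e ▸ h, fun h => ⟨L', h, rfl⟩⟩

instance : PartialOrder (Mor (SubCat G)) where
  le := Mor.Le
  le_refl s := by
    obtain ⟨i, j, L, rfl⟩ := exists_eq_toMor s
    exact toMor_le_toMor_iff.2 ⟨le_rfl, rfl, rfl⟩
  le_trans s t r h1 h2 := by
    obtain ⟨i, j, L, rfl⟩ := exists_eq_toMor r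
    obtain ⟨L', hL', rfl⟩ := mor_le_toMor_iff.1 h2
    obtain ⟨L'', hL'', rfl⟩ := mor_le_toMor_iff.1 h1
    exact toMor_le_toMor_iff.2 ⟨hL'.1.trans hL''.1, hL'.2.1.trans hL''.2.1, hL'.2.2.trans hL''.2.2⟩
  le_antisymm s t h1 h2 := by
    obtain ⟨i, j, L, rfl⟩ := exists_eq_toMor t
    obtain ⟨L', hL', rfl⟩ := mor_le_toMor_iff.1 h1
    rw [le_antisymm hL'.1 (toMor_le_toMor_iff.1 h2).1]

theorem mor_le_def {s t : Mor (SubCat G)} : s ≤ t ↔ s.Le t := Iff.rfl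

instance [Finite ι] [∀ i, Finite (G i)] : Finite (Mor (SubCat G)) :=
  Finite.of_surjective (α := Σ x : ι × ι, Subgroup (G x.1 × G x.2)) (fun x => toMor x.2) fun s =>
    ⟨⟨(s.cod.idx, s.dom.idx), s.hom.1⟩, (eq_toMor s).symm⟩

noncomputable instance [Finite ι] [∀ i, Finite (G i)] : Fintype (Mor (SubCat G)) :=
  Fintype.ofFinite _

end MorOrder

/-! ### The cocycle λ and the isomorphisms ε and δ -/

section DeltaEpsilon

variable {ι : Type v} (G : ι → Type u) [∀ i, CommGroup (G i)] [∀ i, Finite (G i)]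
  (R : Type w) [CommRing R]

section Lam

variable [∀ i, IsCyclic (G i)] (hG : ∀ i, IsUnit (Nat.card (G i) : R))
    (hφ : ∀ i, IsUnit (Nat.totient (Nat.card (G i)) : R))

variable {G} in
theorem p2_eq_p1_of_comp {X Y Z : SubCat G} (L : Y ⟶ Z) (M : X ⟶ Y) : p2 L.1 = p1 M.1 :=
  (mem_fullSub_prod.1 L.2).2.trans (mem_fullSub_prod.1 M.2).1.symm

/-- The `2`-cocycle `λ`. -/
noncomputable def lamCocycle : TwoCocycle R (SubCat G) where
  toFun {_ Y _} L M := (isUnit_lam R (hG Y.idx) (hφ Y.idx) (p2_eq_p1_of_comp L M)).unit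
  cocycle {W X Y Z} s t r := by
    ext
    simp only [Units.val_mul, IsUnit.unit_spec]
    have e1 := lam_mul_mu R (p2_eq_p1_of_comp (t ≫ r) s)
    have e2 := lam_mul_mu R (p2_eq_p1_of_comp r t)
    have e3 := lam_mul_mu R (p2_eq_p1_of_comp r (s ≫ t))
    have e4 := lam_mul_mu R (p2_eq_p1_of_comp t s)
    have e5 : star (t ≫ r).1 s.1 = star r.1 (s ≫ t).1 := star_assoc r.1 t.1 s.1
    change lam R r.1 t.1 * mu R (t ≫ r).1 = _ at e2
    change lam R t.1 s.1 * mu R (s ≫ t).1 = _ at e4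
    rw [e5] at e1
    -- Multiplied by this unit, both sides of the cocycle identity become μ(r) μ(t) μ(s).
    have hu : IsUnit (mu R (star r.1 (s ≫ t).1)) :=
      isUnit_mu R (hG Z.idx) (hφ Z.idx) (hG W.idx) _
    refine hu.mul_right_cancel ?_
    linear_combination lam R r.1 t.1 * e1 + mu R s.1 * e2 - lam R t.1 s.1 * e3 - mu R r.1 * e4

theorem lamCocycle_apply {X Y Z : SubCat G} (L : Y ⟶ Z) (M : X ⟶ Y) :
    ((lamCocycle G R hG hφ).toFun L M : R) = lam R L.1 M.1 := rfl

/-- As λ is the coboundary of the unit-valued cochain μ, multiplying each basis element by its value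
of μ turns the twisted product into the untwisted one. -/
theorem exists_epsilon [Finite ι] :
    ∃ ε : TwistedAlg (lamCocycle G R hG hφ) ≃ₐ[R] CatAlg R (SubCat G),
      ∀ s : Mor (SubCat G), ε (TwistedAlg.basis _ s) = mu R s.hom.1 • TwistedAlg.basis _ s := by
  have hu : ∀ s : Mor (SubCat G), IsUnit (mu R s.hom.1) := fun s =>
    isUnit_mu R (hG s.cod.idx) (hφ s.cod.idx) (hG s.dom.idx) _
  let f : TwistedAlg (lamCocycle G R hG hφ) →ₗ[R] CatAlg R (SubCat G) :=
    TwistedAlg.lin _ fun s => mu R s.hom.1 • TwistedAlg.basis _ s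
  let g : CatAlg R (SubCat G) →ₗ[R] TwistedAlg (lamCocycle G R hG hφ) :=
    TwistedAlg.lin _ fun s => Ring.inverse (mu R s.hom.1) • TwistedAlg.basis _ s
  have hf : ∀ s, f (TwistedAlg.basis _ s) = mu R s.hom.1 • TwistedAlg.basis _ s :=
    TwistedAlg.lin_basis _ _
  have hg : ∀ s, g (TwistedAlg.basis _ s) = Ring.inverse (mu R s.hom.1) • TwistedAlg.basis _ s :=
    TwistedAlg.lin_basis _ _
  have h1 : g ∘ₗ f = LinearMap.id := TwistedAlg.linearMap_ext fun s => by
    rw [LinearMap.comp_apply, hf, map_smul, hg, smul_smul, Ring.mul_inverse_cancel _ (hu s),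
      one_smul, LinearMap.id_apply]
  have h2 : f ∘ₗ g = LinearMap.id := TwistedAlg.linearMap_ext fun s => by
    rw [LinearMap.comp_apply, hg, map_smul, hf, smul_smul, Ring.inverse_mul_cancel _ (hu s),
      one_smul, LinearMap.id_apply]
  obtain ⟨e, he⟩ := exists_algEquiv_of_bijective f
    ⟨Function.LeftInverse.injective (g := g) fun a => LinearMap.congr_fun h1 a,
      Function.RightInverse.surjective (g := g) fun a => LinearMap.congr_fun h2 a⟩
    (TwistedAlg.map_mul_of_basis f (by
      rintro ⟨Y, Z, L⟩ ⟨X, Y', M⟩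
      rw [hf, hf, smul_mul_smul_comm, TwistedAlg.basis_mul_basis]
      by_cases h : Y' = Y
      · subst h
        rw [TwistedAlg.basisMul_comp, TwistedAlg.basisMul_comp, map_smul, hf, smul_smul, smul_smul,
          lamCocycle_apply]
        congr 1
        have := lam_mul_mu R (p2_eq_p1_of_comp L M)
        refine this.trans ?_
        simp [TwoCocycle.trivial]
      · rw [TwistedAlg.basisMul_zero _ h, TwistedAlg.basisMul_zero _ h, map_zero, smul_zero]))
  exact ⟨e, fun s => (he _).trans (hf s)⟩

/-- The inverse D, sending the morphism L to L̃, is constructed first. Its coefficient at L' is 1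
exactly if L' ∈ 𝒫(L), that is, if L ≤ L' as morphisms, so D is the zeta transform of the poset of
morphisms. Multiplicativity is `tildeMul_hat`. -/
theorem exists_delta [Fintype ι] [DecidableEq ι] :
    ∃ δ : ATilde R G hG ≃ₐ[R] TwistedAlg (lamCocycle G R hG hφ),
      ∀ (i j : ι) (L : Subgroup (G i × G j)),
        δ (LinCat.of i j (hat R L)) = TwistedAlg.basis _ (toMor L) := by
  classical
  let D : TwistedAlg (lamCocycle G R hG hφ) →ₗ[R] ATilde R G hG :=
    TwistedAlg.lin _ fun s => LinCat.of s.cod.idx s.dom.idx (hat R s.hom.1)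
  have hD : ∀ s, D (TwistedAlg.basis _ s) = LinCat.of s.cod.idx s.dom.idx (hat R s.hom.1) :=
    TwistedAlg.lin_basis _ _
  let E : ATilde R G hG →ₗ[R] (Mor (SubCat G) → R) :=
    { toFun := fun a s => (show RS R (G s.cod.idx × G s.dom.idx) from a s.cod.idx s.dom.idx) s.hom.1
      map_add' := fun _ _ => rfl
      map_smul' := fun _ _ => rfl }
  have hE : Function.Injective E := by
    intro a b h
    refine LinCat.ext fun i j => Finsupp.ext fun L => ?_
    exact congrFun h (toMor L)
  have hED : E ∘ₗ D = zetaTransform R (Mor (SubCat G)) := TwistedAlg.linearMap_ext fun s => by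
    ext t
    refine Eq.trans ?_ (zetaTransform_single s t).symm
    rw [LinearMap.comp_apply, hD]
    obtain ⟨i, j, L, rfl⟩ := exists_eq_toMor s
    obtain ⟨i', j', L', rfl⟩ := exists_eq_toMor t
    change (show RS R (G i' × G j') from
      (LinCat.of i j (hat R L) : ATilde R G hG) i' j') L' = _
    by_cases h : i' = i ∧ j' = j
    · obtain ⟨rfl, rfl⟩ := h
      have := LinCat.of_apply_self (A := subgroupCat R G hG) i' j' (hat R L)
      refine (congrArg (fun a : RS R (G i' × G j') => a L') this).trans ?_
      refine (hat_apply R L L').trans ?_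
      simp only [mor_le_def, toMor_le_toMor_iff]
    · have := LinCat.of_apply_of_ne (A := subgroupCat R G hG) (hat R L) h
      refine (congrArg (fun a : RS R (G i' × G j') => a L') this).trans ?_
      rw [if_neg]
      · rfl
      · intro hle
        obtain ⟨N, _, hN⟩ := mor_le_toMor_iff.1 hle
        exact h ⟨congrArg (fun s : Mor (SubCat G) => s.cod.idx) hN.symm,
          congrArg (fun s : Mor (SubCat G) => s.dom.idx) hN.symm⟩
  have hbij : Function.Bijective (E ∘ D) := by
    have := zetaTransform_bijective R (Mor (SubCat G))
    rw [← hED] at this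
    exact this
  have hDbij : Function.Bijective D := by
    refine ⟨hbij.1.of_comp, fun a => ?_⟩
    obtain ⟨c, hc⟩ := hbij.2 (E a)
    exact ⟨c, hE hc⟩
  obtain ⟨e, he⟩ := exists_algEquiv_of_bijective D hDbij
    (TwistedAlg.map_mul_of_basis D (by
      rintro ⟨Y, Z, L⟩ ⟨X, Y', M⟩
      rw [hD, hD]
      by_cases h : Y' = Y
      · subst h
        rw [TwistedAlg.basisMul_comp, map_smul, hD, lamCocycle_apply]
        refine (LinCat.of_smul _ _ _ _).symm.trans ?_
        refine Eq.trans ?_ (LinCat.of_mul_of (A := subgroupCat R G hG) Z.idx Y'.idx X.idx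
          (hat R L.1) (hat R M.1)).symm
        exact congrArg (LinCat.of (A := subgroupCat R G hG) Z.idx X.idx)
          (tildeMul_hat R (p2_eq_p1_of_comp L M)).symm
      · rw [TwistedAlg.basisMul_zero _ h, map_zero]
        obtain ⟨i, U⟩ := Y
        obtain ⟨i', U'⟩ := Y'
        -- Distinct middle objects either have different groups, and then the components do not
        -- match, or have different subgroups of one group, and then the Möbius sums vanish.
        by_cases hi : i = i'
        · subst hi
          symm
          refine (LinCat.of_mul_of (A := subgroupCat R G hG) Z.idx i X.idx
            (hat R L.1) (hat R M.1)).trans ?_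
          refine (congrArg (LinCat.of (A := subgroupCat R G hG) Z.idx X.idx)
            (tildeMul_hat_of_ne R ?_)).trans (LinCat.of_zero _ _)
          intro h'
          refine h ?_
          rw [(mem_fullSub_prod.1 L.2).2, (mem_fullSub_prod.1 M.2).1] at h'
          exact congrArg (SubCat.mk i) h'.symm
        · exact (LinCat.of_mul_of_ne (A := subgroupCat R G hG) hi _ _).symm))
  refine ⟨e.symm, fun i j L => ?_⟩
  rw [AlgEquiv.symm_apply_eq, he, hD]
  rfl

end Lam

end DeltaEpsilon

/-! ### Goursat's lemma for sections -/

section Goursat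

theorem Sec.ext' {A : Type u} [Group A] {σ τ : Sec A} (h1 : σ.P = τ.P) (h2 : σ.K = τ.K) :
    σ = τ := by
  obtain ⟨P, K, h3, h4⟩ := σ
  obtain ⟨P', K', h5, h6⟩ := τ
  subst h1; subst h2; rfl

section

variable {A B C : Type u} [Group A] [Group B] [Group C]

theorem mem_quintuple {σ : Sec A} {τ : Sec B} {η : τ.Quot ≃* σ.Quot} {p : A × B} :
    p ∈ quintuple σ τ η ↔ ∃ (ha : p.1 ∈ σ.P) (hb : p.2 ∈ τ.P),
      η (QuotientGroup.mk ⟨p.2, hb⟩) = QuotientGroup.mk ⟨p.1, ha⟩ := Iff.rfl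

theorem p1_quintuple (σ : Sec A) (τ : Sec B) (η : τ.Quot ≃* σ.Quot) :
    p1 (quintuple σ τ η) = σ.P := (mem_fullSub_prod.1 (quintuple_mem σ τ η)).1

theorem p2_quintuple (σ : Sec A) (τ : Sec B) (η : τ.Quot ≃* σ.Quot) :
    p2 (quintuple σ τ η) = τ.P := (mem_fullSub_prod.1 (quintuple_mem σ τ η)).2

theorem Sec.mk_eq_one_iff (σ : Sec A) {a : A} (ha : a ∈ σ.P) :
    (QuotientGroup.mk ⟨a, ha⟩ : σ.Quot) = 1 ↔ a ∈ σ.K := by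
  rw [QuotientGroup.eq_one_iff, Subgroup.mem_subgroupOf]

theorem k1_quintuple (σ : Sec A) (τ : Sec B) (η : τ.Quot ≃* σ.Quot) :
    k1 (quintuple σ τ η) = σ.K := by
  ext a
  rw [mem_k1, mem_quintuple]
  constructor
  · rintro ⟨ha, hb, h⟩
    rw [(τ.mk_eq_one_iff hb).2 τ.K.one_mem, map_one, eq_comm, σ.mk_eq_one_iff] at h
    exact h
  · intro ha
    refine ⟨σ.le ha, τ.P.one_mem, ?_⟩
    rw [(τ.mk_eq_one_iff τ.P.one_mem).2 τ.K.one_mem, map_one, eq_comm, σ.mk_eq_one_iff]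
    exact ha

theorem k2_quintuple (σ : Sec A) (τ : Sec B) (η : τ.Quot ≃* σ.Quot) :
    k2 (quintuple σ τ η) = τ.K := by
  ext b
  rw [mem_k2, mem_quintuple]
  constructor
  · rintro ⟨ha, hb, h⟩
    rw [(σ.mk_eq_one_iff ha).2 σ.K.one_mem, map_eq_one_iff η η.injective, τ.mk_eq_one_iff] at h
    exact h
  · intro hb
    refine ⟨σ.P.one_mem, τ.le hb, ?_⟩
    rw [(σ.mk_eq_one_iff σ.P.one_mem).2 σ.K.one_mem, map_eq_one_iff η η.injective, τ.mk_eq_one_iff]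
    exact hb

theorem quintuple_injective {σ : Sec A} {τ : Sec B} {η η' : τ.Quot ≃* σ.Quot}
    (h : quintuple σ τ η = quintuple σ τ η') : η = η' := by
  ext x
  obtain ⟨⟨b, hb⟩, rfl⟩ := QuotientGroup.mk_surjective x
  obtain ⟨⟨a, ha⟩, hab⟩ := QuotientGroup.mk_surjective (η (QuotientGroup.mk ⟨b, hb⟩))
  have h1 : (a, b) ∈ quintuple σ τ η' := h ▸ mem_quintuple.2 ⟨ha, hb, hab.symm⟩
  obtain ⟨_, _, h2⟩ := mem_quintuple.1 h1
  exact hab.symm.trans h2.symm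

/-- When the middle sections agree, the composition is that of isomorphisms; this yields the
groupoid behind ω. -/
theorem star_quintuple (σ : Sec A) (τ : Sec B) (ρ : Sec C) (η : τ.Quot ≃* σ.Quot)
    (η' : ρ.Quot ≃* τ.Quot) :
    star (quintuple σ τ η) (quintuple τ ρ η') = quintuple σ ρ (η'.trans η) := by
  ext ⟨a, c⟩
  rw [mem_star]
  constructor
  · rintro ⟨b, ⟨ha, hb, h1⟩, ⟨_, hc, h2⟩⟩
    refine mem_quintuple.2 ⟨ha, hc, ?_⟩
    rw [MulEquiv.trans_apply, h2]
    exact h1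
  · rintro ⟨ha, hc, h⟩
    obtain ⟨⟨b, hb⟩, h1⟩ := QuotientGroup.mk_surjective (η' (QuotientGroup.mk ⟨c, hc⟩))
    rw [MulEquiv.trans_apply, ← h1] at h
    exact ⟨b, mem_quintuple.2 ⟨ha, hb, h⟩, mem_quintuple.2 ⟨hb, hc, h1.symm⟩⟩

end

variable {A B C : Type u} [CommGroup A] [CommGroup B] [CommGroup C]

/-- The section `(p₁(L), k₁(L))`. -/
def sec1 (L : Subgroup (A × B)) : Sec A := ⟨p1 L, k1 L, k1_le_p1 L, inferInstance⟩

/-- The section `(p₂(L), k₂(L))`. -/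
def sec2 (L : Subgroup (A × B)) : Sec B := ⟨p2 L, k2 L, k2_le_p2 L, inferInstance⟩

theorem sec1_quintuple (σ : Sec A) (τ : Sec B) (η : τ.Quot ≃* σ.Quot) :
    sec1 (quintuple σ τ η) = σ :=
  Sec.ext' (p1_quintuple σ τ η) (k1_quintuple σ τ η)

theorem sec2_quintuple (σ : Sec A) (τ : Sec B) (η : τ.Quot ≃* σ.Quot) :
    sec2 (quintuple σ τ η) = τ :=
  Sec.ext' (p2_quintuple σ τ η) (k2_quintuple σ τ η)

/-- Goursat's lemma: the maps from L onto p₁(L)/k₁(L) and onto p₂(L)/k₂(L) have the same kernel, so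
the two quotients are identified. -/
theorem exists_eq_quintuple (L : Subgroup (A × B)) :
    ∃ η : (sec2 L).Quot ≃* (sec1 L).Quot, L = quintuple (sec1 L) (sec2 L) η := by
  let f1 : L →* (sec1 L).Quot := (QuotientGroup.mk' _).comp
    (((MonoidHom.fst A B).comp L.subtype).codRestrict (sec1 L).P
      fun l => mem_p1.2 ⟨l.1.2, l.2⟩)
  let f2 : L →* (sec2 L).Quot := (QuotientGroup.mk' _).comp
    (((MonoidHom.snd A B).comp L.subtype).codRestrict (sec2 L).P
      fun l => mem_p2.2 ⟨l.1.1, l.2⟩)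
  have e1 : ∀ (l : L) (h : l.1.1 ∈ (sec1 L).P),
      f1 l = QuotientGroup.mk ⟨l.1.1, h⟩ := fun _ _ => rfl
  have e2 : ∀ (l : L) (h : l.1.2 ∈ (sec2 L).P),
      f2 l = QuotientGroup.mk ⟨l.1.2, h⟩ := fun _ _ => rfl
  have s1 : Function.Surjective f1 := by
    intro x
    obtain ⟨⟨a, ha⟩, rfl⟩ := QuotientGroup.mk_surjective x
    obtain ⟨b, hb⟩ := mem_p1.1 ha
    exact ⟨⟨(a, b), hb⟩, rfl⟩
  have s2 : Function.Surjective f2 := by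
    intro x
    obtain ⟨⟨b, hb⟩, rfl⟩ := QuotientGroup.mk_surjective x
    obtain ⟨a, ha⟩ := mem_p2.1 hb
    exact ⟨⟨(a, b), ha⟩, rfl⟩
  have hker : f2.ker = f1.ker := by
    ext ⟨⟨a, b⟩, hab⟩
    have ha : a ∈ (sec1 L).P := mem_p1.2 ⟨b, hab⟩
    have hb : b ∈ (sec2 L).P := mem_p2.2 ⟨a, hab⟩
    rw [MonoidHom.mem_ker, MonoidHom.mem_ker, e1 _ ha, e2 _ hb]
    refine ((sec2 L).mk_eq_one_iff hb).trans (Iff.trans ?_ ((sec1 L).mk_eq_one_iff ha).symm)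
    change (1, b) ∈ L ↔ (a, 1) ∈ L
    constructor
    · intro h
      simpa using L.mul_mem hab (L.inv_mem h)
    · intro h
      simpa using L.mul_mem hab (L.inv_mem h)
  let η : (sec2 L).Quot ≃* (sec1 L).Quot :=
    ((QuotientGroup.quotientKerEquivOfSurjective f2 s2).symm.trans
      (QuotientGroup.quotientMulEquivOfEq hker)).trans
        (QuotientGroup.quotientKerEquivOfSurjective f1 s1)
  have hη : ∀ l : L, η (f2 l) = f1 l := by
    intro l
    have : (QuotientGroup.quotientKerEquivOfSurjective f2 s2).symm (f2 l) =
        QuotientGroup.mk l := by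
      rw [MulEquiv.symm_apply_eq]; rfl
    simp only [η, MulEquiv.trans_apply, this]
    rfl
  refine ⟨η, ?_⟩
  ext ⟨a, b⟩
  rw [mem_quintuple]
  constructor
  · intro hab
    exact ⟨mem_p1.2 ⟨b, hab⟩, mem_p2.2 ⟨a, hab⟩, hη ⟨(a, b), hab⟩⟩
  · rintro ⟨ha, hb, h⟩
    obtain ⟨a', ha'⟩ := mem_p2.1 hb
    have h1 := (hη ⟨(a', b), ha'⟩).symm.trans h
    have hA' : a' ∈ (sec1 L).P := mem_p1.2 ⟨b, ha'⟩
    rw [e1 _ hA', QuotientGroup.eq, Subgroup.mem_subgroupOf] at h1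
    have h2 : (a'⁻¹ * a, 1) ∈ L := h1
    simpa using L.mul_mem ha' h2

/-- The factorization of a subgroup containing `L * M` into subgroups containing `L` and `M`. -/
theorem exists_factorization {L : Subgroup (A × B)} {M : Subgroup (B × C)} (h : p2 L = p1 M)
    {N : Subgroup (A × C)} (hN : star L M ∈ fullSub N) :
    ∃ (T : Subgroup (A × B)) (S : Subgroup (B × C)), L ∈ fullSub T ∧ M ∈ fullSub S ∧
      sec1 T = sec1 N ∧ sec2 T = sec1 S ∧ sec2 S = sec2 N ∧ star T S = N := by
  obtain ⟨hle, hN1, hN2⟩ := hN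
  rw [p1_star h] at hN1
  rw [p2_star h] at hN2
  have hcomp : ∀ {a b c}, (a, b) ∈ L → (b, c) ∈ M → (a, c) ∈ N := fun h1 h2 => hle ⟨_, h1, h2⟩
  -- T must contain L and k₁(N) × 1, and S must contain M and 1 × k₂(N). Nothing more is needed: the
  -- middle sections of T and S then agree automatically.
  let T : Subgroup (A × B) := L ⊔ (k1 N).prod ⊥
  let S : Subgroup (B × C) := M ⊔ Subgroup.prod ⊥ (k2 N)
  have hT : ∀ a b, (a, b) ∈ T ↔ ∃ a', (a', b) ∈ L ∧ (a'⁻¹ * a, 1) ∈ N := by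
    intro a b
    rw [Subgroup.mem_sup]
    constructor
    · rintro ⟨⟨a', b'⟩, h1, ⟨a'', b''⟩, ⟨h2, h3⟩, h4⟩
      obtain rfl : b'' = 1 := h3
      simp only [Prod.mk_mul_mk, mul_one, Prod.mk.injEq] at h4
      obtain ⟨rfl, rfl⟩ := h4
      exact ⟨a', h1, by rw [inv_mul_cancel_left]; exact h2⟩
    · rintro ⟨a', h1, h2⟩
      exact ⟨(a', b), h1, (a'⁻¹ * a, 1), ⟨h2, rfl⟩, by simp⟩
  have hS : ∀ b c, (b, c) ∈ S ↔ ∃ c', (b, c') ∈ M ∧ (1, c'⁻¹ * c) ∈ N := by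
    intro b c
    rw [Subgroup.mem_sup]
    constructor
    · rintro ⟨⟨b', c'⟩, h1, ⟨b'', c''⟩, ⟨h2, h3⟩, h4⟩
      obtain rfl : b'' = 1 := h2
      simp only [Prod.mk_mul_mk, mul_one, Prod.mk.injEq] at h4
      obtain ⟨rfl, rfl⟩ := h4
      exact ⟨c', h1, by rw [inv_mul_cancel_left]; exact h3⟩
    · rintro ⟨c', h1, h2⟩
      exact ⟨(b, c'), h1, (1, c'⁻¹ * c), ⟨rfl, h2⟩, by simp⟩
  have hLT : L ≤ T := le_sup_left
  have hMS : M ≤ S := le_sup_left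
  have p1T : p1 T = p1 L := by
    refine le_antisymm (fun a ha => ?_) (Subgroup.map_mono hLT)
    obtain ⟨b, hb⟩ := mem_p1.1 ha
    obtain ⟨a', h1, h2⟩ := (hT a b).1 hb
    have h3 : a'⁻¹ * a ∈ p1 L := hN1 ▸ mem_p1.2 ⟨1, h2⟩
    simpa using mul_mem (mem_p1.2 ⟨b, h1⟩) h3
  have p2T : p2 T = p2 L := by
    refine le_antisymm (fun b hb => ?_) (Subgroup.map_mono hLT)
    obtain ⟨a, ha⟩ := mem_p2.1 hb
    obtain ⟨a', h1, h2⟩ := (hT a b).1 ha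
    exact mem_p2.2 ⟨a', h1⟩
  have p1S : p1 S = p1 M := by
    refine le_antisymm (fun b hb => ?_) (Subgroup.map_mono hMS)
    obtain ⟨c, hc⟩ := mem_p1.1 hb
    obtain ⟨c', h1, h2⟩ := (hS b c).1 hc
    exact mem_p1.2 ⟨c', h1⟩
  have p2S : p2 S = p2 M := by
    refine le_antisymm (fun c hc => ?_) (Subgroup.map_mono hMS)
    obtain ⟨b, hb⟩ := mem_p2.1 hc
    obtain ⟨c', h1, h2⟩ := (hS b c).1 hb
    have h3 : c'⁻¹ * c ∈ p2 M := hN2 ▸ mem_p2.2 ⟨1, h2⟩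
    simpa using mul_mem (mem_p2.2 ⟨b, h1⟩) h3
  refine ⟨T, S, ⟨hLT, p1T.symm, p2T.symm⟩, ⟨hMS, p1S.symm, p2S.symm⟩, Sec.ext' (p1T.trans hN1) ?_,
    Sec.ext' (p2T.trans (h.trans p1S.symm)) ?_, Sec.ext' (p2S.trans hN2) ?_, ?_⟩
  · ext a
    change (a, 1) ∈ T ↔ (a, 1) ∈ N
    rw [hT]
    constructor
    · rintro ⟨a', h1, h2⟩
      simpa using N.mul_mem (hcomp h1 M.one_mem) h2
    · intro ha
      exact ⟨1, L.one_mem, by simpa using ha⟩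
  -- An element (a, b) ∈ L with a ∈ k₁(N) and a partner (b, c) ∈ M give (a, c) ∈ N, hence c ∈ k₂(N);
  -- and conversely.
  · ext b
    change (1, b) ∈ T ↔ (b, 1) ∈ S
    rw [hT, hS]
    constructor
    · rintro ⟨a, h1, h2⟩
      obtain ⟨c, hc⟩ := mem_p1.1 (h ▸ mem_p2.2 ⟨a, h1⟩ : b ∈ p1 M)
      refine ⟨c, hc, ?_⟩
      simpa using N.inv_mem (N.mul_mem (hcomp h1 hc) h2)
    · rintro ⟨c, h1, h2⟩
      obtain ⟨a, ha⟩ := mem_p2.1 (h ▸ mem_p1.2 ⟨c, h1⟩ : b ∈ p2 L)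
      refine ⟨a, ha, ?_⟩
      simpa using N.inv_mem (N.mul_mem (hcomp ha h1) h2)
  · ext c
    change (1, c) ∈ S ↔ (1, c) ∈ N
    rw [hS]
    constructor
    · rintro ⟨c', h1, h2⟩
      simpa using N.mul_mem (hcomp L.one_mem h1) h2
    · intro hc
      exact ⟨1, M.one_mem, by simpa using hc⟩
  · ext ⟨a, c⟩
    rw [mem_star]
    constructor
    · rintro ⟨b, h1, h2⟩
      obtain ⟨a', h3, h4⟩ := (hT a b).1 h1
      obtain ⟨c', h5, h6⟩ := (hS b c).1 h2
      simpa using N.mul_mem (N.mul_mem (hcomp h3 h5) h4) h6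
    · intro hac
      obtain ⟨b, hb⟩ := mem_p1.1 (hN1 ▸ mem_p1.2 ⟨c, hac⟩ : a ∈ p1 L)
      obtain ⟨c', hc'⟩ := mem_p1.1 (h ▸ mem_p2.2 ⟨a, hb⟩ : b ∈ p1 M)
      refine ⟨b, hLT hb, (hS b c).2 ⟨c', hc', ?_⟩⟩
      simpa using N.mul_mem (N.inv_mem (hcomp hb hc')) hac

/-- Since p₂(L) = p₂(T), the group T is generated by L and k₁(T) × 1. Hence an element above a given
morphism is determined by its kernel on one side. -/
theorem eq_of_mem_fullSub {L T T' : Subgroup (A × B)} (h : L ∈ fullSub T) (h' : L ∈ fullSub T')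
    (hk : k1 T = k1 T') : T = T' := by
  have key : ∀ {T T' : Subgroup (A × B)}, L ∈ fullSub T → L ∈ fullSub T' → k1 T = k1 T' →
      T ≤ T' := by
    rintro T T' h h' hk ⟨a, b⟩ hab
    obtain ⟨a', ha'⟩ := mem_p2.1 (h.2.2 ▸ mem_p2.2 ⟨a, hab⟩ : b ∈ p2 L)
    have h1 : a * a'⁻¹ ∈ k1 T' := hk ▸ (by
      rw [mem_k1]
      simpa using T.mul_mem hab (T.inv_mem (h.1 ha')))
    simpa using T'.mul_mem h1 (h'.1 ha')
  exact le_antisymm (key h h' hk) (key h' h hk.symm)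

end Goursat

/-! ### The isomorphism `ω` -/

section Units

variable {ι : Type v} {G : ι → Type u} [∀ i, CommGroup (G i)]

/-- The section attached to the codomain of a morphism. -/
def leftSec (s : Mor (SubCat G)) : Σ i, Sec (G i) := ⟨s.cod.idx, sec1 s.hom.1⟩

/-- The section attached to the domain of a morphism. -/
def rightSec (s : Mor (SubCat G)) : Σ i, Sec (G i) := ⟨s.dom.idx, sec2 s.hom.1⟩

section

variable {k : ℕ} (θ : ∀ σ : SecOf G k, Cyc k ≃* σ.1.2.Quot) (σ τ ρ : SecOf G k)
  (a b : MulAut (Cyc k))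

theorem leftSec_unitMor : leftSec (unitMor θ σ τ a) = σ.1 :=
  Sigma.ext rfl (heq_of_eq (sec1_quintuple σ.1.2 τ.1.2 _))

theorem rightSec_unitMor : rightSec (unitMor θ σ τ a) = τ.1 :=
  Sigma.ext rfl (heq_of_eq (sec2_quintuple σ.1.2 τ.1.2 _))

theorem unitMor_eq_toMor : unitMor θ σ τ a =
    toMor (quintuple σ.1.2 τ.1.2 (((θ τ).symm.trans a).trans (θ σ))) :=
  eq_toMor _

theorem unitMor_comp :
    (⟨_, _, (unitMor θ τ ρ b).hom ≫ (unitMor θ σ τ a).hom⟩ : Mor (SubCat G)) =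
      unitMor θ σ ρ (a * b) := by
  refine congrArg (Mor.mk (⟨ρ.1.1, ρ.1.2.P⟩ : SubCat G) ⟨σ.1.1, σ.1.2.P⟩) (Subtype.ext ?_)
  refine (star_quintuple σ.1.2 τ.1.2 ρ.1.2 _ _).trans (congrArg _ ?_)
  ext x
  simp

variable {θ σ τ ρ a b}

theorem unitMor_injective {σ' τ' : SecOf G k} {a' : MulAut (Cyc k)}
    (h : unitMor θ σ τ a = unitMor θ σ' τ' a') : σ = σ' ∧ τ = τ' ∧ a = a' := by
  have h1 := congrArg leftSec h
  have h2 := congrArg rightSec h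
  rw [leftSec_unitMor, leftSec_unitMor] at h1
  rw [rightSec_unitMor, rightSec_unitMor] at h2
  obtain rfl := Subtype.ext h1
  obtain rfl := Subtype.ext h2
  refine ⟨rfl, rfl, ?_⟩
  rw [unitMor_eq_toMor, unitMor_eq_toMor] at h
  have h3 := quintuple_injective (toMor_injective h)
  ext x
  have h4 := DFunLike.congr_fun h3 (θ τ x)
  simpa using h4

end

theorem SecOf.card_quot {k : ℕ} (σ : SecOf G k) : Nat.card σ.1.2.Quot = k := by
  obtain ⟨e⟩ := σ.2
  rw [← Nat.card_congr e.toEquiv]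
  exact Nat.card_zmod k

variable [∀ i, Finite (G i)] [∀ i, IsCyclic (G i)]

theorem Sec.nonempty_cyc_equiv {A : Type u} [CommGroup A] [Finite A] [IsCyclic A] (σ : Sec A) :
    Nonempty (Cyc (Nat.card σ.Quot) ≃* σ.Quot) :=
  ⟨zmodCyclicMulEquiv inferInstance⟩

/-- Sections of cyclic groups are cyclic, so the isomorphism of Goursat's lemma becomes an
automorphism of some C_k once transported along θ. Together with `unitMor_injective` this
parametrizes the morphisms by the matrix positions and group elements of the target of ω. -/
theorem exists_eq_unitMor (θ : ∀ (k : Divs G) (σ : SecOf G k.1), Cyc k.1 ≃* σ.1.2.Quot)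
    (s : Mor (SubCat G)) : ∃ (k : Divs G) (σ τ : SecOf G k.1) (a : MulAut (Cyc k.1)),
      leftSec s = σ.1 ∧ rightSec s = τ.1 ∧ s = unitMor (θ k) σ τ a := by
  obtain ⟨i, j, L, rfl⟩ := exists_eq_toMor s
  obtain ⟨η, hη⟩ := exists_eq_quintuple L
  obtain ⟨e⟩ := (sec1 L).nonempty_cyc_equiv
  let k : Divs G := ⟨Nat.card (sec1 L).Quot, i,
    (Subgroup.card_quotient_dvd_card _).trans (Subgroup.card_subgroup_dvd_card _)⟩
  let σ : SecOf G k.1 := ⟨⟨i, sec1 L⟩, ⟨e⟩⟩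
  let τ : SecOf G k.1 := ⟨⟨j, sec2 L⟩, ⟨e.trans η.symm⟩⟩
  refine ⟨k, σ, τ, ((θ k τ).trans η).trans (θ k σ).symm, rfl, rfl, ?_⟩
  rw [unitMor_eq_toMor]
  have : ((θ k τ).symm.trans (((θ k τ).trans η).trans (θ k σ).symm)).trans (θ k σ) = η := by
    ext x
    simp
  refine (congrArg toMor hη).trans ?_
  exact congrArg (fun ξ => toMor (quintuple (sec1 L) (sec2 L) ξ)) this.symm

theorem mk_le_mk_iff {X Y : SubCat G} {M M' : X ⟶ Y} :
    Mor.Le (⟨X, Y, M'⟩ : Mor (SubCat G)) ⟨X, Y, M⟩ ↔ M.1 ≤ M'.1 := by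
  rw [eq_toMor ⟨X, Y, M⟩, eq_toMor ⟨X, Y, M'⟩]
  refine toMor_le_toMor_iff.trans ⟨fun h => h.1, fun hle => ⟨hle, ?_, ?_⟩⟩
  · exact (mem_fullSub_prod.1 M.2).1.trans (mem_fullSub_prod.1 M'.2).1.symm
  · exact (mem_fullSub_prod.1 M.2).2.trans (mem_fullSub_prod.1 M'.2).2.symm

theorem le_mk_iff {X Y : SubCat G} {M : X ⟶ Y} {s : Mor (SubCat G)} :
    s.Le ⟨X, Y, M⟩ ↔ ∃ M' : X ⟶ Y, M.1 ≤ M'.1 ∧ s = ⟨X, Y, M'⟩ := by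
  constructor
  · rintro ⟨e, he, rfl⟩
    exact ⟨e ≫ M, mk_le_mk_iff.1 ⟨e, he, rfl⟩, rfl⟩
  · rintro ⟨M', hle, rfl⟩
    exact mk_le_mk_iff.2 hle

variable {k : ℕ} {θ : ∀ σ : SecOf G k, Cyc k ≃* σ.1.2.Quot}

theorem unitMor_mul_eq {X Y Z : SubCat G} {L : Y ⟶ Z} {M : X ⟶ Y} {σ τ ρ : SecOf G k}
    {a b : MulAut (Cyc k)} (h1 : unitMor θ σ τ a = ⟨Y, Z, L⟩)
    (h2 : unitMor θ τ ρ b = ⟨X, Y, M⟩) : unitMor θ σ ρ (a * b) = ⟨X, Z, M ≫ L⟩ := by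
  have hdom := congrArg Mor.dom h1
  have hcod := congrArg Mor.cod h1
  have hdom' := congrArg Mor.dom h2
  simp only at hdom hcod hdom'
  subst hdom
  subst hcod
  subst hdom'
  have e1 : (unitMor θ σ τ a).hom = L := eq_of_heq (Mor.mk.inj h1).2.2
  have e2 : (unitMor θ τ ρ b).hom = M := eq_of_heq (Mor.mk.inj h2).2.2
  rw [← unitMor_comp (τ := τ), e1, e2]
  rfl

theorem unitMor_le_comp {X Y Z : SubCat G} {L : Y ⟶ Z} {M : X ⟶ Y} {σ τ ρ : SecOf G k}
    {a b : MulAut (Cyc k)} (h1 : (unitMor θ σ τ a).Le ⟨Y, Z, L⟩)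
    (h2 : (unitMor θ τ ρ b).Le ⟨X, Y, M⟩) :
    (unitMor θ σ ρ (a * b)).Le ⟨X, Z, M ≫ L⟩ := by
  obtain ⟨L', hL, h1⟩ := le_mk_iff.1 h1
  obtain ⟨M', hM, h2⟩ := le_mk_iff.1 h2
  rw [unitMor_mul_eq h1 h2]
  refine mk_le_mk_iff.2 ?_
  rintro ⟨x, z⟩ ⟨y, hx, hz⟩
  exact ⟨y, hL hx, hM hz⟩

/-- A morphism of the given form above `t` is determined by its section at the codomain. -/
theorem unitMor_eq_of_le {t : Mor (SubCat G)} {σ τ τ' : SecOf G k} {a a' : MulAut (Cyc k)}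
    (h : (unitMor θ σ τ a).Le t) (h' : (unitMor θ σ τ' a').Le t) : τ = τ' ∧ a = a' := by
  obtain ⟨i, j, L, rfl⟩ := exists_eq_toMor t
  obtain ⟨T, hT, e⟩ := mor_le_toMor_iff.1 h
  obtain ⟨T', hT', e'⟩ := mor_le_toMor_iff.1 h'
  have h1 := (congrArg leftSec e).symm.trans ((leftSec_unitMor θ σ τ a).trans
    ((leftSec_unitMor θ σ τ' a').symm.trans (congrArg leftSec e')))
  have h2 : sec1 T = sec1 T' := eq_of_heq (Sigma.mk.inj h1).2
  rw [eq_of_mem_fullSub hT hT' (congrArg Sec.K h2), ← e'] at e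
  exact (unitMor_injective e).2

/-- A morphism below the composite is a subgroup N containing L * M; the factors T and S of
`exists_factorization` have matching middle sections and outer sections equal to those of N. -/
theorem exists_unitMor_le_of_le_comp
    {Θ : ∀ (k : Divs G) (σ : SecOf G k.1), Cyc k.1 ≃* σ.1.2.Quot} {k : Divs G}
    {X Y Z : SubCat G} {L : Y ⟶ Z} {M : X ⟶ Y} {σ ρ : SecOf G k.1} {c : MulAut (Cyc k.1)}
    (h : (unitMor (Θ k) σ ρ c).Le ⟨X, Z, M ≫ L⟩) :
    ∃ (τ : SecOf G k.1) (a b : MulAut (Cyc k.1)), a * b = c ∧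
      (unitMor (Θ k) σ τ a).Le ⟨Y, Z, L⟩ ∧ (unitMor (Θ k) τ ρ b).Le ⟨X, Y, M⟩ := by
  obtain ⟨N, hN, h1⟩ := le_mk_iff.1 h
  have hL := mem_fullSub_prod.1 L.2
  have hM := mem_fullSub_prod.1 M.2
  have hp := p2_eq_p1_of_comp L M
  have hN' : star L.1 M.1 ∈ fullSub N.1 := by
    refine ⟨hN, ?_, ?_⟩
    · rw [p1_star hp, hL.1, (mem_fullSub_prod.1 N.2).1]
    · rw [p2_star hp, hM.2, (mem_fullSub_prod.1 N.2).2]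
  obtain ⟨T, S, hT, hS, e1, e2, e3, e4⟩ := exists_factorization hp hN'
  have hTm : T ∈ fullSub (Z.sub.prod Y.sub) :=
    mem_fullSub_prod.2 ⟨hT.2.1.symm.trans hL.1, hT.2.2.symm.trans hL.2⟩
  have hSm : S ∈ fullSub (Y.sub.prod X.sub) :=
    mem_fullSub_prod.2 ⟨hS.2.1.symm.trans hM.1, hS.2.2.symm.trans hM.2⟩
  obtain ⟨k1, σ1, τ1, a, f1, f2, f3⟩ := exists_eq_unitMor Θ ⟨Y, Z, ⟨T, hTm⟩⟩
  obtain ⟨k2, σ2, τ2, b, g1, g2, g3⟩ := exists_eq_unitMor Θ ⟨X, Y, ⟨S, hSm⟩⟩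
  have hσ : σ1.1 = σ.1 := by
    rw [← leftSec_unitMor (Θ k) σ ρ c, h1, ← f1]
    exact congrArg (Sigma.mk Z.idx) e1
  have hρ : τ2.1 = ρ.1 := by
    rw [← rightSec_unitMor (Θ k) σ ρ c, h1, ← g2]
    exact congrArg (Sigma.mk X.idx) e3
  have hτ : τ1.1 = σ2.1 := by
    rw [← f2, ← g1]
    exact congrArg (Sigma.mk Y.idx) e2
  -- k is recovered from a section as the order of its quotient, so both factors belong to the same
  -- k as the composite.
  have hk1 : k1 = k := Subtype.ext (by rw [← σ1.card_quot, ← σ.card_quot, hσ])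
  have hk2 : k2 = k := Subtype.ext (by rw [← τ2.card_quot, ← ρ.card_quot, hρ])
  subst hk1
  subst hk2
  obtain rfl := Subtype.ext hσ
  obtain rfl := Subtype.ext hρ
  obtain rfl := Subtype.ext hτ
  refine ⟨τ1, a, b, ?_, ?_, ?_⟩
  · have h2 := unitMor_mul_eq f3.symm g3.symm
    rw [show (⟨S, hSm⟩ : X ⟶ Y) ≫ (⟨T, hTm⟩ : Y ⟶ Z) = N from Subtype.ext e4, ← h1] at h2
    exact (unitMor_injective h2).2.2
  · rw [← f3]; exact mk_le_mk_iff.2 hT.1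
  · rw [← g3]; exact mk_le_mk_iff.2 hS.1

end Units

/-! ### Multiplicativity and bijectivity of ω -/

section Omega

variable {ι : Type v} {G : ι → Type u} [∀ i, CommGroup (G i)] [∀ i, Finite (G i)]

theorem Divs.ne_zero (k : Divs G) : k.1 ≠ 0 := by
  obtain ⟨k, i, hk⟩ := k
  rintro rfl
  exact Nat.card_pos.ne' (Nat.eq_zero_of_zero_dvd hk)

instance (k : Divs G) : NeZero k.1 := ⟨k.ne_zero⟩

noncomputable instance (k : Divs G) : Fintype (MulAut (Cyc k.1)) :=
  have : Finite (Cyc k.1) := inferInstanceAs (Finite (ZMod k.1))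
  have : Finite (MulAut (Cyc k.1)) := DFunLike.finite _
  Fintype.ofFinite _

instance [Finite ι] : Finite (Divs G) := by
  have : Divs G = ↥{k : ℕ | ∃ i, k ∣ Nat.card (G i)} := rfl
  rw [this, Set.finite_coe_iff]
  have h : {k : ℕ | ∃ i, k ∣ Nat.card (G i)} = ⋃ i, ((Nat.card (G i)).divisors : Set ℕ) := by
    ext k; simp [Nat.card_pos.ne']
  rw [h]
  exact Set.finite_iUnion fun i => Finset.finite_toSet _

instance {A : Type u} [CommGroup A] [Finite A] : Finite (Sec A) :=
  Finite.of_injective (fun σ : Sec A => (σ.P, σ.K)) fun _ _ h =>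
    Sec.ext' (congrArg Prod.fst h) (congrArg Prod.snd h)

instance [Finite ι] (k : ℕ) : Finite (SecOf G k) :=
  inferInstanceAs (Finite {σ : Σ i, Sec (G i) // Nonempty (Cyc k ≃* σ.2.Quot)})

variable (R : Type w) [CommRing R] (enum : ∀ k : Divs G, Fin (numSec G k.1) ≃ SecOf G k.1)
  (θ : ∀ (k : Divs G) (σ : SecOf G k.1), Cyc k.1 ≃* σ.1.2.Quot)

open Classical in
theorem omegaMor_apply (s : Mor (SubCat G)) (k : Divs G) (m n : Fin (numSec G k.1)) :
    omegaMor R enum θ s k m n = ∑ a : MulAut (Cyc k.1),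
      if (unitMor (θ k) (enum k m) (enum k n) a).Le s then MonoidAlgebra.of R _ a else 0 := by
  rw [omegaMor, Matrix.of_apply, finsum_eq_sum_of_fintype]

open Classical in
theorem coeff_omegaMor (s : Mor (SubCat G)) (k : Divs G) (m n : Fin (numSec G k.1))
    (a : MulAut (Cyc k.1)) : (omegaMor R enum θ s k m n).coeff a =
      if (unitMor (θ k) (enum k m) (enum k n) a).Le s then 1 else 0 := by
  rw [omegaMor_apply, MonoidAlgebra.coeff_sum, Finsupp.finsetSum_apply, Finset.sum_eq_single a]
  · split_ifs <;> simp
  · intro b _ hb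
    split_ifs <;> simp [hb]
  · simp

variable [∀ i, IsCyclic (G i)]

/-- Entry by entry, the product sums a b over the triples (l, a, b) with the two units below the two
factors, and (l, a, b) ↦ a b is a bijection onto the automorphisms occurring in the composite. -/
theorem omegaMor_mul {X Y Z : SubCat G} (L : Y ⟶ Z) (M : X ⟶ Y) :
    omegaMor R enum θ ⟨Y, Z, L⟩ * omegaMor R enum θ ⟨X, Y, M⟩ =
      omegaMor R enum θ ⟨X, Z, M ≫ L⟩ := by
  classical
  funext k
  ext1 m n
  rw [Pi.mul_apply, Matrix.mul_apply, omegaMor_apply]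
  simp only [omegaMor_apply, Finset.sum_mul_sum]
  rw [← Finset.sum_filter]
  have h1 : ∀ (l : Fin (numSec G k.1)) (a b : MulAut (Cyc k.1)),
      ((if (unitMor (θ k) (enum k m) (enum k l) a).Le ⟨Y, Z, L⟩
        then MonoidAlgebra.of R _ a else 0) *
      (if (unitMor (θ k) (enum k l) (enum k n) b).Le ⟨X, Y, M⟩
        then MonoidAlgebra.of R _ b else 0)) =
      if (unitMor (θ k) (enum k m) (enum k l) a).Le ⟨Y, Z, L⟩ ∧
        (unitMor (θ k) (enum k l) (enum k n) b).Le ⟨X, Y, M⟩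
        then MonoidAlgebra.of R _ (a * b) else 0 := by
    intro l a b
    rw [map_mul]
    split_ifs <;> simp_all
  simp only [h1]
  calc _ = ∑ x : Fin (numSec G k.1) × MulAut (Cyc k.1) × MulAut (Cyc k.1),
        if (unitMor (θ k) (enum k m) (enum k x.1) x.2.1).Le ⟨Y, Z, L⟩ ∧
          (unitMor (θ k) (enum k x.1) (enum k n) x.2.2).Le ⟨X, Y, M⟩
          then MonoidAlgebra.of R _ (x.2.1 * x.2.2) else 0 := by
        simp only [Fintype.sum_prod_type]
    _ = _ := by
        rw [← Finset.sum_filter]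
        refine Finset.sum_bij (fun x _ => x.2.1 * x.2.2) ?_ ?_ ?_ fun _ _ => rfl
        · rintro ⟨l, a, b⟩ h
          rw [Finset.mem_filter] at h ⊢
          exact ⟨Finset.mem_univ _, unitMor_le_comp h.2.1 h.2.2⟩
        · rintro ⟨l, a, b⟩ h ⟨l', a', b'⟩ h' e
          rw [Finset.mem_filter] at h h'
          -- The left factor and the row m already determine l and a; then b follows by
          -- cancellation.
          obtain ⟨e1, rfl⟩ := unitMor_eq_of_le h.2.1 h'.2.1
          obtain rfl := (enum k).injective e1
          obtain rfl : b = b' := mul_left_cancel e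
          rfl
        · intro c hc
          rw [Finset.mem_filter] at hc
          obtain ⟨τ, a, b, rfl, h2, h3⟩ := exists_unitMor_le_of_le_comp hc.2
          refine ⟨((enum k).symm τ, a, b), ?_, rfl⟩
          rw [Finset.mem_filter]
          simp only [Equiv.apply_symm_apply]
          exact ⟨Finset.mem_univ _, h2, h3⟩

theorem omegaMor_mul_of_ne {X Y Y' Z : SubCat G} (h : Y' ≠ Y) (L : Y ⟶ Z) (M : X ⟶ Y') :
    omegaMor R enum θ ⟨Y, Z, L⟩ * omegaMor R enum θ ⟨X, Y', M⟩ = 0 := by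
  classical
  funext k
  ext1 m n
  rw [Pi.mul_apply, Matrix.mul_apply]
  refine Finset.sum_eq_zero fun l _ => ?_
  rw [omegaMor_apply, omegaMor_apply, Finset.sum_mul_sum]
  refine Finset.sum_eq_zero fun a _ => Finset.sum_eq_zero fun b _ => ?_
  by_cases h1 : (unitMor (θ k) (enum k m) (enum k l) a).Le ⟨Y, Z, L⟩
  · by_cases h2 : (unitMor (θ k) (enum k l) (enum k n) b).Le ⟨X, Y', M⟩
    · obtain ⟨_, _, h1⟩ := le_mk_iff.1 h1
      obtain ⟨_, _, h2⟩ := le_mk_iff.1 h2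
      exact absurd ((congrArg Mor.cod h2).symm.trans (congrArg Mor.dom h1)) h
    · rw [if_neg h2, mul_zero]
  · rw [if_neg h1, zero_mul]

/-- In the coordinates of the target indexed by morphisms, ω sends s to the indicator function of
the t ≤ s, hence is a zeta transform and bijective. -/
theorem exists_omega [Finite ι] : ∃ ω : CatAlg R (SubCat G) ≃ₐ[R] MatProd G R,
    ∀ s : Mor (SubCat G), ω (TwistedAlg.basis _ s) = omegaMor R enum θ s := by
  classical
  let f : CatAlg R (SubCat G) →ₗ[R] MatProd G R := TwistedAlg.lin _ (omegaMor R enum θ)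
  have hf : ∀ s, f (TwistedAlg.basis _ s) = omegaMor R enum θ s := TwistedAlg.lin_basis _ _
  choose k σ τ a _ _ hu using exists_eq_unitMor θ
  -- The order is reversed because ω runs over the t below s, whereas the zeta transform of s is
  -- supported on the t above s.
  let E : MatProd G R →ₗ[R] ((Mor (SubCat G))ᵒᵈ → R) :=
    { toFun := fun x t => (x (k t) ((enum _).symm (σ t)) ((enum _).symm (τ t))).coeff (a t)
      map_add' := fun _ _ => rfl
      map_smul' := fun _ _ => rfl }
  have hE : Function.Injective E := by
    intro x y h
    -- The parameters chosen for a unit morphism equal the given ones only after an identification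
    -- of k, on which their types depend; with all of them general, the equality can be eliminated.
    have key : ∀ {k' : Divs G} {m n : Fin (numSec G k'.1)} {a' : MulAut (Cyc k'.1)}
        {k₁ : Divs G} {σ₁ τ₁ : SecOf G k₁.1} {a₁ : MulAut (Cyc k₁.1)},
        unitMor (θ k') (enum k' m) (enum k' n) a' = unitMor (θ k₁) σ₁ τ₁ a₁ →
        (x k₁ ((enum k₁).symm σ₁) ((enum k₁).symm τ₁)).coeff a₁ =
          (y k₁ ((enum k₁).symm σ₁) ((enum k₁).symm τ₁)).coeff a₁ →
        (x k' m n).coeff a' = (y k' m n).coeff a' := by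
      intro k' m n a' k₁ σ₁ τ₁ a₁ e h
      have e1 := congrArg leftSec e
      rw [leftSec_unitMor, leftSec_unitMor] at e1
      obtain rfl : k' = k₁ :=
        Subtype.ext (by rw [← (enum k' m).card_quot, ← σ₁.card_quot, e1])
      obtain ⟨rfl, rfl, rfl⟩ := unitMor_injective e
      rwa [Equiv.symm_apply_apply, Equiv.symm_apply_apply] at h
    funext k'
    ext m n a'
    have h1 := congrFun h (unitMor (θ k') (enum k' m) (enum k' n) a')
    exact key (hu (unitMor (θ k') (enum k' m) (enum k' n) a')) h1
  have hc : ∀ s t : Mor (SubCat G),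
      (omegaMor R enum θ s (k t) ((enum _).symm (σ t)) ((enum _).symm (τ t))).coeff (a t) =
        if t.Le s then 1 else 0 := by
    intro s t
    rw [coeff_omegaMor, Equiv.apply_symm_apply, Equiv.apply_symm_apply]
    exact if_congr (by rw [← hu t]) rfl rfl
  have hEf : E ∘ₗ f = zetaTransform R (Mor (SubCat G))ᵒᵈ := TwistedAlg.linearMap_ext fun s => by
    ext t
    refine Eq.trans ?_ (zetaTransform_single (X := (Mor (SubCat G))ᵒᵈ) s t).symm
    rw [LinearMap.comp_apply, hf]
    refine (hc s t).trans ?_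
    rfl
  have hbij : Function.Bijective (E ∘ f) := by
    have := zetaTransform_bijective R (Mor (SubCat G))ᵒᵈ
    rw [← hEf] at this
    exact this
  have hfbij : Function.Bijective f := by
    refine ⟨hbij.1.of_comp, fun x => ?_⟩
    obtain ⟨c, hc⟩ := hbij.2 (E x)
    exact ⟨c, hE hc⟩
  obtain ⟨e, he⟩ := exists_algEquiv_of_bijective f hfbij
    (TwistedAlg.map_mul_of_basis f (by
      rintro ⟨Y, Z, L⟩ ⟨X, Y', M⟩
      rw [hf, hf]
      by_cases h : Y' = Y
      · subst h
        rw [TwistedAlg.basisMul_comp, map_smul, hf, omegaMor_mul]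
        exact one_smul R _
      · rw [TwistedAlg.basisMul_zero _ h, map_zero, omegaMor_mul_of_ne R enum θ h]))
  exact ⟨e, fun s => (he _).trans (hf s)⟩

end Omega

/-! ### Semisimplicity of the matrix product -/

section Semisimple

variable {ι : Type v} [Finite ι] (G : ι → Type u) [∀ i, CommGroup (G i)] [∀ i, Finite (G i)]

/-- |Aut(C_k)| = φ(k) divides some φ(|G i|), hence is nonzero in R, and Maschke's theorem applies.
Matrix rings and finite products preserve semisimplicity. -/
theorem isSemisimpleRing_matProd (R : Type w) [CommRing R] (hR : IsField R)
    (hφ : ∀ i, IsUnit (Nat.totient (Nat.card (G i)) : R)) : IsSemisimpleRing (MatProd G R) := by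
  have h : ∀ k : Divs G, IsSemisimpleRing (MonoidAlgebra R (MulAut (Cyc k.1))) := by
    intro k
    let := hR.toField
    have hc : Nat.card (MulAut (Cyc k.1)) = Nat.totient k.1 := by
      have : Finite (Cyc k.1) := inferInstanceAs (Finite (ZMod k.1))
      rw [IsCyclic.card_mulAut]
      exact congrArg _ (Nat.card_zmod k.1)
    have : NeZero (Nat.card (MulAut (Cyc k.1)) : R) := ⟨by
      rw [hc]
      obtain ⟨i, hi⟩ := k.2
      exact (isUnit_of_natCast_dvd (Nat.totient_dvd_of_dvd hi) (hφ i)).ne_zero⟩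
    infer_instance
  infer_instance

end Semisimple

end DoubleBurnside

/-! ### The chain of isomorphisms -/

open DoubleBurnside in
theorem mainTheorem1 {ι : Type v} [Fintype ι] [DecidableEq ι]
    (G : ι → Type u) [∀ i, CommGroup (G i)] [∀ i, Finite (G i)] [∀ i, IsCyclic (G i)]
    (R : Type w) [CommRing R]
    (hG : ∀ i, IsUnit (Nat.card (G i) : R))
    (hφ : ∀ i, IsUnit (Nat.totient (Nat.card (G i)) : R)) :
    (∃ Λ : TwoCocycle R (SubCat G),
      (∀ (X Y Z : SubCat G) (L : Y ⟶ Z) (M : X ⟶ Y), (Λ.toFun L M : R) = lam R L.1 M.1) ∧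
      ∃ (γ : BAlg R G ≃ₐ[R] ATilde R G hG)
        (δ : ATilde R G hG ≃ₐ[R] TwistedAlg Λ)
        (ε : TwistedAlg Λ ≃ₐ[R] CatAlg R (SubCat G)),
        (∀ (a : BAlg R G) (i j : ι),
          γ a i j = zetaMap R (G i × G j) (alphaMap R (G i) (G j) (a i j))) ∧
        (∀ (i j : ι) (L : Subgroup (G i × G j)),
          δ (LinCat.of i j (hat R L)) = TwistedAlg.basis Λ (toMor L)) ∧
        (∀ s : Mor (SubCat G),
          ε (TwistedAlg.basis Λ s) = mu R s.hom.1 • TwistedAlg.basis _ s)) ∧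
    (∀ (enum : ∀ k : Divs G, Fin (numSec G k.1) ≃ SecOf G k.1)
      (θ : ∀ (k : Divs G) (σ : SecOf G k.1), Cyc k.1 ≃* σ.1.2.Quot),
      ∃ ω : CatAlg R (SubCat G) ≃ₐ[R] MatProd G R,
        ∀ s : Mor (SubCat G), ω (TwistedAlg.basis _ s) = omegaMor R enum θ s) ∧
    Nonempty (BAlg R G ≃ₐ[R] MatProd G R) ∧
    (IsField R → IsSemisimpleRing (BAlg R G)) := by
  obtain ⟨γ, hγ⟩ := exists_gamma G R hG
  obtain ⟨δ, hδ⟩ := exists_delta G R hG hφ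
  obtain ⟨ε, hε⟩ := exists_epsilon G R hG hφ
  -- For the composite isomorphism any numbering of the sections and any choice of the θ will do.
  obtain ⟨ω, _⟩ := exists_omega R (fun k : Divs G => (Finite.equivFin (SecOf G k.1)).symm)
    (fun _ σ => σ.2.some)
  let e := ((γ.trans δ).trans ε).trans ω
  refine ⟨⟨lamCocycle G R hG hφ, fun _ _ _ L M => lamCocycle_apply G R hG hφ L M,
    γ, δ, ε, hγ, hδ, hε⟩, fun enum θ => exists_omega R enum θ, ⟨e⟩, fun hR => ?_⟩
  have := isSemisimpleRing_matProd G R hR hφ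
  exact e.symm.toRingEquiv.isSemisimpleRing
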